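/- Let $\Omega\subset\mathbb R^3$ be a bounded open set with $C^\infty$ boundary (locally $\Omega=\{\rho<0\}$ with $\rho$ smooth, $\nabla\rho\ne0$ on $\partial\Omega$), with outward unit normal $n$ and surface area $dS$; let $\tau>0$, $\nu\ge 0$. Repeated indices are summed. Let $u^s,w^s$ be prescribed vector fields (the surface values) on $[0,\tau]\times\partial\Omega$ that are restrictions of vector fields which are continuous with continuous first spatial derivatives. For vector fields $u,w$ and scalars $p,r$ on $[0,\tau]\times\overline\Omega$ put $$J(u,p,w,r)=\int_0^\tau\!\!\int_\Omega\mathscr L\,dx\,dt,\qquad I=J+\int_0^\tau\!\!\int_{\partial\Omega}\mathscr M_jn_j\,dS\,dt ,$$ $$\begin{aligned}\mathscr L={}&\tfrac\nu2(\partial_ju_i)^2+\tfrac12(w_i+u_i)u_j\partial_jw_i+u_i\partial_ip+\tfrac12u_i\partial_tw_i\\&-\tfrac\nu2(\partial_jw_i)^2-\tfrac12(u_i+w_i)w_j\partial_ju_i-w_i\partial_ir-\tfrac12w_i\partial_tu_i,\end{aligned}$$ $$\begin{aligned}\mathscr M_j={}&-u^s_jp+w^s_jr+\tfrac14(u_ju_i^2+u_i^2w_j)-\tfrac14(w_jw_i^2+w_i^2u_j)\\&+\nu\bigl[-(u_i-u_i^s)\partial_ju_i+(w_i-w_i^s)\partial_jw_i+\varepsilon_{ijk}(w_k-w_k^s-u_k+u_k^s)\,\partial_i|u-u^s+w-w^s|\bigr].\end{aligned}$$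 (In $n_j\mathscr M_j$ the last term contains only derivatives tangential to $\partial\Omega$; where $u-u^s+w-w^s=0$ that derivative is taken to be $0$.) Let $g$ be a vector field on $\overline\Omega$ and $x_0\in\partial\Omega$. Call $(u,p,w,r)$ admissible if * $u,w$ have continuous spatial derivatives up to order two and a continuous first time derivative, and $p,r$ are continuous with continuous first spatial derivatives (all up to the boundary); * $u=w=g$ on $\overline\Omega$ at $t=0$; * $u=w$ on $\overline\Omega$ at $t=\tau$; * $u=w$ at the single boundary point $x_0$ for all $t\in[0,\tau]$. No values of $u,w,p,r$ are prescribed elsewhere on $\partial\Omega$. Let $(u,p,w,r)$ be admissible and let $I$ be stationary there: $\frac{d}{d\epsilon}\big|_{\epsilon=0}I(u+\epsilon\,\delta u,\,p+\epsilon\,\delta p,\,w+\epsilon\,\delta w,\,r+\epsilon\,\delta r)=0$ for all variations which have the same regularity, satisfy $\delta u=\delta w=0$ at $t=0$, $\delta u=\delta w$ at $t=\tau$ and at $x_0$, and satisfy in addition $\delta u+\delta w=0$ on $[0,\tau]\times\partial\Omega$. Then the following hold. 1. On $[0,\tau]\times\overline\Omega$: $\partial_iu_i=0$, $\partial_iw_i=0$,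 $$\nu\Delta u_i-\partial_ip=\partial_tw_i+\tfrac{u_j+w_j}2(\partial_jw_i+\partial_iw_j),\qquad \nu\Delta w_i-\partial_ir=\partial_tu_i+\tfrac{u_j+w_j}2(\partial_ju_i+\partial_iu_j).$$ Consequently $v=\frac{u+w}2$ satisfies the Navier–Stokes equations $$\partial_tv-\nu\Delta v+(v\cdot\nabla)v+\nabla q=0,\qquad \nabla\cdot v=0,\qquad q=\tfrac{p+r}2+\tfrac12|v|^2,$$ and $\tilde v=\frac{u-w}2$, $\tilde q=\frac{p-r}2$ satisfy the adjoint system $$\nu\Delta\tilde v_i-\partial_i\tilde q=-\partial_t\tilde v_i-v_j(\partial_j\tilde v_i+\partial_i\tilde v_j),\qquad \nabla\cdot\tilde v=0.$$ 2. On $[0,\tau]\times\partial\Omega$: $n\cdot(u-u^s)=0$ and $n\cdot(w-w^s)=0$, and if $\nu\neq0$ then $u=u^s$ and $w=w^s$. In particular: * if $w^s=0$ on $\partial\Omega$, then $n\cdot w=0$, and $w=0$ on $\partial\Omega$ if $\nu\ne0$; * if $w^s=u^s$ on $\partial\Omega$, then the Navier–Stokes velocity $v$ and the adjoint velocity $\tilde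 v$ satisfy $n\cdot(v-u^s)=0$ and $n\cdot\tilde v=0$, and $v=u^s$, $\tilde v=0$ on $\partial\Omega$ if $\nu\neq0$. -/

import Mathlib

open MeasureTheory Set Filter Topology

noncomputable section

namespace ExtendedNS

/-- Physical space `ℝ³` with the Euclidean norm. -/
abbrev E3 : Type := EuclideanSpace ℝ (Fin 3)

/-! ### Geometry of the flow domain -/

/-- `ρ` is a smooth function with nonvanishing gradient at `x`, and near `x` the set `Ω` is
`{ρ < 0}`. -/
def IsDefiningFunctionAt (Ω : Set E3) (x : E3) (ρ : E3 → ℝ) : Prop :=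
  ContDiff ℝ ((⊤ : ℕ∞) : WithTop ℕ∞) ρ ∧ gradient ρ x ≠ 0 ∧ ∀ᶠ y in 𝓝 x, (y ∈ Ω ↔ ρ y < 0)

/-- The boundary of `Ω` is a `C^∞` surface with `Ω` locally on one side of it. -/
def HasSmoothBoundary (Ω : Set E3) : Prop :=
  ∀ x ∈ frontier Ω, ∃ ρ : E3 → ℝ, IsDefiningFunctionAt Ω x ρ

open Classical in
/-- The outward unit normal `∇ρ / |∇ρ|` at a boundary point. At a point of the boundary of an
open set it does not depend on the defining function `ρ`. -/
def outwardNormal (Ω : Set E3) (x : E3) : E3 :=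
  if h : ∃ ρ : E3 → ℝ, IsDefiningFunctionAt Ω x ρ then
    ‖gradient h.choose x‖⁻¹ • gradient h.choose x
  else 0

/-- Surface area on `∂Ω`: the two-dimensional Hausdorff measure, normalized so as to agree with
Lebesgue measure on planes, restricted to `∂Ω`. -/
def surfaceArea (Ω : Set E3) : Measure E3 :=
  (MeasureTheory.Measure.euclideanHausdorffMeasure 2).restrict (frontier Ω)

/-! ### Coordinates -/

/-- The partial derivative `∂f/∂x_j`. -/
def pd (f : E3 → ℝ) (j : Fin 3) (x : E3) : ℝ :=
  fderiv ℝ f x (EuclideanSpace.single j 1)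

/-- The spatial derivative `∂u_i/∂x_j` of a time-dependent vector field. -/
def dx (u : ℝ → E3 → E3) (i j : Fin 3) (t : ℝ) (x : E3) : ℝ :=
  pd (fun y => u t y i) j x

/-- The time derivative `∂u_i/∂t` of a time-dependent vector field. -/
def dt (u : ℝ → E3 → E3) (i : Fin 3) (t : ℝ) (x : E3) : ℝ :=
  deriv (fun s => u s x i) t

/-- The Laplacian `∂²u_i/∂x_j∂x_j` of the `i`-th component of a time-dependent vector field. -/
def lap (u : ℝ → E3 → E3) (i : Fin 3) (t : ℝ) (x : E3) : ℝ :=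
  ∑ j, pd (fun y => dx u i j t y) j x

/-- The permutation symbol `ε_{ijk}`, with indices running through `0, 1, 2`. -/
def permSymbol (i j k : Fin 3) : ℝ :=
  (((j : ℕ) : ℝ) - ((i : ℕ) : ℝ)) * (((k : ℕ) : ℝ) - ((i : ℕ) : ℝ)) *
    (((k : ℕ) : ℝ) - ((j : ℕ) : ℝ)) / 2

/-! ### Regularity up to the boundary

Functions on `[0, τ] × (Ω ∪ ∂Ω)` with continuous derivatives up to the boundary are represented
by functions on `ℝ × ℝ³` with continuous derivatives. Everything below uses only the values for
`t ∈ [0, τ]` and `x ∈ Ω ∪ ∂Ω`. -/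

/-- Continuous, with continuous first order spatial derivatives. -/
def SpaceC1 {F : Type*} [NormedAddCommGroup F] [NormedSpace ℝ F] (p : ℝ → E3 → F) : Prop :=
  Continuous (fun z : ℝ × E3 => p z.1 z.2) ∧
  (∀ t, ContDiff ℝ 1 (p t)) ∧
  Continuous (fun z : ℝ × E3 => fderiv ℝ (p z.1) z.2)

/-- Continuous, with continuous spatial derivatives up to the second order and a continuous first
order time derivative. -/
def SpaceC2TimeC1 (u : ℝ → E3 → E3) : Prop :=
  Continuous (fun z : ℝ × E3 => u z.1 z.2) ∧
  (∀ t, ContDiff ℝ 2 (u t)) ∧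
  Continuous (fun z : ℝ × E3 => fderiv ℝ (u z.1) z.2) ∧
  Continuous (fun z : ℝ × E3 => fderiv ℝ (fderiv ℝ (u z.1)) z.2) ∧
  (∀ x, Differentiable ℝ (fun t => u t x)) ∧
  Continuous (fun z : ℝ × E3 => deriv (fun s => u s z.2) z.1)

/-! ### The functional -/

/-- The arguments `(u, p, w, r)` of the functionals. -/
structure Fields where
  u : ℝ → E3 → E3
  p : ℝ → E3 → ℝ
  w : ℝ → E3 → E3
  r : ℝ → E3 → ℝ

/-- The one-parameter family `s + ε • d`. -/
def Fields.perturb (s d : Fields) (ε : ℝ) : Fields where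
  u := fun t x => s.u t x + ε • d.u t x
  p := fun t x => s.p t x + ε * d.p t x
  w := fun t x => s.w t x + ε • d.w t x
  r := fun t x => s.r t x + ε * d.r t x

/-- Condition (i): the regularity of the fields. -/
def Fields.Regular (s : Fields) : Prop :=
  SpaceC2TimeC1 s.u ∧ SpaceC2TimeC1 s.w ∧ SpaceC1 s.p ∧ SpaceC1 s.r

/-- The Lagrangian density `ℒ(u, p, w, r)`. -/
def lagrangian (ν : ℝ) (s : Fields) (t : ℝ) (x : E3) : ℝ :=
  (ν / 2 * ∑ i, ∑ j, (dx s.u i j t x) ^ 2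
    + 1 / 2 * ∑ i, ∑ j, (s.w t x i + s.u t x i) * s.u t x j * dx s.w i j t x
    + ∑ i, s.u t x i * pd (s.p t) i x
    + ∑ i, s.u t x i / 2 * dt s.w i t x)
  - (ν / 2 * ∑ i, ∑ j, (dx s.w i j t x) ^ 2
    + 1 / 2 * ∑ i, ∑ j, (s.u t x i + s.w t x i) * s.w t x j * dx s.u i j t x
    + ∑ i, s.w t x i * pd (s.r t) i x
    + ∑ i, s.w t x i / 2 * dt s.u i t x)

/-- The functional `J(u, p, w, r) = ∫₀^τ ∫_Ω ℒ dx dt`. -/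
def functionalJ (ν τ : ℝ) (Ω : Set E3) (s : Fields) : ℝ :=
  ∫ t in (0 : ℝ)..τ, ∫ x in Ω, lagrangian ν s t x

/-- The surface density `ℳ_j(u, p, w, r)`, where `us`, `ws` are the prescribed surface values
`u^s`, `w^s`. They are given as `C¹` functions on all of space. In `n_j ℳ_j` only their values on
`∂Ω` matter, because `n_j ε_{ijk} ∂/∂x_i` is a derivative tangential to `∂Ω`. -/
def surfaceDensity (ν : ℝ) (us ws : ℝ → E3 → E3) (s : Fields) (j : Fin 3) (t : ℝ) (x : E3) : ℝ :=
  -(us t x j) * s.p t x + ws t x j * s.r t x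
  + (∑ i, (s.u t x j * (s.u t x i) ^ 2 + (s.u t x i) ^ 2 * s.w t x j)) / 4
  - (∑ i, (s.w t x j * (s.w t x i) ^ 2 + (s.w t x i) ^ 2 * s.u t x j)) / 4
  + ν * (∑ i, (-(s.u t x i - us t x i) * dx s.u i j t x
              + (s.w t x i - ws t x i) * dx s.w i j t x)
      + ∑ i, ∑ k, permSymbol i j k *
          (s.w t x k - ws t x k - s.u t x k + us t x k) *
          pd (fun y => ‖s.u t y - us t y + s.w t y - ws t y‖) i x)

/-- The extended functional `I = J + ∫₀^τ ∫_{∂Ω} ℳ_j n_j dS dt`. -/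
def functionalI (ν τ : ℝ) (Ω : Set E3) (us ws : ℝ → E3 → E3) (s : Fields) : ℝ :=
  functionalJ ν τ Ω s +
    ∫ t in (0 : ℝ)..τ, ∫ x, (∑ j, surfaceDensity ν us ws s j t x * outwardNormal Ω x j)
      ∂(surfaceArea Ω)

/-! ### Admissible fields, variations and stationarity -/

/-- The class of admissible fields: regularity, prescribed common initial values `g`, equal final
values, and `u = w` at the single boundary point `x₀`. -/
def Admissible (τ : ℝ) (Ω : Set E3) (g : E3 → E3) (x₀ : E3) (s : Fields) : Prop :=
  s.Regular ∧
  (∀ x ∈ closure Ω, s.u 0 x = g x ∧ s.w 0 x = g x) ∧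
  (∀ x ∈ closure Ω, s.u τ x = s.w τ x) ∧
  (∀ t ∈ Icc 0 τ, s.u t x₀ = s.w t x₀)

/-- The directions `(δu, δp, δw, δr)` of the class of admissible fields for which in addition
`δu + δw = 0` on `∂Ω`. -/
def IsVariation (τ : ℝ) (Ω : Set E3) (x₀ : E3) (d : Fields) : Prop :=
  Admissible τ Ω (fun _ => 0) x₀ d ∧
  (∀ t ∈ Icc 0 τ, ∀ x ∈ frontier Ω, d.u t x + d.w t x = 0)

/-- `δI = 0` at `s`: the first variation of `I` exists and is zero in every direction. -/
def IsStationary (ν τ : ℝ) (Ω : Set E3) (us ws : ℝ → E3 → E3) (x₀ : E3) (s : Fields) : Prop :=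
  ∀ d : Fields, IsVariation τ Ω x₀ d →
    HasDerivAt (fun ε : ℝ => functionalI ν τ Ω us ws (s.perturb d ε)) 0 0

/-! ### The equations of motion -/

/-- The mean velocity `(u + w) / 2`. -/
def Fields.meanVelocity (s : Fields) : ℝ → E3 → E3 :=
  fun t x => (2⁻¹ : ℝ) • (s.u t x + s.w t x)

/-- The difference velocity `(u - w) / 2`. -/
def Fields.diffVelocity (s : Fields) : ℝ → E3 → E3 :=
  fun t x => (2⁻¹ : ℝ) • (s.u t x - s.w t x)

/-- The pressure `(p + r) / 2 + |v|² / 2` that belongs to the mean velocity `v`. -/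
def Fields.meanPressure (s : Fields) : ℝ → E3 → ℝ :=
  fun t x => (s.p t x + s.r t x) / 2 + ‖s.meanVelocity t x‖ ^ 2 / 2

/-- The difference pressure `(p - r) / 2`. -/
def Fields.diffPressure (s : Fields) : ℝ → E3 → ℝ :=
  fun t x => (s.p t x - s.r t x) / 2

/-- The Navier-Stokes equations (unit density, no body force) for velocity `v` and pressure `q`
on `[0, τ] × (Ω ∪ ∂Ω)`. -/
def NavierStokes (ν τ : ℝ) (Ω : Set E3) (v : ℝ → E3 → E3) (q : ℝ → E3 → ℝ) : Prop :=
  ∀ t ∈ Icc 0 τ, ∀ x ∈ closure Ω,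
    (∑ i, dx v i i t x = 0) ∧
    ∀ i, dt v i t x - ν * lap v i t x + ∑ j, v t x j * dx v i j t x + pd (q t) i x = 0

/-- The system adjoint to the Navier-Stokes equations linearized at `v`, for the adjoint velocity
`z` and the adjoint pressure `q`, on `[0, τ] × (Ω ∪ ∂Ω)`. -/
def AdjointSystem (ν τ : ℝ) (Ω : Set E3) (v z : ℝ → E3 → E3) (q : ℝ → E3 → ℝ) : Prop :=
  ∀ t ∈ Icc 0 τ, ∀ x ∈ closure Ω,
    (∑ i, dx z i i t x = 0) ∧
    ∀ i, ν * lap z i t x - pd (q t) i x =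
      -dt z i t x - ∑ j, v t x j * (dx z i j t x + dx z j i t x)

/-- The coupled Euler-Lagrange equations for `(u, p, w, r)` on `[0, τ] × (Ω ∪ ∂Ω)`. -/
def EulerLagrange (ν τ : ℝ) (Ω : Set E3) (s : Fields) : Prop :=
  ∀ t ∈ Icc 0 τ, ∀ x ∈ closure Ω,
    (∑ i, dx s.u i i t x = 0) ∧
    (∑ i, dx s.w i i t x = 0) ∧
    (∀ i, ν * lap s.u i t x - pd (s.p t) i x = dt s.w i t x +
      ∑ j, (s.u t x j + s.w t x j) / 2 * (dx s.w i j t x + dx s.w j i t x)) ∧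
    (∀ i, ν * lap s.w i t x - pd (s.r t) i x = dt s.u i t x +
      ∑ j, (s.u t x j + s.w t x j) / 2 * (dx s.u i j t x + dx s.u j i t x))

/-- The natural boundary conditions on `∂Ω` for a velocity `v` with surface values `vs`:
`n · (v - vs) = 0`, and `v = vs` if `ν ≠ 0`. -/
def NaturalBoundaryCondition (ν τ : ℝ) (Ω : Set E3) (v vs : ℝ → E3 → E3) : Prop :=
  ∀ t ∈ Icc 0 τ, ∀ x ∈ frontier Ω,
    (∑ i, outwardNormal Ω x i * (v t x i - vs t x i) = 0) ∧ (ν ≠ 0 → v t x = vs t x)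

end ExtendedNS

end

/-! Two families of variations suffice. For `δp = θ(t) ψ(x)` stationarity gives, after removal of
`θ`, `∫_Ω u·∇ψ = ∫_∂Ω (u^s·n) ψ` for every `t`. Functions `ψ` supported in `Ω` force `div u = 0`,
and then functions `ψ` concentrating at a boundary point force `n·(u - u^s) = 0`.

For `δu = θ(t) φ(x) e_i` let `φ = 0` on `∂Ω` and `θ = 0` at `0` and `τ`; with `δw = 0` this meets
every constraint, the one at `x₀` included. On `∂Ω` the values of `u` are unchanged and `∇φ` is
parallel to `n`. Of `n_j ℳ_j` only the viscous term therefore varies: the derivative of the norm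
changes by a multiple of `n`, which `ε_{ijk}` contracted with `n_j` annihilates. Integration by
parts in `t` and `x`, using `div w = 0`, gives `∫_Ω φ R_i = ∫_∂Ω ν (u_i - u_i^s) ∂φ/∂n`, where `R_i`
is the momentum residual. Interior `φ` give `R_i = 0`. Then `φ = ρ ψ`, with `ρ` a defining function,
has normal derivative `|∇ρ| ψ`, so `u = u^s` if `ν ≠ 0`.

The statements about `(w, r)` follow by symmetry: exchanging `(u, p, u^s)` with `(w, r, w^s)`
changes the sign of `I` (`functionalI_swap`). Half the sum and half the difference of the two
momentum equations are the Navier–Stokes and the adjoint system.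

The divergence theorem enters in an approximate local form with frozen normal
(`exists_nhds_divergence`): for `F` supported near `x ∈ ∂Ω`, `∫_Ω ∂_j F` equals `n_j(x) ∫_∂Ω F` up
to `η ∫_∂Ω |F|`. This is enough, since test functions may shrink to `x` while `η → 0`
(`eq_zero_of_boundary_test`), and it is exact when `F = 0` on `∂Ω`. It holds because the boundary is
locally a nearly flat graph, on which Hausdorff measure and flat area differ by a factor close to
`1`. -/

namespace ExtendedNS

/-! ### Comparison of measures and oblique coordinates -/

section Hausdorff

variable {X Y : Type*} [MetricSpace X] [MeasurableSpace X] [BorelSpace X]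
  [MetricSpace Y] [MeasurableSpace Y] [BorelSpace Y]

theorem euclideanHausdorffMeasure_image_le {K : NNReal} {f : X → Y} {s : Set X}
    (h : LipschitzOnWith K f s) (d : ℕ) :
    Measure.euclideanHausdorffMeasure d (f '' s) ≤
      (K : ENNReal) ^ d * Measure.euclideanHausdorffMeasure d s := by
  rw [Measure.euclideanHausdorffMeasure_def, Measure.euclideanHausdorffMeasure_def,
    Measure.smul_apply, Measure.smul_apply]
  have := h.hausdorffMeasure_image_le (d := d) (by positivity)
  rw [ENNReal.rpow_natCast] at this
  simp only [ENNReal.smul_def, smul_eq_mul]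
  rw [mul_left_comm]
  gcongr

end Hausdorff

/-- Oblique coordinates `x₀ + y + s a`, with `y` orthogonal to the unit vector `e` and
`⟪e, a⟫ = 1`, preserve volume. -/
theorem measurePreserving_oblique {e a : E3} (he : ‖e‖ = 1) (ha : inner ℝ e a = 1) (x₀ : E3) :
    MeasurePreserving (fun q : ℝ × (Submodule.span ℝ {e})ᗮ => x₀ + (q.2 : E3) + q.1 • a) := by
  set s := Submodule.span ℝ {e}
  have h1 := (s.measurePreserving_measurableEquivProd x₀).symm
  rw [InnerProductSpace.euclideanHausdorffMeasure_eq_volume] at h1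
  let ι := LinearIsometryEquiv.toSpanUnitSingleton (𝕜 := ℝ) e he
  have h2 : MeasurePreserving ι := ι.measurePreserving
  -- With `a = e + b` and `b` orthogonal to `e`, the oblique coordinates are orthogonal ones
  -- preceded by the shear `y ↦ y + t b`, which translates each slice.
  let b : sᗮ := ⟨a - e, by
    rw [Submodule.mem_orthogonal_singleton_iff_inner_right]
    simp [inner_sub_right, ha, he]⟩
  have h3 : MeasurePreserving (fun q : ℝ × sᗮ => (q.1, q.1 • b + q.2)) :=
    (MeasurePreserving.id (volume : Measure ℝ)).skew_product
      (g := fun t y => t • b + y) (by unfold Function.uncurry; fun_prop)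
      (ae_of_all _ fun t => (measurePreserving_add_left volume (t • b)).map_eq)
  have h4 : MeasurePreserving (Prod.map ι id : ℝ × sᗮ → s × sᗮ) := h2.prod (MeasurePreserving.id _)
  convert h1.comp (h4.comp h3) using 1
  ext1 q
  simp [ι, b, s]
  module

/-- For nonnegative integrands the two comparisons give the bound, because `(1 - η)(1 + η) ≤ 1`. A
signed `f` is half the difference of `|f| + f` and `|f| - f`, whose sum is `2|f|`, so the constant
`η` is kept. -/
theorem abs_integral_sub_integral_le {X : Type*} [MeasurableSpace X] {m₁ m₂ : Measure X}
    {c : NNReal} {η : ℝ} (hη : (c : ℝ) = 1 + η) (hη0 : 0 ≤ η)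
    (h12 : m₁ ≤ c • m₂) (h21 : m₂ ≤ c • m₁) {f : X → ℝ}
    (hf₁ : Integrable f m₁) (hf₂ : Integrable f m₂) :
    |∫ x, f x ∂m₁ - ∫ x, f x ∂m₂| ≤ η * ∫ x, |f x| ∂m₂ := by
  have key : ∀ h : X → ℝ, (∀ x, 0 ≤ h x) → Integrable h m₁ → Integrable h m₂ →
      |∫ x, h x ∂m₁ - ∫ x, h x ∂m₂| ≤ η * ∫ x, h x ∂m₂ := by
    intro h h0 i1 i2
    have e1 : ∫ x, h x ∂m₁ ≤ (1 + η) * ∫ x, h x ∂m₂ := by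
      have := integral_mono_measure h12 (ae_of_all _ h0) (i2.smul_measure_nnreal)
      rwa [integral_smul_nnreal_measure, NNReal.smul_def, hη, smul_eq_mul] at this
    have e2 : ∫ x, h x ∂m₂ ≤ (1 + η) * ∫ x, h x ∂m₁ := by
      have := integral_mono_measure h21 (ae_of_all _ h0) (i1.smul_measure_nnreal)
      rwa [integral_smul_nnreal_measure, NNReal.smul_def, hη, smul_eq_mul] at this
    have p1 : 0 ≤ ∫ x, h x ∂m₁ := integral_nonneg h0
    have p2 : 0 ≤ ∫ x, h x ∂m₂ := integral_nonneg h0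
    rw [abs_le]
    constructor
    · by_contra! hc
      nlinarith
    · linarith
  have k1 := key (fun x => |f x| + f x) (fun x => by linarith [neg_abs_le (f x)])
    (hf₁.abs.add hf₁) (hf₂.abs.add hf₂)
  have k2 := key (fun x => |f x| - f x) (fun x => by linarith [le_abs_self (f x)])
    (hf₁.abs.sub hf₁) (hf₂.abs.sub hf₂)
  rw [integral_add hf₁.abs hf₁, integral_add hf₂.abs hf₂] at k1
  rw [integral_sub hf₁.abs hf₁, integral_sub hf₂.abs hf₂] at k2
  rw [abs_le] at *
  constructor <;> linarith [k1.1, k1.2, k2.1, k2.2]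

/-! ### Defining functions and the outward normal -/

theorem inner_gradient (ρ : E3 → ℝ) (x v : E3) : inner ℝ (gradient ρ x) v = fderiv ℝ ρ x v := by
  simp [gradient]

namespace IsDefiningFunctionAt

variable {Ω : Set E3} {x : E3} {ρ ρ' : E3 → ℝ}

theorem eq_zero (h : IsDefiningFunctionAt Ω x ρ) (hΩ : IsOpen Ω) (hx : x ∈ frontier Ω) :
    ρ x = 0 := by
  rw [hΩ.frontier_eq] at hx
  have hev := h.2.2
  apply le_antisymm
  · by_contra! hlt
    have h1 : ∀ᶠ y in 𝓝 x, 0 < ρ y := h.1.continuous.continuousAt.eventually (lt_mem_nhds hlt)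
    have h2 := mem_closure_iff_frequently.1 hx.1
    obtain ⟨y, hy, h3, h4⟩ := (h2.and_eventually (hev.and h1)).exists
    linarith [h3.1 hy]
  · by_contra! hlt
    exact hx.2 (hev.self_of_nhds.2 hlt)

theorem eventually (h : IsDefiningFunctionAt Ω x ρ) :
    ∀ᶠ y in 𝓝 x, IsDefiningFunctionAt Ω y ρ := by
  have hc : Continuous (gradient ρ) := by
    unfold gradient
    exact (LinearIsometryEquiv.continuous _).comp (h.1.continuous_fderiv (by simp))
  filter_upwards [h.2.2.eventually_nhds, hc.continuousAt.eventually_ne h.2.1] with y h1 h2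
  exact ⟨h.1, h2, h1⟩

/-- A short step along `v` makes `ρ` negative and so enters `Ω`; hence `ρ'` is negative there too,
and its difference quotients are at most `0`. -/
theorem fderiv_nonpos (h : IsDefiningFunctionAt Ω x ρ) (h' : IsDefiningFunctionAt Ω x ρ')
    (hΩ : IsOpen Ω) (hx : x ∈ frontier Ω) {v : E3} (hv : fderiv ℝ ρ x v < 0) :
    fderiv ℝ ρ' x v ≤ 0 := by
  have hd : ∀ {σ : E3 → ℝ}, IsDefiningFunctionAt Ω x σ →
      HasDerivAt (fun t : ℝ => σ (x + t • v)) (fderiv ℝ σ x v) 0 := by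
    intro σ hσ
    have h1 : HasFDerivAt σ (fderiv ℝ σ x) (x + (0 : ℝ) • v) := by
      simpa using (hσ.1.differentiable (by simp) x).hasFDerivAt
    have h2 : HasDerivAt (fun t : ℝ => x + t • v) v 0 := by
      simpa using ((hasDerivAt_id (0 : ℝ)).smul_const v).const_add x
    exact h1.comp_hasDerivAt 0 h2
  have hcont : Tendsto (fun t : ℝ => x + t • v) (𝓝[>] 0) (𝓝 x) := by
    have : Continuous (fun t : ℝ => x + t • v) := by fun_prop
    simpa using (this.tendsto 0).mono_left nhdsWithin_le_nhds
  have s1 := ((hasDerivAt_iff_tendsto_slope.1 (hd h)).mono_left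
    (nhdsGT_le_nhdsNE _))
  have s2 := ((hasDerivAt_iff_tendsto_slope.1 (hd h')).mono_left
    (nhdsGT_le_nhdsNE _))
  refine le_of_tendsto s2 ?_
  filter_upwards [s1.eventually (gt_mem_nhds hv), self_mem_nhdsWithin, hcont.eventually h.2.2,
    hcont.eventually h'.2.2] with t h1 (h2 : 0 < t) h3 h4
  have e0 := h.eq_zero hΩ hx
  have e0' := h'.eq_zero hΩ hx
  simp only [slope_def_field, zero_smul, add_zero, sub_zero, e0, e0'] at h1 ⊢
  rw [div_lt_iff₀ h2, zero_mul] at h1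
  exact div_nonpos_of_nonpos_of_nonneg (h4.1 (h3.2 h1)).le h2.le

/-- Makes the choice in `outwardNormal` harmless. If the unit vectors `n`, `n'` differed, `n' - n`
would point strictly inward for `ρ` and strictly outward for `ρ'`, against `fderiv_nonpos`. -/
theorem normalized_gradient_eq (h : IsDefiningFunctionAt Ω x ρ)
    (h' : IsDefiningFunctionAt Ω x ρ') (hΩ : IsOpen Ω) (hx : x ∈ frontier Ω) :
    ‖gradient ρ x‖⁻¹ • gradient ρ x = ‖gradient ρ' x‖⁻¹ • gradient ρ' x := by
  by_contra hne
  set n := ‖gradient ρ x‖⁻¹ • gradient ρ x with hn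
  set n' := ‖gradient ρ' x‖⁻¹ • gradient ρ' x with hn'
  have p : 0 < ‖gradient ρ x‖ := norm_pos_iff.2 h.2.1
  have p' : 0 < ‖gradient ρ' x‖ := norm_pos_iff.2 h'.2.1
  have u : ‖n‖ = 1 := by rw [hn, norm_smul]; simp [p.ne']
  have u' : ‖n'‖ = 1 := by rw [hn', norm_smul]; simp [p'.ne']
  have g : gradient ρ x = ‖gradient ρ x‖ • n := by rw [hn, smul_smul]; simp [p.ne']
  have g' : gradient ρ' x = ‖gradient ρ' x‖ • n' := by rw [hn', smul_smul]; simp [p'.ne']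
  have hlt : inner ℝ n n' < 1 := by
    have := inner_lt_one_iff_real_of_norm_eq_one u u'
    exact this.2 hne
  have a1 : fderiv ℝ ρ x (n' - n) < 0 := by
    rw [← inner_gradient, g, real_inner_smul_left, inner_sub_right, real_inner_self_eq_norm_sq, u]
    nlinarith
  have a2 := h.fderiv_nonpos h' hΩ hx a1
  rw [← inner_gradient, g', real_inner_smul_left, inner_sub_right, real_inner_self_eq_norm_sq, u',
    real_inner_comm] at a2
  nlinarith

theorem outwardNormal_eq (h : IsDefiningFunctionAt Ω x ρ) (hΩ : IsOpen Ω)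
    (hx : x ∈ frontier Ω) : outwardNormal Ω x = ‖gradient ρ x‖⁻¹ • gradient ρ x := by
  have hex : ∃ ρ : E3 → ℝ, IsDefiningFunctionAt Ω x ρ := ⟨ρ, h⟩
  rw [outwardNormal, dif_pos hex]
  exact hex.choose_spec.normalized_gradient_eq h hΩ hx

theorem norm_outwardNormal (h : IsDefiningFunctionAt Ω x ρ) (hΩ : IsOpen Ω)
    (hx : x ∈ frontier Ω) : ‖outwardNormal Ω x‖ = 1 := by
  rw [h.outwardNormal_eq hΩ hx, norm_smul]
  simp [h.2.1]

theorem gradient_eq (h : IsDefiningFunctionAt Ω x ρ) (hΩ : IsOpen Ω)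
    (hx : x ∈ frontier Ω) : gradient ρ x = ‖gradient ρ x‖ • outwardNormal Ω x := by
  rw [h.outwardNormal_eq hΩ hx, smul_smul]
  simp [h.2.1]

/-- For the converse, moving from a zero of `ρ` against the gradient makes `ρ` negative, so the zero
is a limit of points of `Ω`. -/
theorem mem_frontier_iff (h : IsDefiningFunctionAt Ω x ρ) (hΩ : IsOpen Ω) :
    x ∈ frontier Ω ↔ ρ x = 0 := by
  refine ⟨h.eq_zero hΩ, fun h0 => ?_⟩
  rw [hΩ.frontier_eq]
  refine ⟨?_, fun hx => by linarith [h.2.2.self_of_nhds.1 hx]⟩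
  have p : 0 < ‖gradient ρ x‖ := norm_pos_iff.2 h.2.1
  have h1 : HasFDerivAt ρ (fderiv ℝ ρ x) (x + (0 : ℝ) • gradient ρ x) := by
    simpa using (h.1.differentiable (by simp) x).hasFDerivAt
  have h2 : HasDerivAt (fun t : ℝ => x + t • gradient ρ x) (gradient ρ x) 0 := by
    simpa using ((hasDerivAt_id (0 : ℝ)).smul_const (gradient ρ x)).const_add x
  have h3 := h1.comp_hasDerivAt 0 h2
  rw [← inner_gradient, real_inner_self_eq_norm_sq] at h3
  have s1 := ((hasDerivAt_iff_tendsto_slope.1 h3).mono_left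
    (nhdsLT_le_nhdsNE _))
  have hcont : Tendsto (fun t : ℝ => x + t • gradient ρ x) (𝓝[<] 0) (𝓝 x) := by
    have : Continuous (fun t : ℝ => x + t • gradient ρ x) := by fun_prop
    simpa using (this.tendsto 0).mono_left nhdsWithin_le_nhds
  refine mem_closure_of_tendsto hcont ?_
  filter_upwards [s1.eventually (lt_mem_nhds (by positivity : (0:ℝ) < ‖gradient ρ x‖ ^ 2)),
    self_mem_nhdsWithin, hcont.eventually h.2.2] with t h4 (h5 : t < 0) h6
  apply h6.2
  simp only [slope_def_field, Function.comp, zero_smul, add_zero, sub_zero, h0] at h4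
  by_contra! hc
  exact absurd h4 (not_lt.2 (div_nonpos_of_nonneg_of_nonpos hc h5.le))

end IsDefiningFunctionAt

theorem continuousOn_outwardNormal {Ω : Set E3} (hΩ : IsOpen Ω) (hs : HasSmoothBoundary Ω) :
    ContinuousOn (outwardNormal Ω) (frontier Ω) := by
  intro x hx
  obtain ⟨ρ, h⟩ := hs x hx
  have hc : Continuous (gradient ρ) := by
    unfold gradient
    exact (LinearIsometryEquiv.continuous _).comp (h.1.continuous_fderiv (by simp))
  have h1 : ContinuousWithinAt (fun y => ‖gradient ρ y‖⁻¹ • gradient ρ y) (frontier Ω) x :=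
    ((hc.norm.continuousAt.inv₀ (norm_ne_zero_iff.2 h.2.1)).smul
      hc.continuousAt).continuousWithinAt
  refine h1.congr_of_eventuallyEq ?_ (h.outwardNormal_eq hΩ hx)
  filter_upwards [nhdsWithin_le_nhds h.eventually, self_mem_nhdsWithin] with y h2 h3
  exact h2.outwardNormal_eq hΩ h3

/-- Near a boundary point, in oblique coordinates along a transversal direction `a`, the domain is
the region below the graph of a function, and the boundary is nearly flat. -/
theorem exists_local_graph {Ω : Set E3} (hΩ : IsOpen Ω) {x₀ : E3} (hx : x₀ ∈ frontier Ω)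
    {ρ : E3 → ℝ} (h : IsDefiningFunctionAt Ω x₀ ρ) {e a : E3} (he : e = outwardNormal Ω x₀)
    (ha : inner ℝ e a = 1) {δ : ℝ} (hδ : 0 < δ) (hδa : δ * (1 + ‖a‖) < 1)
    {W : Set E3} (hW : W ∈ 𝓝 x₀) :
    ∃ r > 0, ∃ g : (Submodule.span ℝ {e})ᗮ → ℝ,
      (∀ y, ‖y‖ < r → |g y| < r) ∧
      (∀ (y : (Submodule.span ℝ {e})ᗮ) (s : ℝ), ‖y‖ < r → |s| < r →
        x₀ + (y : E3) + s • a ∈ W ∧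
        (x₀ + (y : E3) + s • a ∈ Ω ↔ s < g y) ∧
        (x₀ + (y : E3) + s • a ∈ frontier Ω ↔ s = g y)) ∧
      (∀ y₁ y₂ : (Submodule.span ℝ {e})ᗮ, ‖y₁‖ < r → ‖y₂‖ < r →
        |g y₁ - g y₂| ≤ δ * ‖((y₁ : E3) + g y₁ • a) - ((y₂ : E3) + g y₂ • a)‖) := by
  set T := (Submodule.span ℝ {e})ᗮ with hT
  set c := ‖gradient ρ x₀‖ with hc
  have c0 : 0 < c := norm_pos_iff.2 h.2.1
  have hD : ∀ v, fderiv ℝ ρ x₀ v = c * inner ℝ e v := fun v => by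
    rw [← inner_gradient, h.gradient_eq hΩ hx, real_inner_smul_left, he]
  have hT0 : ∀ y : T, inner ℝ e (y : E3) = 0 := fun y =>
    (Submodule.mem_orthogonal_singleton_iff_inner_right).1 y.2
  have hstrict : HasStrictFDerivAt ρ (fderiv ℝ ρ x₀) x₀ :=
    h.1.contDiffAt.hasStrictFDerivAt (by simp)
  -- Strict differentiability makes `ρ` uniformly close to its linearization on pairs of points near
  -- `x₀`. The tolerance `δ c` is relative to the slope `c`, so `c` cancels from the flatness
  -- estimate at the end.
  have hlit := hstrict.isLittleO.def (mul_pos hδ c0)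
  rw [nhds_prod_eq] at hlit
  obtain ⟨V, hV, hVρ⟩ := mem_prod_self_iff.1 hlit
  have hdef : {z | IsDefiningFunctionAt Ω z ρ} ∈ 𝓝 x₀ := h.eventually
  obtain ⟨r₀, r₀pos, hr₀⟩ := Metric.mem_nhds_iff.1 (inter_mem hV (inter_mem hW hdef))
  have a0 := norm_nonneg a
  -- The factor `1 + ‖a‖` makes the oblique cylinder of radius and half-height `r` fit into the ball
  -- of radius `r₀`.
  set r := r₀ / (1 + ‖a‖) with hr
  have rpos : 0 < r := by positivity
  have rmul : r * (1 + ‖a‖) = r₀ := by rw [hr]; field_simp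
  have hball : ∀ (y : T) (s : ℝ), ‖y‖ < r → |s| ≤ r →
      x₀ + (y : E3) + s • a ∈ V ∩ (W ∩ {z | IsDefiningFunctionAt Ω z ρ}) := by
    intro y s hy hs
    apply hr₀
    rw [mem_ball_iff_norm, add_assoc, add_sub_cancel_left]
    calc ‖(y : E3) + s • a‖ ≤ ‖(y : E3)‖ + ‖s • a‖ := norm_add_le _ _
      _ = ‖y‖ + |s| * ‖a‖ := by rw [norm_smul, Real.norm_eq_abs]; rfl
      _ < r + r * ‖a‖ := add_lt_add_of_lt_of_le hy (by gcongr)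
      _ = r₀ := by rw [← rmul]; ring
  have hest : ∀ z₁ ∈ V, ∀ z₂ ∈ V, |ρ z₁ - ρ z₂ - c * inner ℝ e (z₁ - z₂)| ≤
      δ * c * ‖z₁ - z₂‖ := by
    intro z₁ h₁ z₂ h₂
    have := hVρ (mk_mem_prod h₁ h₂)
    simpa only [mem_ofPred_eq, hD, Real.norm_eq_abs] using this
  -- Along `a` the linear part of `ρ` has slope `c` and the error slope is at most `δ c ‖a‖ < c`.
  have hinc : ∀ (y : T) (s t : ℝ), ‖y‖ < r → |s| ≤ r → |t| ≤ r → s < t →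
      ρ (x₀ + y + s • a) < ρ (x₀ + y + t • a) := by
    intro y s t hy hs ht hst
    have := hest _ (hball y t hy ht).1 _ (hball y s hy hs).1
    rw [add_sub_add_left_eq_sub, ← sub_smul, real_inner_smul_right, ha, norm_smul,
      Real.norm_eq_abs, abs_of_pos (sub_pos.2 hst), abs_le] at this
    have h1 : δ * c * ((t - s) * ‖a‖) < c * ((t - s) * 1) := by
      have : 0 < c * (t - s) := mul_pos c0 (sub_pos.2 hst)
      nlinarith
    linarith [this.1]
  have hx₀V : x₀ ∈ V := mem_of_mem_nhds hV
  -- At `s = r` and `s = -r` this fixes the sign of `ρ`, so the intermediate value theorem yields a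
  -- zero on each line, unique by `hinc`.
  have hend : ∀ (y : T) (s : ℝ), ‖y‖ < r → |s| ≤ r →
      |ρ (x₀ + y + s • a) - c * s| < c * r := by
    intro y s hy hs
    have := hest _ (hball y s hy hs).1 _ hx₀V
    rw [h.eq_zero hΩ hx, add_assoc, add_sub_cancel_left, inner_add_right, hT0, zero_add, sub_zero,
      real_inner_smul_right, ha, mul_one, ← add_assoc] at this
    refine this.trans_lt ?_
    have h2 : ‖(y : E3) + s • a‖ ≤ r * (1 + ‖a‖) := by
      calc ‖(y : E3) + s • a‖ ≤ ‖(y : E3)‖ + ‖s • a‖ := norm_add_le _ _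
        _ = ‖y‖ + |s| * ‖a‖ := by rw [norm_smul, Real.norm_eq_abs]; rfl
        _ ≤ r + r * ‖a‖ := by gcongr
        _ = _ := by ring
    calc δ * c * ‖(y : E3) + s • a‖ ≤ δ * c * (r * (1 + ‖a‖)) := by gcongr
      _ = c * r * (δ * (1 + ‖a‖)) := by ring
      _ < c * r * 1 := by gcongr
      _ = c * r := mul_one _
  have hzero : ∀ y : T, ‖y‖ < r → ∃ s, |s| < r ∧ ρ (x₀ + y + s • a) = 0 := by
    intro y hy
    have hcont : Continuous (fun s : ℝ => ρ (x₀ + y + s • a)) :=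
      h.1.continuous.comp (by fun_prop)
    have e1 := hend y r hy (by rw [abs_of_pos rpos])
    have e2 := hend y (-r) hy (by rw [abs_neg, abs_of_pos rpos])
    rw [abs_lt] at e1 e2
    obtain ⟨s, hs, hs0⟩ := intermediate_value_Ioo (by linarith : -r ≤ r) hcont.continuousOn
      (show (0 : ℝ) ∈ Ioo _ _ from ⟨by linarith [e2.2], by linarith [e1.1]⟩)
    exact ⟨s, abs_lt.2 hs, hs0⟩
  classical
  let g : T → ℝ := fun y => if hy : ‖y‖ < r then (hzero y hy).choose else 0
  have hg : ∀ y, ‖y‖ < r → |g y| < r ∧ ρ (x₀ + y + g y • a) = 0 := by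
    intro y hy
    simp only [g, dif_pos hy]
    exact (hzero y hy).choose_spec
  refine ⟨r, rpos, g, fun y hy => (hg y hy).1, ?_, ?_⟩
  · intro y s hy hs
    have hz := (hball y s hy hs.le).2
    have hρ : ∀ t, |t| ≤ r → s < t → ρ (x₀ + y + s • a) < ρ (x₀ + y + t • a) :=
      fun t ht => hinc y s t hy hs.le ht
    have key : ρ (x₀ + y + s • a) < 0 ↔ s < g y := by
      rw [← (hg y hy).2]
      constructor
      · intro hlt
        by_contra! hle
        rcases hle.eq_or_lt with heq | hlt'
        · rw [heq] at hlt; exact lt_irrefl _ hlt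
        · exact lt_asymm hlt (hinc y _ _ hy (hg y hy).1.le hs.le hlt')
      · exact hinc y _ _ hy hs.le (hg y hy).1.le
    have key' : ρ (x₀ + y + s • a) = 0 ↔ s = g y := by
      rw [← (hg y hy).2]
      constructor
      · intro heq
        rcases lt_trichotomy s (g y) with hlt | heq' | hlt
        · exact absurd heq (hinc y _ _ hy hs.le (hg y hy).1.le hlt).ne
        · exact heq'
        · exact absurd heq (hinc y _ _ hy (hg y hy).1.le hs.le hlt).ne'
      · rintro rfl; rfl
    exact ⟨hz.1, (hz.2.2.2.self_of_nhds).trans key,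
      (hz.2.mem_frontier_iff hΩ).trans key'⟩
  -- Both points lie on the zero set, so the linearization estimate bounds their difference of
  -- heights directly.
  · intro y₁ y₂ h₁ h₂
    have := hest _ (hball y₁ _ h₁ (hg y₁ h₁).1.le).1 _ (hball y₂ _ h₂ (hg y₂ h₂).1.le).1
    rw [(hg y₁ h₁).2, (hg y₂ h₂).2, add_assoc, add_assoc, add_sub_add_left_eq_sub, inner_sub_right,
      inner_add_right, inner_add_right, hT0, hT0, real_inner_smul_right, real_inner_smul_right, ha]
      at this
    simp only [sub_zero, zero_sub, abs_neg, zero_add, mul_one] at this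
    rw [abs_mul, abs_of_pos c0, mul_comm δ c, mul_assoc] at this
    exact le_of_mul_le_mul_left this c0

/-! ### The approximate divergence theorem -/

theorem frontier_measurableSet (Ω : Set E3) : MeasurableSet (frontier Ω) :=
  isClosed_frontier.measurableSet

/-- Integrating along lines parallel to `a` turns the volume integral into the integral of `F` over
the graph with respect to flat area on the plane orthogonal to the normal. Projection along `a` is
nearly isometric on the boundary, so flat area and surface area agree up to a factor `1 + η`. -/
theorem exists_local_divergence {Ω : Set E3} (hΩ : IsOpen Ω) {x₀ : E3} (hx : x₀ ∈ frontier Ω)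
    {ρ : E3 → ℝ} (h : IsDefiningFunctionAt Ω x₀ ρ) {a : E3}
    (ha' : inner ℝ (outwardNormal Ω x₀) a = 1) {η : ℝ} (hη : 0 < η) (hη1 : η ≤ 1)
    {W : Set E3} (hW : W ∈ 𝓝 x₀) :
    ∃ U : Set E3, IsOpen U ∧ x₀ ∈ U ∧ U ⊆ W ∧ 0 < surfaceArea Ω U ∧ surfaceArea Ω U < ⊤ ∧
      ∀ F : E3 → ℝ, ContDiff ℝ 1 F → HasCompactSupport F → tsupport F ⊆ U →
        |(∫ x in Ω, fderiv ℝ F x a) - ∫ x, F x ∂(surfaceArea Ω)| ≤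
          η * ∫ x, |F x| ∂(surfaceArea Ω) := by
  obtain ⟨e, he⟩ : ∃ e, e = outwardNormal Ω x₀ := ⟨_, rfl⟩
  have ha : inner ℝ e a = 1 := by rw [he]; exact ha'
  have he1 : ‖e‖ = 1 := by rw [he]; exact h.norm_outwardNormal hΩ hx
  have a0 := norm_nonneg a
  -- The height term `(g y₁ - g y₂) a` is then at most `η/6` of the distance on the graph, whence
  -- Lipschitz constants `1 + η/3` for the graph map and its inverse. Area scales by the square, and
  -- `(1 + η/3)² ≤ 1 + η` as `η ≤ 1`.
  set δ := η / (6 * (1 + ‖a‖)) with hδ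
  have δ0 : 0 < δ := by positivity
  have δm : δ * (1 + ‖a‖) = η / 6 := by rw [hδ]; field_simp
  let T := (Submodule.span ℝ {e})ᗮ
  have hT : T = (Submodule.span ℝ {e})ᗮ := rfl
  obtain ⟨r, r0, g, hg1, hg2, hg3⟩ :
      ∃ r > 0, ∃ g : T → ℝ, _ := exists_local_graph hΩ hx h he ha δ0 (by linarith) hW
  have hT0 : ∀ y : T, inner ℝ e (y : E3) = 0 := fun y =>
    (Submodule.mem_orthogonal_singleton_iff_inner_right).1 y.2
  have hvol : (Measure.euclideanHausdorffMeasure 2 : Measure T) = volume := by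
    have : Fact (Module.finrank ℝ E3 = 2 + 1) := ⟨by simp⟩
    have hf : Module.finrank ℝ T = 2 :=
      Submodule.finrank_orthogonal_span_singleton (by rintro rfl; simp at he1)
    rw [← hf]
    exact InnerProductSpace.euclideanHausdorffMeasure_eq_volume
  let pr : E3 → T := fun z => ⟨(z - x₀) - (inner ℝ e (z - x₀) : ℝ) • a, by
    rw [hT, Submodule.mem_orthogonal_singleton_iff_inner_right, inner_sub_right,
      real_inner_smul_right, ha]; ring⟩
  have hprc : Continuous pr := by
    apply Continuous.subtype_mk
    fun_prop
  let γ : T → E3 := fun y => x₀ + (y : E3) + g y • a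
  let κ : ℝ × T → E3 := fun q => x₀ + (q.2 : E3) + q.1 • a
  have hκc : Continuous κ := by fun_prop
  have hκp : ∀ s y, pr (κ (s, y)) = y := by
    intro s y
    apply Subtype.ext
    simp only [pr, κ, add_assoc, add_sub_cancel_left, inner_add_right, hT0, real_inner_smul_right,
      ha]
    simp
  have hκe : ∀ s y, inner ℝ e (κ (s, y) - x₀) = s := by
    intro s y
    simp only [κ, add_assoc, add_sub_cancel_left, inner_add_right, hT0, real_inner_smul_right,
      ha]
    simp
  have hκ : ∀ z, κ (inner ℝ e (z - x₀), pr z) = z := by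
    intro z
    simp only [κ, pr]
    abel
  set U : Set E3 := {z | |(inner ℝ e (z - x₀) : ℝ)| < r ∧ ‖pr z‖ < r} with hU
  have hUo : IsOpen U :=
    (isOpen_lt (f := fun z => |(inner ℝ e (z - x₀) : ℝ)|) (by fun_prop) continuous_const).inter
      (isOpen_lt (f := fun z => ‖pr z‖) (by fun_prop) continuous_const)
  have hκU : ∀ s y, κ (s, y) ∈ U ↔ |s| < r ∧ ‖y‖ < r := by
    intro s y
    rw [hU, mem_ofPred_eq, hκe, hκp]
  set B : Set T := Metric.ball 0 r with hB
  have hγU : ∀ y ∈ B, γ y ∈ frontier Ω ∩ U := by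
    intro y hy
    rw [hB, mem_ball_zero_iff] at hy
    exact ⟨(hg2 y _ hy (hg1 y hy)).2.2.2 rfl, (hκU _ _).2 ⟨hg1 y hy, hy⟩⟩
  have hγp : ∀ y, pr (γ y) = y := fun y => hκp _ y
  have hfr : ∀ z ∈ frontier Ω ∩ U, pr z ∈ B ∧ γ (pr z) = z := by
    rintro z ⟨hz1, hz2⟩
    refine ⟨mem_ball_zero_iff.2 hz2.2, ?_⟩
    have hz3 : κ (inner ℝ e (z - x₀), pr z) ∈ frontier Ω := by rwa [hκ]
    have := (hg2 (pr z) _ hz2.2 hz2.1).2.2.1 hz3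
    conv_rhs => rw [← hκ z]
    simp only [κ, γ, this]
  obtain ⟨K, hK⟩ : ∃ K : NNReal, (K : ℝ) = 1 + η / 3 := ⟨⟨1 + η / 3, by positivity⟩, rfl⟩
  obtain ⟨c, hc⟩ : ∃ c : NNReal, (c : ℝ) = 1 + η := ⟨⟨1 + η, by positivity⟩, rfl⟩
  have hKc : K ^ 2 ≤ c := by
    rw [← NNReal.coe_le_coe]
    push_cast
    rw [hK, hc]
    nlinarith
  have hdist : ∀ y₁ ∈ B, ∀ y₂ ∈ B, ‖y₁ - y₂‖ ≤ K * ‖γ y₁ - γ y₂‖ ∧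
      ‖γ y₁ - γ y₂‖ ≤ K * ‖y₁ - y₂‖ := by
    intro y₁ h₁ y₂ h₂
    rw [hB, mem_ball_zero_iff] at h₁ h₂
    have h3 := hg3 y₁ y₂ h₁ h₂
    have hD : γ y₁ - γ y₂ = ((y₁ : E3) + g y₁ • a) - ((y₂ : E3) + g y₂ • a) := by
      simp only [γ]; abel
    rw [← hD] at h3
    have h4 : γ y₁ - γ y₂ = ((y₁ - y₂ : T) : E3) + (g y₁ - g y₂) • a := by
      rw [hD, Submodule.coe_sub]; module
    have h5 : ‖(g y₁ - g y₂) • a‖ ≤ η / 6 * ‖γ y₁ - γ y₂‖ := by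
      rw [norm_smul, Real.norm_eq_abs]
      calc _ ≤ (δ * ‖γ y₁ - γ y₂‖) * ‖a‖ := by gcongr
        _ = (δ * ‖a‖) * ‖γ y₁ - γ y₂‖ := by ring
        _ ≤ _ := by gcongr; linarith
    have h6 : ‖γ y₁ - γ y₂‖ ≤ ‖y₁ - y₂‖ + ‖(g y₁ - g y₂) • a‖ := by
      conv_lhs => rw [h4]
      exact norm_add_le _ _
    have h7 : ‖y₁ - y₂‖ ≤ ‖γ y₁ - γ y₂‖ + ‖(g y₁ - g y₂) • a‖ := by
      have : ((y₁ - y₂ : T) : E3) = (γ y₁ - γ y₂) - (g y₁ - g y₂) • a := by rw [h4]; abel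
      change ‖((y₁ - y₂ : T) : E3)‖ ≤ _
      rw [this]
      exact norm_sub_le _ _
    have n1 := norm_nonneg (γ y₁ - γ y₂)
    have n2 := norm_nonneg (y₁ - y₂)
    rw [hK]
    constructor
    · nlinarith
    · have h8 : ‖γ y₁ - γ y₂‖ * (1 - η / 6) ≤ ‖y₁ - y₂‖ := by linarith
      have h9 : 1 ≤ (1 - η / 6) * (1 + η / 3) := by nlinarith
      calc ‖γ y₁ - γ y₂‖ ≤ ‖γ y₁ - γ y₂‖ * ((1 - η / 6) * (1 + η / 3)) :=
            le_mul_of_one_le_right n1 h9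
        _ = (1 + η / 3) * (‖γ y₁ - γ y₂‖ * (1 - η / 6)) := by ring
        _ ≤ _ := by gcongr
  have hLγ : LipschitzOnWith K γ B := LipschitzOnWith.of_dist_le_mul fun y₁ h₁ y₂ h₂ => by
    rw [dist_eq_norm, dist_eq_norm]; exact (hdist y₁ h₁ y₂ h₂).2
  have hLp : LipschitzOnWith K pr (frontier Ω ∩ U) :=
    LipschitzOnWith.of_dist_le_mul fun z₁ h₁ z₂ h₂ => by
      have := (hdist _ (hfr z₁ h₁).1 _ (hfr z₂ h₂).1).1
      rw [(hfr z₁ h₁).2, (hfr z₂ h₂).2] at this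
      rw [dist_eq_norm, dist_eq_norm]; exact this
  have himγ : ∀ A : Set T, γ '' (A ∩ B) = (pr ⁻¹' A ∩ U) ∩ frontier Ω := by
    intro A
    ext z
    constructor
    · rintro ⟨y, ⟨hy1, hy2⟩, rfl⟩
      exact ⟨⟨by rwa [mem_preimage, hγp], (hγU y hy2).2⟩, (hγU y hy2).1⟩
    · rintro ⟨⟨h1, h2⟩, h3⟩
      exact ⟨pr z, ⟨h1, (hfr z ⟨h3, h2⟩).1⟩, (hfr z ⟨h3, h2⟩).2⟩
  have himp : ∀ A : Set T, pr '' ((pr ⁻¹' A ∩ U) ∩ frontier Ω) = A ∩ B := by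
    intro A
    rw [← himγ, image_image]
    simp [hγp]
  -- Flat area and projected surface area, both carried by the disc `B`; `himγ` and `himp` exhibit
  -- the sets they measure as Lipschitz images of one another.
  set m₁ : Measure T := volume.restrict B with hm₁
  set m₂ : Measure T := ((surfaceArea Ω).restrict U).map pr with hm₂
  have hm₂A : ∀ A, MeasurableSet A →
      m₂ A = Measure.euclideanHausdorffMeasure 2 ((pr ⁻¹' A ∩ U) ∩ frontier Ω) := by
    intro A hA
    have hm : MeasurableSet (pr ⁻¹' A) := hprc.measurable hA
    rw [hm₂, Measure.map_apply hprc.measurable hA, Measure.restrict_apply hm, surfaceArea,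
      Measure.restrict_apply (hm.inter hUo.measurableSet)]
  have hm₁A : ∀ A, MeasurableSet A → m₁ A = Measure.euclideanHausdorffMeasure 2 (A ∩ B) := by
    intro A hA
    rw [hm₁, Measure.restrict_apply hA, hvol]
  have hKc' : ((K : ENNReal) ^ 2) ≤ c := by exact_mod_cast hKc
  have h12 : m₁ ≤ c • m₂ := by
    refine Measure.le_iff.2 fun A hA => ?_
    rw [Measure.smul_apply, hm₁A A hA, hm₂A A hA, ← himp A]
    refine (euclideanHausdorffMeasure_image_le (hLp.mono ?_) 2).trans ?_
    · rintro z ⟨⟨h1, h2⟩, h3⟩; exact ⟨h3, h2⟩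
    · rw [ENNReal.smul_def, smul_eq_mul]
      gcongr
  have h21 : m₂ ≤ c • m₁ := by
    refine Measure.le_iff.2 fun A hA => ?_
    rw [Measure.smul_apply, hm₁A A hA, hm₂A A hA, ← himγ A]
    refine (euclideanHausdorffMeasure_image_le (hLγ.mono inter_subset_right) 2).trans ?_
    rw [ENNReal.smul_def, smul_eq_mul]
    gcongr
  have hm₁fin : IsFiniteMeasure m₁ := ⟨by
    rw [hm₁, Measure.restrict_apply_univ]; exact measure_ball_lt_top⟩
  have hm₂fin : IsFiniteMeasure m₂ := isFiniteMeasure_of_le _ h21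
  have hm₂univ : m₂ univ = surfaceArea Ω U := by
    rw [hm₂, Measure.map_apply hprc.measurable MeasurableSet.univ]; simp
  refine ⟨U, hUo, ?_, ?_, ?_, ?_, ?_⟩
  · have : pr x₀ = 0 := Subtype.ext (by simp [pr])
    simp [hU, this, r0]
  · intro z hz
    have := (hg2 (pr z) _ hz.2 hz.1).1
    have hzz := hκ z
    simp only [κ] at hzz
    rwa [hzz] at this
  · rw [← hm₂univ, pos_iff_ne_zero]
    intro h0
    have h1 := Measure.le_iff.1 h12 univ MeasurableSet.univ
    rw [Measure.smul_apply, h0, smul_zero, hm₁, Measure.restrict_apply_univ] at h1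
    exact (Metric.measure_ball_pos volume (0 : T) r0).ne' (le_antisymm h1 bot_le)
  · rw [← hm₂univ]; exact measure_lt_top _ _
  intro F hF hFc hFU
  have hFz : ∀ z, z ∉ U → F z = 0 := fun z hz => image_eq_zero_of_notMem_tsupport fun hz' =>
    hz (hFU hz')
  have hFd : ∀ z, z ∉ U → fderiv ℝ F z = 0 := fun z hz =>
    image_eq_zero_of_notMem_tsupport fun hz' => hz (hFU (tsupport_fderiv_subset ℝ hz'))
  obtain ⟨C, hC⟩ := hFc.exists_bound_of_continuous hF.continuous
  have hfm₁ : AEStronglyMeasurable (fun y => F (γ y)) m₁ :=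
    (hF.continuous.comp_continuousOn hLγ.continuousOn).aestronglyMeasurable
      Metric.isOpen_ball.measurableSet
  have hfm₂ : AEStronglyMeasurable (fun y => F (γ y)) m₂ :=
    hfm₁.mono_ac ((Measure.absolutelyContinuous_of_le h21).trans
      (Measure.AbsolutelyContinuous.rfl.smul_left c))
  have hi₁ : Integrable (fun y => F (γ y)) m₁ :=
    Integrable.of_bound hfm₁ C (ae_of_all _ fun y => hC _)
  have hi₂ : Integrable (fun y => F (γ y)) m₂ :=
    Integrable.of_bound hfm₂ C (ae_of_all _ fun y => hC _)
  have hsurf : ∀ φ : ℝ → ℝ, Continuous φ → φ 0 = 0 →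
      ∫ y, φ (F (γ y)) ∂m₂ = ∫ x, φ (F x) ∂(surfaceArea Ω) := by
    intro φ hφ hφ0
    rw [hm₂, integral_map hprc.aemeasurable (hφ.comp_aestronglyMeasurable hfm₂),
      ← setIntegral_eq_integral_of_forall_compl_eq_zero (s := U)
        (f := fun x => φ (F x))
        (fun z hz => by rw [hFz z hz, hφ0])]
    refine setIntegral_congr_ae hUo.measurableSet ?_
    rw [surfaceArea]
    refine (ae_restrict_mem (frontier_measurableSet Ω)).mono fun z hz hzU => ?_
    rw [(hfr z ⟨hz, hzU⟩).2]
  have hint : Integrable (indicator Ω (fun z => fderiv ℝ F z a)) := by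
    refine Integrable.indicator ?_ hΩ.measurableSet
    exact (((hF.continuous_fderiv (by simp)).clm_apply
      continuous_const)).integrable_of_hasCompactSupport (hFc.fderiv_apply ℝ a)
  have hκm : MeasurePreserving κ := measurePreserving_oblique he1 ha x₀
  -- Fubini in oblique coordinates: on each line `Ω` is the part `s < g y`, and the fundamental
  -- theorem of calculus leaves the value of `F` at the graph, since `F` vanishes far below.
  have hvolint : ∫ x in Ω, fderiv ℝ F x a = ∫ y, F (γ y) ∂m₁ := by
    rw [← integral_indicator hΩ.measurableSet, ← hκm.map_eq,
      integral_map hκc.aemeasurable (by rw [hκm.map_eq]; exact hint.1), hm₁,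
      ← integral_indicator Metric.isOpen_ball.measurableSet]
    refine (integral_prod_symm _ (hκm.integrable_comp_of_integrable hint)).trans ?_
    refine integral_congr_ae (ae_of_all _ fun y => ?_)
    by_cases hy : y ∈ B
    · have hy' : ‖y‖ < r := mem_ball_zero_iff.1 hy
      rw [indicator_of_mem (show y ∈ Metric.ball 0 r from hy)]
      have hf : ContDiff ℝ 1 (fun s => F (κ (s, y))) := by
        refine hF.comp ?_
        simp only [κ]
        fun_prop
      have hfc : HasCompactSupport (fun s => F (κ (s, y))) := by
        refine HasCompactSupport.intro (isCompact_Icc (a := -r) (b := r)) fun s hs => ?_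
        refine hFz _ fun hsU => hs ?_
        exact ⟨(abs_lt.1 ((hκU s y).1 hsU).1).1.le, (abs_lt.1 ((hκU s y).1 hsU).1).2.le⟩
      have := hfc.integral_Iic_deriv_eq hf (g y)
      rw [integral_Iic_eq_integral_Iio, ← integral_indicator measurableSet_Iio] at this
      refine Eq.trans ?_ this
      refine integral_congr_ae (ae_of_all _ fun s => ?_)
      beta_reduce
      rw [Function.comp_apply]
      have hder : deriv (fun s => F (κ (s, y))) s = fderiv ℝ F (κ (s, y)) a := by
        have h2 : HasDerivAt (fun t : ℝ => κ (t, y)) a s := by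
          simpa [κ] using ((hasDerivAt_id s).smul_const a).const_add (x₀ + (y : E3))
        exact ((hF.differentiable (by simp) _).hasFDerivAt.comp_hasDerivAt s h2).deriv
      by_cases hs : |s| < r
      · have hiff := (hg2 y s hy' hs).2.1
        by_cases hsg : s < g y
        · rw [indicator_of_mem (show κ (s, y) ∈ Ω from hiff.2 hsg),
            indicator_of_mem (show s ∈ Iio (g y) from hsg), hder]
        · rw [indicator_of_notMem (show κ (s, y) ∉ Ω from fun hh => hsg (hiff.1 hh)),
            indicator_of_notMem (show s ∉ Iio (g y) from hsg)]
      · have h0 : fderiv ℝ F (κ (s, y)) = 0 := hFd _ fun hh => hs ((hκU s y).1 hh).1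
        simp only [indicator, hder, h0]
        simp
    · rw [indicator_of_notMem (show y ∉ Metric.ball 0 r from hy)]
      have h0 : ∀ s, fderiv ℝ F (κ (s, y)) = 0 := fun s => hFd _ fun hh =>
        hy (mem_ball_zero_iff.2 ((hκU s y).1 hh).2)
      simp [indicator, h0]
  have hs := hsurf id continuous_id rfl
  simp only [id] at hs
  rw [hvolint, ← hs, ← hsurf (fun t => |t|) continuous_abs abs_zero]
  exact abs_integral_sub_integral_le hc hη.le h12 h21 hi₁ hi₂

theorem isDefiningFunctionAt_inner_self {Ω : Set E3} (hΩ : IsOpen Ω) {x : E3}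
    (hx : x ∈ frontier Ω) {ρ : E3 → ℝ} (h : IsDefiningFunctionAt Ω x ρ) :
    inner ℝ (outwardNormal Ω x) (outwardNormal Ω x) = (1 : ℝ) := by
  rw [real_inner_self_eq_norm_sq, h.norm_outwardNormal hΩ hx, one_pow]

theorem isFiniteMeasure_surfaceArea {Ω : Set E3} (hΩ : IsOpen Ω) (hb : Bornology.IsBounded Ω)
    (hs : HasSmoothBoundary Ω) : IsFiniteMeasure (surfaceArea Ω) := by
  have hK : IsCompact (frontier Ω) :=
    Metric.isCompact_of_isClosed_isBounded isClosed_frontier (hb.closure.subset frontier_subset_closure)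
  have h1 : surfaceArea Ω (frontier Ω) < ⊤ := by
    refine hK.measure_lt_top_of_nhdsWithin fun x hx => ?_
    obtain ⟨ρ, h⟩ := hs x hx
    obtain ⟨U, hU, hxU, -, -, hfin, -⟩ := exists_local_divergence hΩ hx h
      (isDefiningFunctionAt_inner_self hΩ hx h) one_pos le_rfl univ_mem
    exact ⟨U, nhdsWithin_le_nhds (hU.mem_nhds hxU), hfin⟩
  refine ⟨?_⟩
  rwa [surfaceArea, Measure.restrict_apply_univ, ← Measure.restrict_apply_self]

theorem surfaceArea_pos {Ω : Set E3} (hΩ : IsOpen Ω) (hs : HasSmoothBoundary Ω) {x : E3}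
    (hx : x ∈ frontier Ω) {W : Set E3} (hW : W ∈ 𝓝 x) : 0 < surfaceArea Ω W := by
  obtain ⟨ρ, h⟩ := hs x hx
  obtain ⟨U, -, -, hUW, hpos, -, -⟩ := exists_local_divergence hΩ hx h
    (isDefiningFunctionAt_inner_self hΩ hx h) one_pos le_rfl hW
  exact hpos.trans_le (measure_mono hUW)

/-- A coordinate direction may be tangential, so it is written as a difference of transversal ones:
`e_j = (e_j + (1 - n_j) n) - (1 - n_j) n`. As `|1 - n_j| ≤ 2`, errors `η/3` add up to at most `η`.
-/
theorem exists_nhds_divergence {Ω : Set E3} (hΩ : IsOpen Ω) (hs : HasSmoothBoundary Ω) {x : E3}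
    (hx : x ∈ frontier Ω) {η : ℝ} (hη : 0 < η) (hη1 : η ≤ 1) :
    ∃ U ∈ 𝓝 x, ∀ F : E3 → ℝ, ContDiff ℝ 1 F → HasCompactSupport F → tsupport F ⊆ U → ∀ j,
      |(∫ y in Ω, pd F j y) - outwardNormal Ω x j * ∫ y, F y ∂(surfaceArea Ω)| ≤
        η * ∫ y, |F y| ∂(surfaceArea Ω) := by
  obtain ⟨ρ, h⟩ := hs x hx
  have hnn := isDefiningFunctionAt_inner_self hΩ hx h
  have hn1 := h.norm_outwardNormal hΩ hx
  set n := outwardNormal Ω x with hn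
  obtain ⟨U, hUo, hxU, -, -, -, hU⟩ := exists_local_divergence hΩ hx h hnn
    (η := η / 3) (by positivity) (by linarith) univ_mem
  let e : Fin 3 → E3 := fun j => EuclideanSpace.single j 1
  have hne : ∀ j, inner ℝ n (e j) = n j := fun j => by
    simp only [e]
    rw [EuclideanSpace.inner_single_right]
    simp
  have ha : ∀ j, inner ℝ n (e j + (1 - n j) • n) = (1 : ℝ) := fun j => by
    rw [inner_add_right, real_inner_smul_right, hne, hnn]; ring
  choose V hVo hxV _ _ _ hV using fun j => exists_local_divergence hΩ hx h (ha j)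
    (η := η / 3) (by positivity) (by linarith) univ_mem
  refine ⟨U ∩ ⋂ j, V j, inter_mem (hUo.mem_nhds hxU)
    (Filter.iInter_mem.2 fun j => (hVo j).mem_nhds (hxV j)), fun F hF hFc hFs j => ?_⟩
  have k1 := hU F hF hFc (hFs.trans inter_subset_left)
  have k2 := hV j F hF hFc (hFs.trans (inter_subset_right.trans (iInter_subset _ j)))
  have hi : ∀ v, IntegrableOn (fun y => fderiv ℝ F y v) Ω := fun v =>
    ((((hF.continuous_fderiv (by simp)).clm_apply
      continuous_const)).integrable_of_hasCompactSupport (hFc.fderiv_apply ℝ v)).integrableOn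
  have hsplit : ∫ y in Ω, fderiv ℝ F y (e j + (1 - n j) • n) =
      (∫ y in Ω, pd F j y) + (1 - n j) * ∫ y in Ω, fderiv ℝ F y n := by
    simp only [map_add, map_smul, smul_eq_mul]
    rw [integral_add (hi _) ((hi _).const_mul _), integral_const_mul]
    rfl
  have hnj : |n j| ≤ 1 := by
    rw [← hn1, ← Real.norm_eq_abs]; exact PiLp.norm_apply_le n j
  rw [hsplit] at k2
  set I := ∫ y, |F y| ∂(surfaceArea Ω)
  have hI : 0 ≤ I := integral_nonneg fun y => abs_nonneg _
  set A := ∫ y in Ω, pd F j y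
  set B := ∫ y in Ω, fderiv ℝ F y n
  set D := ∫ y, F y ∂(surfaceArea Ω)
  have : A - n j * D = (A + (1 - n j) * B - D) - (1 - n j) * (B - D) := by ring
  rw [this]
  refine (abs_sub _ _).trans ?_
  rw [abs_mul]
  have h2 : |1 - n j| ≤ 2 := by rw [abs_le] at *; constructor <;> linarith
  have h3 : |1 - n j| * |B - D| ≤ 2 * (η / 3 * I) := by gcongr
  linarith

/-- The divergence theorem for functions that vanish on the boundary. -/
theorem exists_nhds_integral_pd_eq_zero {Ω : Set E3} (hΩ : IsOpen Ω) (hs : HasSmoothBoundary Ω)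
    {x : E3} (hx : x ∈ frontier Ω) :
    ∃ U ∈ 𝓝 x, ∀ F : E3 → ℝ, ContDiff ℝ 1 F → HasCompactSupport F → tsupport F ⊆ U →
      (∀ y ∈ frontier Ω, F y = 0) → ∀ j, ∫ y in Ω, pd F j y = 0 := by
  -- Any `η` serves, because the error is a multiple of the surface integral of `|F|`, which is
  -- zero.
  obtain ⟨U, hU, h⟩ := exists_nhds_divergence hΩ hs hx one_pos le_rfl
  refine ⟨U, hU, fun F hF hFc hFs h0 j => ?_⟩
  have h1 := h F hF hFc hFs j
  have h2 : ∀ φ : ℝ → ℝ, φ 0 = 0 → ∫ y, φ (F y) ∂(surfaceArea Ω) = 0 := by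
    intro φ hφ
    refine integral_eq_zero_of_ae ?_
    rw [surfaceArea]
    refine (ae_restrict_mem (frontier_measurableSet Ω)).mono fun z hz => ?_
    simp [h0 z hz, hφ]
  have h3 := h2 id rfl
  simp only [id] at h3
  rw [h3, h2 _ abs_zero] at h1
  simpa using h1

theorem integral_pd_eq_zero_of_tsupport_subset {Ω : Set E3} {F : E3 → ℝ} (hF : ContDiff ℝ 1 F)
    (hFc : HasCompactSupport F) (hFs : tsupport F ⊆ Ω) (j : Fin 3) :
    ∫ y in Ω, pd F j y = 0 := by
  have hF0 : ∀ y, y ∉ Ω → pd F j y = 0 := fun y hy => by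
    have : fderiv ℝ F y = 0 := image_eq_zero_of_notMem_tsupport fun hz' =>
      hy (hFs (tsupport_fderiv_subset ℝ hz'))
    simp [pd, this]
  rw [setIntegral_eq_integral_of_forall_compl_eq_zero hF0]
  have hi : Integrable (fun y => fderiv ℝ F y (EuclideanSpace.single j 1)) :=
    (((hF.continuous_fderiv (by simp)).clm_apply
      continuous_const)).integrable_of_hasCompactSupport (hFc.fderiv_apply ℝ _)
  -- Integration by parts over all of space against the constant `1`.
  have := integral_mul_fderiv_eq_neg_fderiv_mul_of_integrable (μ := (volume : Measure E3))
    (f := fun _ => (1 : ℝ)) (g := F) (v := EuclideanSpace.single j 1) (by simp) (by simpa using hi)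
    (by simpa using hF.continuous.integrable_of_hasCompactSupport hFc)
    (fun _ _ => differentiableAt_const _) (fun y _ => hF.differentiable (by simp) y)
  simpa [pd] using this

/-! ### Partial derivatives -/

theorem pd_add {f g : E3 → ℝ} {x : E3} (hf : DifferentiableAt ℝ f x) (hg : DifferentiableAt ℝ g x)
    (j : Fin 3) : pd (fun y => f y + g y) j x = pd f j x + pd g j x := by
  simp only [pd]; rw [fderiv_fun_add hf hg]; rfl

theorem pd_sub {f g : E3 → ℝ} {x : E3} (hf : DifferentiableAt ℝ f x) (hg : DifferentiableAt ℝ g x)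
    (j : Fin 3) : pd (fun y => f y - g y) j x = pd f j x - pd g j x := by
  simp only [pd]; rw [fderiv_fun_sub hf hg]; rfl

theorem pd_const_mul {f : E3 → ℝ} {x : E3} (hf : DifferentiableAt ℝ f x) (c : ℝ) (j : Fin 3) :
    pd (fun y => c * f y) j x = c * pd f j x := by
  simp only [pd]; rw [fderiv_const_mul hf]; rfl

theorem pd_mul {f g : E3 → ℝ} {x : E3} (hf : DifferentiableAt ℝ f x) (hg : DifferentiableAt ℝ g x)
    (j : Fin 3) : pd (fun y => f y * g y) j x = f x * pd g j x + pd f j x * g x := by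
  simp only [pd]; rw [fderiv_fun_mul hf hg]; simp; ring

theorem continuous_pd {f : E3 → ℝ} (hf : ContDiff ℝ 1 f) (j : Fin 3) : Continuous (pd f j) :=
  (hf.continuous_fderiv (by simp)).clm_apply continuous_const

/-! ### Regular fields -/

theorem SpaceC1.continuous_pd {p : ℝ → E3 → ℝ} (h : SpaceC1 p) (j : Fin 3) :
    Continuous (fun z : ℝ × E3 => pd (p z.1) j z.2) :=
  h.2.2.clm_apply continuous_const

theorem SpaceC1.differentiable {F : Type*} [NormedAddCommGroup F] [NormedSpace ℝ F]
    {p : ℝ → E3 → F} (h : SpaceC1 p) (t : ℝ) : Differentiable ℝ (p t) :=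
  (h.2.1 t).differentiable (by simp)

theorem SpaceC1.continuous_apply {u : ℝ → E3 → E3} (h : SpaceC1 u) (i : Fin 3) :
    Continuous (fun z : ℝ × E3 => u z.1 z.2 i) :=
  (EuclideanSpace.proj (𝕜 := ℝ) i).continuous.comp h.1

namespace SpaceC2TimeC1

variable {u : ℝ → E3 → E3}

theorem spaceC1 (h : SpaceC2TimeC1 u) : SpaceC1 u :=
  ⟨h.1, fun t => (h.2.1 t).of_le (by norm_num), h.2.2.1⟩

theorem continuous_apply (h : SpaceC2TimeC1 u) (i : Fin 3) :
    Continuous (fun z : ℝ × E3 => u z.1 z.2 i) :=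
  h.spaceC1.continuous_apply i

theorem contDiff_apply (h : SpaceC2TimeC1 u) (t : ℝ) (i : Fin 3) :
    ContDiff ℝ 2 (fun y => u t y i) :=
  (EuclideanSpace.proj (𝕜 := ℝ) i).contDiff.comp (h.2.1 t)

theorem differentiable_apply (h : SpaceC2TimeC1 u) (t : ℝ) (i : Fin 3) :
    Differentiable ℝ (fun y => u t y i) :=
  (h.contDiff_apply t i).differentiable (by simp)

theorem fderiv_apply (h : SpaceC2TimeC1 u) (t : ℝ) (x : E3) (i : Fin 3) :
    fderiv ℝ (fun y => u t y i) x = (EuclideanSpace.proj (𝕜 := ℝ) i).comp (fderiv ℝ (u t) x) :=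
  ((EuclideanSpace.proj (𝕜 := ℝ) i).hasFDerivAt.comp x
    (h.spaceC1.differentiable t x).hasFDerivAt).fderiv

theorem dx_eq (h : SpaceC2TimeC1 u) (i j : Fin 3) (t : ℝ) (x : E3) :
    dx u i j t x = fderiv ℝ (u t) x (EuclideanSpace.single j 1) i := by
  rw [dx, pd, h.fderiv_apply]; rfl

theorem continuous_dx (h : SpaceC2TimeC1 u) (i j : Fin 3) :
    Continuous (fun z : ℝ × E3 => dx u i j z.1 z.2) := by
  simp only [h.dx_eq]
  exact (EuclideanSpace.proj (𝕜 := ℝ) i).continuous.comp (h.2.2.1.clm_apply continuous_const)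

theorem contDiff_fderiv (h : SpaceC2TimeC1 u) (t : ℝ) : ContDiff ℝ 1 (fderiv ℝ (u t)) :=
  (h.2.1 t).fderiv_right (by norm_num)

theorem contDiff_dx (h : SpaceC2TimeC1 u) (i j : Fin 3) (t : ℝ) : ContDiff ℝ 1 (dx u i j t) := by
  have : dx u i j t = fun x => fderiv ℝ (u t) x (EuclideanSpace.single j 1) i :=
    funext fun x => h.dx_eq i j t x
  rw [this]
  exact (EuclideanSpace.proj (𝕜 := ℝ) i).contDiff.comp
    ((h.contDiff_fderiv t).clm_apply contDiff_const)

theorem differentiable_dx (h : SpaceC2TimeC1 u) (i j : Fin 3) (t : ℝ) :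
    Differentiable ℝ (dx u i j t) :=
  (h.contDiff_dx i j t).differentiable (by simp)

theorem continuous_pd_dx (h : SpaceC2TimeC1 u) (i j k : Fin 3) :
    Continuous (fun z : ℝ × E3 => pd (dx u i j z.1) k z.2) := by
  have : ∀ z : ℝ × E3, pd (dx u i j z.1) k z.2 =
      fderiv ℝ (fderiv ℝ (u z.1)) z.2 (EuclideanSpace.single k 1)
        (EuclideanSpace.single j 1) i := by
    intro z
    have h1 : dx u i j z.1 = fun x => fderiv ℝ (u z.1) x (EuclideanSpace.single j 1) i :=
      funext fun x => h.dx_eq i j z.1 x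
    rw [h1, pd]
    have h2 := ((h.contDiff_fderiv z.1).differentiable (by simp) z.2).hasFDerivAt
    have h3 := ((EuclideanSpace.proj (𝕜 := ℝ) i).hasFDerivAt.comp z.2
      (h2.clm_apply (hasFDerivAt_const (EuclideanSpace.single j (1 : ℝ)) z.2)))
    refine (congrArg (fun L : E3 →L[ℝ] ℝ => L (EuclideanSpace.single k 1)) h3.fderiv).trans ?_
    simp
  simp only [this]
  exact (EuclideanSpace.proj (𝕜 := ℝ) i).continuous.comp
    ((h.2.2.2.1.clm_apply continuous_const).clm_apply continuous_const)

theorem continuous_lap (h : SpaceC2TimeC1 u) (i : Fin 3) :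
    Continuous (fun z : ℝ × E3 => lap u i z.1 z.2) :=
  continuous_finsetSum _ fun j _ => h.continuous_pd_dx i j j

theorem hasDerivAt_apply (h : SpaceC2TimeC1 u) (i : Fin 3) (t : ℝ) (x : E3) :
    HasDerivAt (fun s => u s x i) (dt u i t x) t :=
  ((EuclideanSpace.proj (𝕜 := ℝ) i).differentiableAt.comp t (h.2.2.2.2.1 x t)).hasDerivAt

theorem continuous_dt (h : SpaceC2TimeC1 u) (i : Fin 3) :
    Continuous (fun z : ℝ × E3 => dt u i z.1 z.2) := by
  have : ∀ z : ℝ × E3, dt u i z.1 z.2 = deriv (fun s => u s z.2) z.1 i := fun z =>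
    (((EuclideanSpace.proj (𝕜 := ℝ) i).hasFDerivAt.comp_hasDerivAt z.1
      (h.2.2.2.2.1 z.2 z.1).hasDerivAt).deriv)
  simp only [this]
  exact (EuclideanSpace.proj (𝕜 := ℝ) i).continuous.comp h.2.2.2.2.2

theorem zero : SpaceC2TimeC1 (fun _ _ => 0) := by
  refine ⟨continuous_const, fun _ => contDiff_const, ?_, ?_, fun _ => differentiable_const _, ?_⟩
  · simpa using continuous_const
  · simpa using continuous_const
  · simpa using continuous_const

theorem smul {θ : ℝ → ℝ} (hθ : ContDiff ℝ 1 θ) {Φ : E3 → E3} (hΦ : ContDiff ℝ 2 Φ) :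
    SpaceC2TimeC1 (fun t x => θ t • Φ x) := by
  have h1 : ∀ t, fderiv ℝ (fun x => θ t • Φ x) = fun x => θ t • fderiv ℝ Φ x := fun t =>
    funext fun x => fderiv_fun_const_smul (hΦ.differentiable (by simp) x) _
  have hΦ' : ContDiff ℝ 1 (fderiv ℝ Φ) := hΦ.fderiv_right (by norm_num)
  have h2 : ∀ t, fderiv ℝ (fun x => θ t • fderiv ℝ Φ x) = fun x => θ t • fderiv ℝ (fderiv ℝ Φ) x :=
    fun t => funext fun x => fderiv_fun_const_smul (hΦ'.differentiable (by simp) x) _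
  have h3 : ∀ x t, deriv (fun s => θ s • Φ x) t = deriv θ t • Φ x := fun x t =>
    deriv_smul_const (hθ.differentiable (by simp) t) _
  have c0 := hθ.continuous
  have c1 := hΦ.continuous
  have c2 := hΦ'.continuous
  have c3 : Continuous (fderiv ℝ (fderiv ℝ Φ)) := hΦ'.continuous_fderiv (by simp)
  have c4 : Continuous (deriv θ) := hθ.continuous_deriv (by simp)
  refine ⟨by fun_prop, fun t => hΦ.const_smul (θ t), ?_, ?_, fun x => ?_, ?_⟩
  · simp only [h1]; fun_prop
  · simp only [h1, h2]; fun_prop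
  · exact (hθ.differentiable (by simp)).smul_const _
  · simp only [h3]; fun_prop

end SpaceC2TimeC1

theorem SpaceC1.zero : SpaceC1 (fun _ _ => (0 : ℝ)) := by
  refine ⟨continuous_const, fun _ => contDiff_const, ?_⟩
  simpa using continuous_const

theorem SpaceC1.mul {θ : ℝ → ℝ} (hθ : Continuous θ) {ψ : E3 → ℝ} (hψ : ContDiff ℝ 1 ψ) :
    SpaceC1 (fun t x => θ t * ψ x) := by
  have h1 : ∀ t x, fderiv ℝ (fun x => θ t * ψ x) x = θ t • fderiv ℝ ψ x := fun t x =>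
    fderiv_const_mul (hψ.differentiable (by simp) x) _
  have c1 := hψ.continuous
  have c2 := hψ.continuous_fderiv (by simp)
  refine ⟨by fun_prop, fun t => contDiff_const.mul hψ, ?_⟩
  simp only [h1]; fun_prop

/-! ### Derivatives of the norm -/

/-- The derivative of `‖A‖` may be discontinuous or fail to exist at zeros of `A`; this bound
replaces continuity in the integrability of the surface density. The norm is `1`-Lipschitz, and the
extra `1` absorbs the remainder of the linearization. -/
theorem norm_fderiv_norm_le {A : E3 → E3} {x : E3} (hA : DifferentiableAt ℝ A x) :
    ‖fderiv ℝ (fun y => ‖A y‖) x‖ ≤ ‖fderiv ℝ A x‖ + 1 := by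
  by_cases hd : DifferentiableAt ℝ (fun y => ‖A y‖) x
  · refine hd.hasFDerivAt.le_of_lip' (by positivity) ?_
    have := hA.hasFDerivAt.isLittleO.def one_pos
    filter_upwards [this] with y hy
    rw [Real.norm_eq_abs]
    refine (abs_norm_sub_norm_le _ _).trans ?_
    calc ‖A y - A x‖ = ‖fderiv ℝ A x (y - x) + (A y - A x - fderiv ℝ A x (y - x))‖ := by
          congr 1; abel
      _ ≤ ‖fderiv ℝ A x (y - x)‖ + _ := norm_add_le _ _
      _ ≤ ‖fderiv ℝ A x‖ * ‖y - x‖ + 1 * ‖y - x‖ := add_le_add (ContinuousLinearMap.le_opNorm _ _) hy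
      _ = _ := by ring
  · rw [fderiv_zero_of_not_differentiableAt hd, norm_zero]; positivity

/-- Perturbing a vector field by a field vanishing at `x` changes the derivative of its norm at `x`
by a multiple of the gradient of the perturbation. -/
theorem exists_pd_norm_add {A : E3 → E3} {φ : E3 → ℝ} {x : E3} (hA : DifferentiableAt ℝ A x)
    (hφ : DifferentiableAt ℝ φ x) (h0 : φ x = 0) (v : E3) :
    ∃ c, ∀ i, pd (fun y => ‖A y + φ y • v‖) i x = pd (fun y => ‖A y‖) i x + c * pd φ i x := by
  -- At a common zero both norms have a minimum, so both derivatives are zero, with `fderiv` taking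
  -- the default value `0` if the norm is not differentiable. Elsewhere the chain rule applies.
  by_cases hx : A x = 0
  · refine ⟨0, fun i => ?_⟩
    have key : ∀ B : E3 → E3, B x = 0 → fderiv ℝ (fun y => ‖B y‖) x = 0 := by
      intro B hB
      refine IsLocalMin.fderiv_eq_zero (Eventually.of_forall fun y => ?_)
      simp [hB]
    simp [pd, key A hx, key (fun y => A y + φ y • v) (by simp [hx, h0])]
  · have hn : DifferentiableAt ℝ (fun y : E3 => ‖y‖) (A x) :=
      (contDiffAt_norm ℝ (n := 1) hx).differentiableAt (by simp)
    refine ⟨fderiv ℝ (fun y : E3 => ‖y‖) (A x) v, fun i => ?_⟩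
    have h1 := hn.hasFDerivAt.comp x hA.hasFDerivAt
    have hn' : HasFDerivAt (fun y : E3 => ‖y‖) (fderiv ℝ (fun y : E3 => ‖y‖) (A x))
        (A x + φ x • v) := by
      rw [h0, zero_smul, add_zero]; exact hn.hasFDerivAt
    have h2 := hn'.comp (f := fun y => A y + φ y • v) x
      (hA.hasFDerivAt.add (hφ.hasFDerivAt.smul_const v))
    simp only [pd]
    rw [show (fun y => ‖A y + φ y • v‖) = (fun y : E3 => ‖y‖) ∘ (fun y => A y + φ y • v) from rfl,
      show (fun y => ‖A y‖) = (fun y : E3 => ‖y‖) ∘ A from rfl, h1.fderiv, h2.fderiv]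
    simp
    ring

/-! ### Integrals depending on a parameter -/

theorem integrable_prod_of_bounded {τ : ℝ} {μ : Measure E3} {K : Set E3}
    (hK : MeasurableSet K) [IsFiniteMeasure (μ.restrict K)] {f : ℝ × E3 → ℝ}
    (hf : AEStronglyMeasurable f ((volume.restrict (Ioc 0 τ)).prod (μ.restrict K)))
    {C : ℝ} (hC : ∀ z ∈ Icc 0 τ ×ˢ K, |f z| ≤ C) :
    Integrable f ((volume.restrict (Ioc 0 τ)).prod (μ.restrict K)) := by
  refine Integrable.of_bound hf C ?_
  have h1 : ∀ᵐ z ∂((volume.restrict (Ioc 0 τ)).prod (μ.restrict K)), z.1 ∈ Ioc 0 τ :=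
    Measure.quasiMeasurePreserving_fst.ae (ae_restrict_mem measurableSet_Ioc)
  have h2 : ∀ᵐ z ∂((volume.restrict (Ioc 0 τ)).prod (μ.restrict K)), z.2 ∈ K :=
    Measure.quasiMeasurePreserving_snd.ae (ae_restrict_mem hK)
  filter_upwards [h1, h2] with z hz1 hz2
  exact hC z ⟨Ioc_subset_Icc_self hz1, hz2⟩

/-- Along the directions used, both densities are polynomials of degree at most two in `ε`, so no
differentiation under the integral is needed. The expansion is required only almost everywhere,
since on the surface it holds only at points of `∂Ω`. -/
theorem hasDerivAt_integral_quadratic {τ : ℝ} (hτ : 0 < τ) {μ : Measure E3} [SFinite μ]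
    {F : ℝ → ℝ → E3 → ℝ} {f₀ f₁ f₂ : ℝ × E3 → ℝ}
    (h₀ : Integrable f₀ ((volume.restrict (Ioc 0 τ)).prod μ))
    (h₁ : Integrable f₁ ((volume.restrict (Ioc 0 τ)).prod μ))
    (h₂ : Integrable f₂ ((volume.restrict (Ioc 0 τ)).prod μ))
    (hF : ∀ ε t, ∀ᵐ x ∂μ, F ε t x = f₀ (t, x) + ε * f₁ (t, x) + ε ^ 2 * f₂ (t, x)) :
    HasDerivAt (fun ε => ∫ t in (0 : ℝ)..τ, ∫ x, F ε t x ∂μ)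
      (∫ t in (0 : ℝ)..τ, ∫ x, f₁ (t, x) ∂μ) 0 := by
  set P := (volume.restrict (Ioc 0 τ)).prod μ with hP
  have key : ∀ ε, ∫ t in (0 : ℝ)..τ, ∫ x, F ε t x ∂μ =
      ∫ z, f₀ z ∂P + ε * ∫ z, f₁ z ∂P + ε ^ 2 * ∫ z, f₂ z ∂P := by
    intro ε
    have h3 : Integrable (fun z => f₀ z + ε * f₁ z + ε ^ 2 * f₂ z) P :=
      (h₀.add (h₁.const_mul ε)).add (h₂.const_mul (ε ^ 2))
    calc ∫ t in (0 : ℝ)..τ, ∫ x, F ε t x ∂μ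
        = ∫ t in (0 : ℝ)..τ, ∫ x, (f₀ (t, x) + ε * f₁ (t, x) + ε ^ 2 * f₂ (t, x)) ∂μ := by
          congr 1; ext t; exact integral_congr_ae (hF ε t)
      _ = ∫ z, (f₀ z + ε * f₁ z + ε ^ 2 * f₂ z) ∂P := by
          rw [intervalIntegral.integral_of_le hτ.le, hP, integral_prod _ h3]
      _ = _ := by
          rw [integral_add (f := fun z => f₀ z + ε * f₁ z) (h₀.add (h₁.const_mul ε))
            (h₂.const_mul (ε ^ 2)), integral_add h₀ (h₁.const_mul ε), integral_const_mul, integral_const_mul]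
  have h4 : ∫ t in (0 : ℝ)..τ, ∫ x, f₁ (t, x) ∂μ = ∫ z, f₁ z ∂P := by
    rw [intervalIntegral.integral_of_le hτ.le, hP, integral_prod _ h₁]
  simp only [key]
  rw [h4]
  have h5 := (((hasDerivAt_id (0 : ℝ)).mul_const (∫ z, f₁ z ∂P)).const_add (∫ z, f₀ z ∂P)).add
    ((hasDerivAt_pow 2 (0 : ℝ)).mul_const (∫ z, f₂ z ∂P))
  simp only [id, one_mul, Nat.cast_ofNat, Nat.add_one_sub_one, pow_one, mul_zero, zero_mul,
    add_zero] at h5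
  exact h5

/-! ### Directions of variation -/

/-- The variation `δp = θ ψ`. -/
noncomputable def pressureVar (θ : ℝ → ℝ) (ψ : E3 → ℝ) : Fields where
  u := fun _ _ => 0
  p := fun t x => θ t * ψ x
  w := fun _ _ => 0
  r := fun _ _ => 0

/-- The variation `δu = θ φ e_i`. -/
noncomputable def velocityVar (θ : ℝ → ℝ) (φ : E3 → ℝ) (i : Fin 3) : Fields where
  u := fun t x => θ t • (φ x • EuclideanSpace.single i (1 : ℝ))
  p := fun _ _ => 0
  w := fun _ _ => 0
  r := fun _ _ => 0

theorem isVariation_pressureVar (τ : ℝ) (Ω : Set E3) (x₀ : E3) {θ : ℝ → ℝ} (hθ : Continuous θ)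
    {ψ : E3 → ℝ} (hψ : ContDiff ℝ 1 ψ) : IsVariation τ Ω x₀ (pressureVar θ ψ) := by
  refine ⟨⟨⟨SpaceC2TimeC1.zero, SpaceC2TimeC1.zero, SpaceC1.mul hθ hψ, SpaceC1.zero⟩, ?_, ?_, ?_⟩, ?_⟩
  all_goals simp [pressureVar]

/-- Since `δw = 0`, the boundary constraint requires `δu = 0` on `∂Ω`; this also settles the
condition at `x₀`. -/
theorem isVariation_velocityVar {τ : ℝ} {Ω : Set E3} {x₀ : E3} (hx₀ : x₀ ∈ frontier Ω)
    {θ : ℝ → ℝ} (hθ : ContDiff ℝ 1 θ) (h0 : θ 0 = 0) (h1 : θ τ = 0)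
    {φ : E3 → ℝ} (hφ : ContDiff ℝ 2 φ) (hφ0 : ∀ x ∈ frontier Ω, φ x = 0) (i : Fin 3) :
    IsVariation τ Ω x₀ (velocityVar θ φ i) := by
  refine ⟨⟨⟨SpaceC2TimeC1.smul hθ (hφ.smul contDiff_const), SpaceC2TimeC1.zero, SpaceC1.zero,
    SpaceC1.zero⟩, ?_, ?_, ?_⟩, ?_⟩
  · intro x _; simp [velocityVar, h0]
  · intro x _; simp [velocityVar, h1]
  · intro t _; simp [velocityVar, hφ0 x₀ hx₀]
  · intro t _ x hx; simp [velocityVar, hφ0 x hx]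

/-! ### Expansion of the densities in powers of `ε` -/

section Perturb

variable (s : Fields) (θ : ℝ → ℝ) (ε : ℝ)

theorem perturb_pressureVar (ψ : E3 → ℝ) : s.perturb (pressureVar θ ψ) ε =
    ⟨s.u, fun t x => s.p t x + ε * (θ t * ψ x), s.w, s.r⟩ := by
  simp [Fields.perturb, pressureVar]

theorem perturb_velocityVar (φ : E3 → ℝ) (i : Fin 3) : s.perturb (velocityVar θ φ i) ε =
    ⟨fun t x => s.u t x + ε • (θ t • (φ x • EuclideanSpace.single i (1 : ℝ))), s.p, s.w, s.r⟩ := by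
  simp [Fields.perturb, velocityVar]

end Perturb

theorem lagrangian_pressureVar (ν : ℝ) {s : Fields} (hs : s.Regular) (θ : ℝ → ℝ) {ψ : E3 → ℝ}
    (hψ : ContDiff ℝ 1 ψ) (ε t : ℝ) (x : E3) :
    lagrangian ν (s.perturb (pressureVar θ ψ) ε) t x =
      lagrangian ν s t x + ε * (θ t * ∑ i, s.u t x i * pd ψ i x) := by
  rw [perturb_pressureVar]
  have h1 : ∀ i, pd (fun y => s.p t y + ε * (θ t * ψ y)) i x =
      pd (s.p t) i x + ε * (θ t * pd ψ i x) := by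
    intro i
    have hd := hψ.differentiable (by simp) x
    rw [pd_add (hs.2.2.1.differentiable t x) ((hd.const_mul _).const_mul _),
      pd_const_mul (hd.const_mul _), pd_const_mul hd]
  simp only [lagrangian, h1, mul_add, Finset.sum_add_distrib, Finset.mul_sum]
  have h2 : ∑ i, s.u t x i * (ε * (θ t * pd ψ i x)) = ∑ i, ε * (θ t * (s.u t x i * pd ψ i x)) :=
    Finset.sum_congr rfl fun i _ => by ring
  rw [h2]
  ring

theorem surfaceDensity_pressureVar (ν : ℝ) (us ws : ℝ → E3 → E3) (s : Fields) (θ : ℝ → ℝ)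
    (ψ : E3 → ℝ) (ε t : ℝ) (x : E3) (j : Fin 3) :
    surfaceDensity ν us ws (s.perturb (pressureVar θ ψ) ε) j t x =
      surfaceDensity ν us ws s j t x + ε * (θ t * (-(us t x j) * ψ x)) := by
  rw [perturb_pressureVar]
  simp only [surfaceDensity]
  ring

/-- The first variation of the Lagrangian density in the direction `δu = θ φ e_i`. -/
noncomputable def lagrangianVelocityVar (ν : ℝ) (s : Fields) (θ : ℝ → ℝ) (φ : E3 → ℝ) (i : Fin 3) (t : ℝ)
    (x : E3) : ℝ :=
  θ t * (ν * ∑ j, dx s.u i j t x * pd φ j x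
    + φ x * (1 / 2 * ∑ j, s.u t x j * dx s.w i j t x
      + 1 / 2 * ∑ j, (s.w t x j + s.u t x j) * dx s.w j i t x
      + pd (s.p t) i x + 1 / 2 * dt s.w i t x
      - 1 / 2 * ∑ j, s.w t x j * dx s.u i j t x)
    - 1 / 2 * ∑ j, (s.u t x i + s.w t x i) * s.w t x j * pd φ j x)
  - 1 / 2 * (deriv θ t * s.w t x i) * φ x

/-- The second order term of the Lagrangian density in the direction `δu = θ φ e_i`. -/
noncomputable def lagrangianVelocityVarSnd (ν : ℝ) (s : Fields) (θ : ℝ → ℝ) (φ : E3 → ℝ) (i : Fin 3) (t : ℝ)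
    (x : E3) : ℝ :=
  θ t ^ 2 * (ν / 2 * ∑ j, pd φ j x ^ 2 + 1 / 2 * φ x ^ 2 * dx s.w i i t x
    - 1 / 2 * φ x * ∑ j, s.w t x j * pd φ j x)

/-- The algebra at one point, with the values as independent reals: `UT`, `WT` are time derivatives,
`P`, `R`, `D` the gradients of `p`, `r`, `φ`, and `c` is the unit vector `e_i`. -/
theorem lagrangian_velocityVar_aux (ν ε θ θ' φ : ℝ) (U W UT WT P R D : Fin 3 → ℝ)
    (DU DW : Fin 3 → Fin 3 → ℝ) (i : Fin 3) (c : Fin 3 → ℝ) (hc : ∀ k, c k = if k = i then 1 else 0) :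
    (ν / 2 * ∑ k, ∑ j, (DU k j + ε * (θ * (c k * D j))) ^ 2
    + 1 / 2 * ∑ k, ∑ j, (W k + (U k + ε * (θ * (φ * c k)))) * (U j + ε * (θ * (φ * c j))) * DW k j
    + ∑ k, (U k + ε * (θ * (φ * c k))) * P k
    + ∑ k, (U k + ε * (θ * (φ * c k))) / 2 * WT k)
  - (ν / 2 * ∑ k, ∑ j, (DW k j) ^ 2
    + 1 / 2 * ∑ k, ∑ j, ((U k + ε * (θ * (φ * c k))) + W k) * W j * (DU k j + ε * (θ * (c k * D j)))
    + ∑ k, W k * R k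
    + ∑ k, W k / 2 * (UT k + ε * (θ' * (φ * c k)))) =
    ((ν / 2 * ∑ k, ∑ j, (DU k j) ^ 2
    + 1 / 2 * ∑ k, ∑ j, (W k + U k) * U j * DW k j
    + ∑ k, U k * P k
    + ∑ k, U k / 2 * WT k)
  - (ν / 2 * ∑ k, ∑ j, (DW k j) ^ 2
    + 1 / 2 * ∑ k, ∑ j, (U k + W k) * W j * DU k j
    + ∑ k, W k * R k
    + ∑ k, W k / 2 * UT k)) + ε *
    (θ * (ν * ∑ j, DU i j * D j
    + φ * (1 / 2 * ∑ j, U j * DW i j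
      + 1 / 2 * ∑ j, (W j + U j) * DW j i
      + P i + 1 / 2 * WT i
      - 1 / 2 * ∑ j, W j * DU i j)
    - 1 / 2 * ∑ j, (U i + W i) * W j * D j)
  - 1 / 2 * (θ' * W i) * φ) + ε ^ 2 *
  (θ ^ 2 * (ν / 2 * ∑ j, D j ^ 2 + 1 / 2 * φ ^ 2 * DW i i
    - 1 / 2 * φ * ∑ j, W j * D j)) := by
  simp only [Fin.sum_univ_three, hc]
  fin_cases i <;> simp <;> ring

theorem single_apply_eq_ite (i k : Fin 3) :
    (EuclideanSpace.single i (1 : ℝ) : E3) k = if k = i then 1 else 0 := by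
  simp

section VelocityVar

variable {s : Fields} (hs : s.Regular) {θ : ℝ → ℝ} (hθ : ContDiff ℝ 1 θ) {φ : E3 → ℝ}
  (hφ : ContDiff ℝ 2 φ) (i k j : Fin 3) (ε t : ℝ) (x : E3)

include hs hφ in
theorem dx_velocityVar : dx (fun t x => s.u t x + ε • (θ t • (φ x • EuclideanSpace.single i (1 : ℝ))))
    k j t x = dx s.u k j t x +
      ε * (θ t * ((EuclideanSpace.single i (1 : ℝ) : E3) k * pd φ j x)) := by
  have hd := hφ.differentiable (by simp) x
  have : (fun y => (s.u t y + ε • (θ t • (φ y • EuclideanSpace.single i (1 : ℝ)))) k) =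
      fun y => s.u t y k +
        (ε * (θ t * (EuclideanSpace.single i (1 : ℝ) : E3) k)) * φ y := by
    ext y
    simp only [PiLp.add_apply, PiLp.smul_apply, smul_eq_mul]
    ring
  rw [dx, this, pd_add (hs.1.differentiable_apply t k x) (hd.const_mul _), pd_const_mul hd, dx]
  ring

include hs hθ in
theorem dt_velocityVar : dt (fun t x => s.u t x + ε • (θ t • (φ x • EuclideanSpace.single i (1 : ℝ))))
    k t x = dt s.u k t x +
      ε * (deriv θ t * (φ x * (EuclideanSpace.single i (1 : ℝ) : E3) k)) := by
  have hd := (hθ.differentiable (by simp) t).hasDerivAt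
  have : (fun r => (s.u r x + ε • (θ r • (φ x • EuclideanSpace.single i (1 : ℝ)))) k) =
      fun r => s.u r x k + ε * (θ r * (φ x * (EuclideanSpace.single i (1 : ℝ) : E3) k)) := by
    ext r
    simp only [PiLp.add_apply, PiLp.smul_apply, smul_eq_mul]
  rw [dt, this]
  exact ((hs.1.hasDerivAt_apply k t x).add ((hd.mul_const _).const_mul ε)).deriv

include hs hθ hφ in
theorem lagrangian_velocityVar (ν : ℝ) :
    lagrangian ν (s.perturb (velocityVar θ φ i) ε) t x =
      lagrangian ν s t x + ε * lagrangianVelocityVar ν s θ φ i t x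
        + ε ^ 2 * lagrangianVelocityVarSnd ν s θ φ i t x := by
  rw [perturb_velocityVar]
  simp only [lagrangian, dx_velocityVar hs hφ, dt_velocityVar hs hθ, PiLp.add_apply,
    PiLp.smul_apply, smul_eq_mul, lagrangianVelocityVar, lagrangianVelocityVarSnd]
  exact lagrangian_velocityVar_aux ν ε (θ t) (deriv θ t) (φ x) (fun k => s.u t x k)
    (fun k => s.w t x k) (fun k => dt s.u k t x) (fun k => dt s.w k t x) (fun k => pd (s.p t) k x)
    (fun k => pd (s.r t) k x) (fun k => pd φ k x) (fun k j => dx s.u k j t x)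
    (fun k j => dx s.w k j t x) i _ (single_apply_eq_ite i)

/-- The symbol is antisymmetric in `i, j` while `n_i n_j` is symmetric: only tangential derivatives
enter `n_j ℳ_j`. -/
theorem sum_permSymbol_eq_zero (X n : Fin 3 → ℝ) :
    ∑ j, (∑ i, ∑ k, permSymbol i j k * X k * n i) * n j = 0 := by
  simp only [Fin.sum_univ_three, permSymbol]
  norm_num
  ring

include hs hφ in
-- Where `φ = 0` all undifferentiated fields keep their values, so only `∂_j u_i` and the derivative
-- of the norm change, and the latter change is normal. The result is affine in `ε` although the
-- norm is nonlinear.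
theorem surfaceDensity_velocityVar (ν : ℝ) {us ws : ℝ → E3 → E3} (hus : SpaceC1 us)
    (hws : SpaceC1 ws) (h0 : φ x = 0) {n : Fin 3 → ℝ} {c : ℝ} (hn : ∀ j, pd φ j x = c * n j) :
    ∑ j, surfaceDensity ν us ws (s.perturb (velocityVar θ φ i) ε) j t x * n j =
      ∑ j, surfaceDensity ν us ws s j t x * n j +
        ε * (θ t * (ν * (-(s.u t x i - us t x i) * ∑ j, pd φ j x * n j))) := by
  rw [perturb_velocityVar]
  set A : E3 → E3 := fun y => s.u t y - us t y + s.w t y - ws t y with hA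
  have hAd : DifferentiableAt ℝ A x :=
    (((hs.1.spaceC1.differentiable t).sub (hus.differentiable t)).add
      (hs.2.1.spaceC1.differentiable t)).sub (hws.differentiable t) x
  have hB : (fun y => ‖s.u t y + ε • (θ t • (φ y • EuclideanSpace.single i (1 : ℝ))) - us t y
      + s.w t y - ws t y‖) =
      fun y => ‖A y + φ y • ((ε * θ t) • EuclideanSpace.single i (1 : ℝ))‖ := by
    ext y
    congr 1
    simp only [hA]
    module
  obtain ⟨κ, hκ⟩ := exists_pd_norm_add hAd (hφ.differentiable (by simp) x) h0
    ((ε * θ t) • EuclideanSpace.single i (1 : ℝ))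
  -- The increment `κ ∇φ = κ c n` of the derivative of the norm drops out by antisymmetry.
  have hperm : ∀ X : Fin 3 → ℝ,
      ∑ j, (∑ l, ∑ k, permSymbol l j k * X k * (pd (fun y => ‖A y‖) l x + κ * pd φ l x)) * n j =
      ∑ j, (∑ l, ∑ k, permSymbol l j k * X k * pd (fun y => ‖A y‖) l x) * n j := by
    intro X
    have h1 := sum_permSymbol_eq_zero X n
    simp only [hn, mul_add, add_mul, Finset.sum_add_distrib]
    rw [add_eq_left]
    calc _ = κ * c * ∑ j, (∑ i, ∑ k, permSymbol i j k * X k * n i) * n j := by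
          simp only [Finset.mul_sum, Finset.sum_mul]
          refine Finset.sum_congr rfl fun j _ => Finset.sum_congr rfl fun l _ =>
            Finset.sum_congr rfl fun k _ => by ring
      _ = 0 := by rw [h1, mul_zero]
  have hvis : ∀ j, ∑ k, (-(s.u t x k - us t x k) * (dx s.u k j t x +
      ε * (θ t * ((EuclideanSpace.single i (1 : ℝ) : E3) k * pd φ j x))) +
      (s.w t x k - ws t x k) * dx s.w k j t x) =
      ∑ k, (-(s.u t x k - us t x k) * dx s.u k j t x + (s.w t x k - ws t x k) * dx s.w k j t x)
        + ε * (θ t * (-(s.u t x i - us t x i) * pd φ j x)) := by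
    intro j
    simp only [single_apply_eq_ite, Fin.sum_univ_three]
    fin_cases i <;> simp <;> ring
  simp only [surfaceDensity, dx_velocityVar hs hφ, hB, hκ, h0, zero_smul, smul_zero, add_zero, hvis]
  have hp := hperm fun k => s.w t x k - ws t x k - s.u t x k + us t x k
  simp only [Fin.sum_univ_three] at hp ⊢
  linear_combination ν * hp

end VelocityVar

/-! ### Integrability of the densities -/

theorem continuous_lagrangian (ν : ℝ) {s : Fields} (hs : s.Regular) :
    Continuous (fun z : ℝ × E3 => lagrangian ν s z.1 z.2) := by
  have h1 := hs.1.continuous_apply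
  have h2 := hs.2.1.continuous_apply
  have h3 := hs.1.continuous_dx
  have h4 := hs.2.1.continuous_dx
  have h5 := hs.1.continuous_dt
  have h6 := hs.2.1.continuous_dt
  have h7 := hs.2.2.1.continuous_pd
  have h8 := hs.2.2.2.continuous_pd
  unfold lagrangian
  repeat' first
    | with_reducible exact h1 _
    | with_reducible exact h2 _
    | with_reducible exact h3 _ _
    | with_reducible exact h4 _ _
    | with_reducible exact h5 _
    | with_reducible exact h6 _
    | with_reducible exact h7 _
    | with_reducible exact h8 _
    | with_reducible exact continuous_const
    | with_reducible_and_instances refine Continuous.add ?_ ?_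
    | with_reducible_and_instances refine Continuous.sub ?_ ?_
    | with_reducible_and_instances refine Continuous.mul ?_ ?_
    | with_reducible_and_instances refine Continuous.neg ?_
    | with_reducible_and_instances refine Continuous.pow ?_ _
    | with_reducible_and_instances refine Continuous.div_const ?_ _
    | with_reducible_and_instances refine continuous_finsetSum _ fun _ _ => ?_

theorem continuous_lagrangianVelocityVar (ν : ℝ) {s : Fields} (hs : s.Regular) {θ : ℝ → ℝ}
    (hθ : ContDiff ℝ 1 θ) {φ : E3 → ℝ} (hφ : ContDiff ℝ 2 φ) (i : Fin 3) :
    Continuous (fun z : ℝ × E3 => lagrangianVelocityVar ν s θ φ i z.1 z.2) := by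
  have h1 := hs.1.continuous_apply
  have h2 := hs.2.1.continuous_apply
  have h3 := hs.1.continuous_dx
  have h4 := hs.2.1.continuous_dx
  have h6 := hs.2.1.continuous_dt
  have h7 := hs.2.2.1.continuous_pd
  have h9 : Continuous (fun z : ℝ × E3 => θ z.1) := hθ.continuous.comp continuous_fst
  have h10 : Continuous (fun z : ℝ × E3 => deriv θ z.1) :=
    (hθ.continuous_deriv (by simp)).comp continuous_fst
  have h11 : Continuous (fun z : ℝ × E3 => φ z.2) := hφ.continuous.comp continuous_snd
  have h12 : ∀ j, Continuous (fun z : ℝ × E3 => pd φ j z.2) := fun j =>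
    (continuous_pd (hφ.of_le (by norm_num)) j).comp continuous_snd
  unfold lagrangianVelocityVar
  repeat' first
    | with_reducible exact h1 _
    | with_reducible exact h2 _
    | with_reducible exact h3 _ _
    | with_reducible exact h4 _ _
    | with_reducible exact h6 _
    | with_reducible exact h7 _
    | with_reducible exact h9
    | with_reducible exact h10
    | with_reducible exact h11
    | with_reducible exact h12 _
    | with_reducible exact continuous_const
    | with_reducible_and_instances refine Continuous.add ?_ ?_
    | with_reducible_and_instances refine Continuous.sub ?_ ?_
    | with_reducible_and_instances refine Continuous.mul ?_ ?_
    | with_reducible_and_instances refine Continuous.neg ?_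
    | with_reducible_and_instances refine Continuous.pow ?_ _
    | with_reducible_and_instances refine Continuous.div_const ?_ _
    | with_reducible_and_instances refine continuous_finsetSum _ fun _ _ => ?_

theorem continuous_lagrangianVelocityVarSnd (ν : ℝ) {s : Fields} (hs : s.Regular) {θ : ℝ → ℝ}
    (hθ : ContDiff ℝ 1 θ) {φ : E3 → ℝ} (hφ : ContDiff ℝ 2 φ) (i : Fin 3) :
    Continuous (fun z : ℝ × E3 => lagrangianVelocityVarSnd ν s θ φ i z.1 z.2) := by
  have h2 := hs.2.1.continuous_apply
  have h4 := hs.2.1.continuous_dx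
  have h9 : Continuous (fun z : ℝ × E3 => θ z.1) := hθ.continuous.comp continuous_fst
  have h11 : Continuous (fun z : ℝ × E3 => φ z.2) := hφ.continuous.comp continuous_snd
  have h12 : ∀ j, Continuous (fun z : ℝ × E3 => pd φ j z.2) := fun j =>
    (continuous_pd (hφ.of_le (by norm_num)) j).comp continuous_snd
  unfold lagrangianVelocityVarSnd
  repeat' first
    | with_reducible exact h2 _
    | with_reducible exact h4 _ _
    | with_reducible exact h9
    | with_reducible exact h11
    | with_reducible exact h12 _
    | with_reducible exact continuous_const
    | with_reducible_and_instances refine Continuous.add ?_ ?_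
    | with_reducible_and_instances refine Continuous.sub ?_ ?_
    | with_reducible_and_instances refine Continuous.mul ?_ ?_
    | with_reducible_and_instances refine Continuous.neg ?_
    | with_reducible_and_instances refine Continuous.pow ?_ _
    | with_reducible_and_instances refine Continuous.div_const ?_ _
    | with_reducible_and_instances refine continuous_finsetSum _ fun _ _ => ?_

theorem integrable_prod_of_continuous {τ : ℝ} {μ : Measure E3} {K : Set E3}
    (hK : MeasurableSet K) (hb : Bornology.IsBounded K) [IsFiniteMeasure (μ.restrict K)]
    {f : ℝ × E3 → ℝ} (hf : Continuous f) :
    Integrable f ((volume.restrict (Ioc 0 τ)).prod (μ.restrict K)) := by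
  have hc : IsCompact (Icc 0 τ ×ˢ closure K) := isCompact_Icc.prod hb.isCompact_closure
  obtain ⟨C, hC⟩ := hc.exists_bound_of_continuousOn hf.continuousOn
  exact integrable_prod_of_bounded hK hf.aestronglyMeasurable
    fun z hz => hC z ⟨hz.1, subset_closure hz.2⟩

/-- Measurable and bounded on `[0, τ] × K`. -/
def BoundedMeasurable (τ : ℝ) (μ : Measure E3) (K : Set E3) (f : ℝ × E3 → ℝ) : Prop :=
  AEStronglyMeasurable f ((volume.restrict (Ioc 0 τ)).prod (μ.restrict K)) ∧
    ∃ C, ∀ z ∈ Icc 0 τ ×ˢ K, |f z| ≤ C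

namespace BoundedMeasurable

variable {τ : ℝ} {μ : Measure E3} {K : Set E3} {f g : ℝ × E3 → ℝ}

theorem add (hf : BoundedMeasurable τ μ K f) (hg : BoundedMeasurable τ μ K g) :
    BoundedMeasurable τ μ K (fun z => f z + g z) := by
  obtain ⟨hf, C, hC⟩ := hf
  obtain ⟨hg, D, hD⟩ := hg
  exact ⟨hf.add hg, C + D, fun z hz => (abs_add_le _ _).trans (add_le_add (hC z hz) (hD z hz))⟩

theorem mul (hf : BoundedMeasurable τ μ K f) (hg : BoundedMeasurable τ μ K g) :
    BoundedMeasurable τ μ K (fun z => f z * g z) := by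
  obtain ⟨hf, C, hC⟩ := hf
  obtain ⟨hg, D, hD⟩ := hg
  refine ⟨hf.mul hg, C * D, fun z hz => ?_⟩
  rw [abs_mul]
  exact mul_le_mul (hC z hz) (hD z hz) (abs_nonneg _) ((abs_nonneg _).trans (hC z hz))

theorem sum {ι : Type*} {t : Finset ι} {F : ι → ℝ × E3 → ℝ}
    (hF : ∀ i ∈ t, BoundedMeasurable τ μ K (F i)) :
    BoundedMeasurable τ μ K (fun z => ∑ i ∈ t, F i z) := by
  classical
  induction t using Finset.induction_on with
  | empty => exact ⟨by simpa using aestronglyMeasurable_const, 0, by simp⟩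
  | insert a t ha ih =>
    simp only [Finset.sum_insert ha]
    exact (hF a (by simp)).add (ih fun i hi => hF i (by simp [hi]))

theorem of_continuous (hb : Bornology.IsBounded K) (hf : Continuous f) :
    BoundedMeasurable τ μ K f := by
  have hc : IsCompact (Icc 0 τ ×ˢ closure K) := isCompact_Icc.prod hb.isCompact_closure
  obtain ⟨C, hC⟩ := hc.exists_bound_of_continuousOn hf.continuousOn
  exact ⟨hf.aestronglyMeasurable, C, fun z hz => hC z ⟨hz.1, subset_closure hz.2⟩⟩

theorem integrable (hf : BoundedMeasurable τ μ K f) (hK : MeasurableSet K)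
    [IsFiniteMeasure (μ.restrict K)] :
    Integrable f ((volume.restrict (Ioc 0 τ)).prod (μ.restrict K)) :=
  integrable_prod_of_bounded hK hf.1 hf.2.choose_spec

theorem of_continuousOn_snd [SFinite (μ.restrict K)] (hK : IsCompact K) {n : E3 → ℝ}
    (hn : ContinuousOn n K) : BoundedMeasurable τ μ K (fun z => n z.2) := by
  obtain ⟨C, hC⟩ := hK.exists_bound_of_continuousOn hn
  exact ⟨(hn.aestronglyMeasurable hK.measurableSet).comp_snd, C, fun z hz => hC z.2 hz.2⟩

/-- Continuity can fail at zeros of `A`. Measurability holds for the spatial derivative of any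
jointly continuous function, and boundedness comes from `norm_fderiv_norm_le`. -/
theorem pd_norm (hb : Bornology.IsBounded K) {A : ℝ → E3 → E3} (hA : SpaceC1 A) (i : Fin 3) :
    BoundedMeasurable τ μ K (fun z => pd (fun y => ‖A z.1 y‖) i z.2) := by
  have hc : IsCompact (Icc 0 τ ×ˢ closure K) := isCompact_Icc.prod hb.isCompact_closure
  obtain ⟨C, hC⟩ := hc.exists_bound_of_continuousOn hA.2.2.continuousOn
  refine ⟨?_, C + 1, fun z hz => ?_⟩
  · have : Continuous (Function.uncurry fun (t : ℝ) (y : E3) => ‖A t y‖) := hA.1.norm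
    exact (measurable_fderiv_apply_const_with_param ℝ this _).aestronglyMeasurable
  · have h1 := hC z ⟨hz.1, subset_closure hz.2⟩
    have h2 := norm_fderiv_norm_le (hA.differentiable z.1 z.2)
    have h3 := (fderiv ℝ (fun y => ‖A z.1 y‖) z.2).le_opNorm (EuclideanSpace.single i (1 : ℝ))
    rw [PiLp.norm_single, norm_one, mul_one, Real.norm_eq_abs] at h3
    exact h3.trans (h2.trans (by linarith))

end BoundedMeasurable

/-! ### First variation identities integrated over time -/

section Stationary

variable {ν τ : ℝ} {Ω : Set E3} (hΩo : IsOpen Ω) (hΩb : Bornology.IsBounded Ω)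
  (hΩs : HasSmoothBoundary Ω) {us ws : ℝ → E3 → E3} (hus : SpaceC1 us) (hws : SpaceC1 ws)
  {x₀ : E3} {s : Fields} (hs : s.Regular)

theorem isBounded_frontier {Ω : Set E3} (hΩb : Bornology.IsBounded Ω) :
    Bornology.IsBounded (frontier Ω) := hΩb.closure.subset frontier_subset_closure

theorem isCompact_frontier {Ω : Set E3} (hΩb : Bornology.IsBounded Ω) : IsCompact (frontier Ω) :=
  Metric.isCompact_of_isClosed_isBounded isClosed_frontier (isBounded_frontier hΩb)

theorem continuousOn_outwardNormal_apply {Ω : Set E3} (hΩo : IsOpen Ω) (hΩs : HasSmoothBoundary Ω)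
    (j : Fin 3) : ContinuousOn (fun x => outwardNormal Ω x j) (frontier Ω) :=
  (EuclideanSpace.proj (𝕜 := ℝ) j).continuous.comp_continuousOn
    (continuousOn_outwardNormal hΩo hΩs)

include hΩo hΩb hΩs in
theorem boundedMeasurable_outwardNormal (j : Fin 3) :
    BoundedMeasurable τ (Measure.euclideanHausdorffMeasure 2) (frontier Ω)
      (fun z => outwardNormal Ω z.2 j) := by
  have := isFiniteMeasure_surfaceArea hΩo hΩb hΩs
  rw [surfaceArea] at this
  exact .of_continuousOn_snd (isCompact_frontier hΩb) (continuousOn_outwardNormal_apply hΩo hΩs j)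

include hΩo hΩb hΩs hus hws hs in
theorem boundedMeasurable_surfaceDensity :
    BoundedMeasurable τ (Measure.euclideanHausdorffMeasure 2) (frontier Ω)
      (fun z => ∑ j, surfaceDensity ν us ws s j z.1 z.2 * outwardNormal Ω z.2 j) := by
  have hb := isBounded_frontier hΩb
  have h1 := hs.1.continuous_apply
  have h2 := hs.2.1.continuous_apply
  have h3 := hs.1.continuous_dx
  have h4 := hs.2.1.continuous_dx
  have h5 := hs.2.2.1.1
  have h6 := hs.2.2.2.1
  have h7 := hus.continuous_apply
  have h8 := hws.continuous_apply
  have hA : SpaceC1 (fun t y => s.u t y - us t y + s.w t y - ws t y) := by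
    have d1 := hs.1.spaceC1
    have d2 := hs.2.1.spaceC1
    refine ⟨((d1.1.sub hus.1).add d2.1).sub hws.1,
      fun t => (((d1.2.1 t).sub (hus.2.1 t)).add (d2.2.1 t)).sub (hws.2.1 t), ?_⟩
    have : ∀ z : ℝ × E3, fderiv ℝ (fun y => s.u z.1 y - us z.1 y + s.w z.1 y - ws z.1 y) z.2 =
        fderiv ℝ (s.u z.1) z.2 - fderiv ℝ (us z.1) z.2 + fderiv ℝ (s.w z.1) z.2
          - fderiv ℝ (ws z.1) z.2 := fun z =>
      ((((d1.differentiable z.1 z.2).hasFDerivAt.sub (hus.differentiable z.1 z.2).hasFDerivAt).add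
        (d2.differentiable z.1 z.2).hasFDerivAt).sub (hws.differentiable z.1 z.2).hasFDerivAt).fderiv
    simp only [this]
    exact ((d1.2.2.sub hus.2.2).add d2.2.2).sub hws.2.2
  refine .sum fun j _ => .mul (.add (.of_continuous hb ?_)
    (.mul (.of_continuous hb continuous_const) (.add (.of_continuous hb ?_)
      (.sum fun i _ => .sum fun k _ => .mul (.of_continuous hb ?_)
        (.pd_norm hb hA i))))) (boundedMeasurable_outwardNormal hΩo hΩb hΩs j)
  all_goals
    repeat' first
      | with_reducible exact h1 _
      | with_reducible exact h2 _
      | with_reducible exact h3 _ _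
      | with_reducible exact h4 _ _
      | with_reducible exact h5
      | with_reducible exact h6
      | with_reducible exact h7 _
      | with_reducible exact h8 _
      | with_reducible exact continuous_const
      | with_reducible_and_instances refine Continuous.add ?_ ?_
      | with_reducible_and_instances refine Continuous.sub ?_ ?_
      | with_reducible_and_instances refine Continuous.mul ?_ ?_
      | with_reducible_and_instances refine Continuous.neg ?_
      | with_reducible_and_instances refine Continuous.pow ?_ _
      | with_reducible_and_instances refine Continuous.div_const ?_ _
      | with_reducible_and_instances refine continuous_finsetSum _ fun _ _ => ?_

include hΩo hΩb hΩs hus hws hs in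
theorem IsStationary.pressure_identity (hstat : IsStationary ν τ Ω us ws x₀ s) (hτ : 0 < τ)
    {θ : ℝ → ℝ} (hθ : Continuous θ) {ψ : E3 → ℝ} (hψ : ContDiff ℝ 1 ψ) :
    (∫ t in (0 : ℝ)..τ, ∫ x in Ω, θ t * ∑ i, s.u t x i * pd ψ i x) +
      (∫ t in (0 : ℝ)..τ, ∫ x, θ t * (-(∑ j, us t x j * outwardNormal Ω x j) * ψ x)
        ∂(surfaceArea Ω)) = 0 := by
  have hfin := isFiniteMeasure_surfaceArea hΩo hΩb hΩs
  have hfin' : IsFiniteMeasure (volume.restrict Ω) := ⟨by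
    rw [Measure.restrict_apply_univ]; exact hΩb.measure_lt_top⟩
  have hd := hstat _ (isVariation_pressureVar τ Ω x₀ hθ hψ)
  refine HasDerivAt.unique (HasDerivAt.add ?_ ?_) hd
  · refine hasDerivAt_integral_quadratic hτ (f₀ := fun z => lagrangian ν s z.1 z.2)
      (f₁ := fun z => θ z.1 * ∑ i, s.u z.1 z.2 i * pd ψ i z.2) (f₂ := fun _ => 0)
      (integrable_prod_of_continuous hΩo.measurableSet hΩb (continuous_lagrangian ν hs))
      (integrable_prod_of_continuous hΩo.measurableSet hΩb ?_)
      (integrable_prod_of_continuous hΩo.measurableSet hΩb continuous_const)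
      fun ε t => ae_of_all _ fun x => ?_
    · exact (hθ.comp continuous_fst).mul (continuous_finsetSum _ fun i _ =>
        (hs.1.continuous_apply i).mul ((continuous_pd hψ i).comp continuous_snd))
    · rw [lagrangian_pressureVar ν hs θ hψ]; ring
  · have hb := isBounded_frontier hΩb
    have hfin2 := hfin
    rw [surfaceArea] at hfin2
    refine hasDerivAt_integral_quadratic hτ
      (f₀ := fun z => ∑ j, surfaceDensity ν us ws s j z.1 z.2 * outwardNormal Ω z.2 j)
      (f₁ := fun z => θ z.1 * (-(∑ j, us z.1 z.2 j * outwardNormal Ω z.2 j) * ψ z.2))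
      (f₂ := fun _ => 0)
      ((boundedMeasurable_surfaceDensity hΩo hΩb hΩs hus hws hs).integrable
        (frontier_measurableSet Ω)) ?_
      (integrable_prod_of_continuous (frontier_measurableSet Ω) hb continuous_const)
      fun ε t => ae_of_all _ fun x => ?_
    · have h7 := hus.continuous_apply
      have hθψ : Continuous (fun z : ℝ × E3 => θ z.1 * ψ z.2) :=
        (hθ.comp continuous_fst).mul (hψ.continuous.comp continuous_snd)
      have : (fun z : ℝ × E3 => θ z.1 * (-(∑ j, us z.1 z.2 j * outwardNormal Ω z.2 j) * ψ z.2)) =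
          fun z => ∑ j, (-(θ z.1 * ψ z.2 * us z.1 z.2 j)) * outwardNormal Ω z.2 j := by
        ext z
        simp only [Fin.sum_univ_three]
        ring
      rw [this]
      refine BoundedMeasurable.integrable (.sum fun j _ => .mul
        (.of_continuous hb (hθψ.mul (h7 j)).neg)
        (boundedMeasurable_outwardNormal hΩo hΩb hΩs j)) (frontier_measurableSet Ω)
    · simp only [surfaceDensity_pressureVar, Fin.sum_univ_three]
      ring

include hΩo hΩb hΩs hus hws hs in
-- The derivative of `I` in this direction is computed from the expansions and equated with `0` by
-- uniqueness of derivatives.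
theorem IsStationary.velocity_identity (hstat : IsStationary ν τ Ω us ws x₀ s) (hτ : 0 < τ)
    (hx₀ : x₀ ∈ frontier Ω) {θ : ℝ → ℝ} (hθ : ContDiff ℝ 1 θ) (h0 : θ 0 = 0) (h1 : θ τ = 0)
    {φ : E3 → ℝ} (hφ : ContDiff ℝ 2 φ) (hφ0 : ∀ x ∈ frontier Ω, φ x = 0)
    (hφn : ∀ x ∈ frontier Ω, ∃ c, ∀ j, pd φ j x = c * outwardNormal Ω x j) (i : Fin 3) :
    (∫ t in (0 : ℝ)..τ, ∫ x in Ω, lagrangianVelocityVar ν s θ φ i t x) +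
      (∫ t in (0 : ℝ)..τ, ∫ x, θ t * (ν * (-(s.u t x i - us t x i) *
        ∑ j, pd φ j x * outwardNormal Ω x j)) ∂(surfaceArea Ω)) = 0 := by
  have hfin := isFiniteMeasure_surfaceArea hΩo hΩb hΩs
  have hfin' : IsFiniteMeasure (volume.restrict Ω) := ⟨by
    rw [Measure.restrict_apply_univ]; exact hΩb.measure_lt_top⟩
  have hd := hstat _ (isVariation_velocityVar hx₀ hθ h0 h1 hφ hφ0 i)
  refine HasDerivAt.unique (HasDerivAt.add ?_ ?_) hd
  · exact hasDerivAt_integral_quadratic hτ (f₀ := fun z => lagrangian ν s z.1 z.2)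
      (f₁ := fun z => lagrangianVelocityVar ν s θ φ i z.1 z.2)
      (f₂ := fun z => lagrangianVelocityVarSnd ν s θ φ i z.1 z.2)
      (integrable_prod_of_continuous hΩo.measurableSet hΩb (continuous_lagrangian ν hs))
      (integrable_prod_of_continuous hΩo.measurableSet hΩb
        (continuous_lagrangianVelocityVar ν hs hθ hφ i))
      (integrable_prod_of_continuous hΩo.measurableSet hΩb
        (continuous_lagrangianVelocityVarSnd ν hs hθ hφ i))
      fun ε t => ae_of_all _ fun x => lagrangian_velocityVar hs hθ hφ i ε t x ν
  · have hb := isBounded_frontier hΩb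
    have hfin2 := hfin
    rw [surfaceArea] at hfin2
    refine hasDerivAt_integral_quadratic hτ
      (f₀ := fun z => ∑ j, surfaceDensity ν us ws s j z.1 z.2 * outwardNormal Ω z.2 j)
      (f₁ := fun z => θ z.1 * (ν * (-(s.u z.1 z.2 i - us z.1 z.2 i) *
        ∑ j, pd φ j z.2 * outwardNormal Ω z.2 j)))
      (f₂ := fun _ => 0)
      ((boundedMeasurable_surfaceDensity hΩo hΩb hΩs hus hws hs).integrable
        (frontier_measurableSet Ω)) ?_
      (integrable_prod_of_continuous (frontier_measurableSet Ω) hb continuous_const)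
      fun ε t => (ae_restrict_mem (frontier_measurableSet Ω)).mono fun x hx => ?_
    · have h7 := hus.continuous_apply
      have h8 := hs.1.continuous_apply
      exact BoundedMeasurable.integrable (.mul
        (.of_continuous hb (hθ.continuous.comp continuous_fst))
        (.mul (.of_continuous hb continuous_const) (.mul
          (.of_continuous hb ((h8 i).sub (h7 i)).neg)
          (.sum fun j _ => .mul (.of_continuous hb
            ((continuous_pd (hφ.of_le (by norm_num)) j).comp continuous_snd))
            (boundedMeasurable_outwardNormal hΩo hΩb hΩs j))))) (frontier_measurableSet Ω)
    · obtain ⟨c, hc⟩ := hφn x hx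
      rw [surfaceDensity_velocityVar hs hφ i ε t x ν hus hws (hφ0 x hx) hc, mul_zero, add_zero]

end Stationary

/-! ### Localization -/

theorem eq_zero_on_closure_of_integral_eq_zero {E : Type*} [NormedAddCommGroup E]
    [NormedSpace ℝ E] [FiniteDimensional ℝ E] [MeasurableSpace E] [BorelSpace E] {μ : Measure E}
    [IsLocallyFiniteMeasure μ] [μ.IsOpenPosMeasure] {U : Set E} (hU : IsOpen U) {f : E → ℝ}
    (hf : Continuous f)
    (h : ∀ g : E → ℝ, ContDiff ℝ ((⊤ : ℕ∞) : WithTop ℕ∞) g → HasCompactSupport g →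
      tsupport g ⊆ U → ∫ x in U, g x * f x ∂μ = 0) :
    ∀ x ∈ closure U, f x = 0 := by
  have h1 : ∀ᵐ x ∂μ, x ∈ U → f x = 0 := by
    refine hU.ae_eq_zero_of_integral_contDiff_smul_eq_zero
      (hf.locallyIntegrable.locallyIntegrableOn U) fun g hg hgc hgs => ?_
    rw [← h g hg hgc hgs]
    refine (setIntegral_eq_integral_of_forall_compl_eq_zero fun x hx => ?_).symm
    rw [image_eq_zero_of_notMem_tsupport fun hx' => hx (hgs hx'), zero_smul]
  have h2 : EqOn f 0 U := by
    refine Measure.eqOn_open_of_ae_eq (μ := μ) ?_ hU hf.continuousOn continuousOn_const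
    exact (ae_restrict_iff' hU.measurableSet).2 h1
  exact h2.closure hf continuous_const

/-- Test functions supported in the open interval already vanish at both ends, so the conditions on
`θ` cost nothing; continuity of `G` recovers the endpoints. -/
theorem eq_zero_on_Icc_of_integral_eq_zero {τ : ℝ} (hτ : 0 < τ) {G : ℝ → ℝ} (hG : Continuous G)
    (h : ∀ θ : ℝ → ℝ, ContDiff ℝ 1 θ → θ 0 = 0 → θ τ = 0 →
      ∫ t in (0 : ℝ)..τ, θ t * G t = 0) :
    ∀ t ∈ Icc 0 τ, G t = 0 := by
  rw [← closure_Ioo hτ.ne]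
  refine eq_zero_on_closure_of_integral_eq_zero (μ := volume) isOpen_Ioo hG fun g hg _ hgs => ?_
  have h0 : ∀ t, t ∉ Ioo 0 τ → g t = 0 := fun t ht =>
    image_eq_zero_of_notMem_tsupport fun ht' => ht (hgs ht')
  rw [← integral_Ioc_eq_integral_Ioo, ← intervalIntegral.integral_of_le hτ.le]
  exact h g (hg.of_le (by norm_cast)) (h0 0 (by simp)) (h0 τ (by simp))

/-- Supplies the continuity in `t` needed to strip off `θ`. The weight `m` will be a component of
the normal, controlled only on `∂Ω`. -/
theorem continuous_integral_mul {μ : Measure E3} {K : Set E3} (hK : MeasurableSet K)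
    (hb : Bornology.IsBounded K) [IsFiniteMeasure (μ.restrict K)] {f : ℝ × E3 → ℝ}
    (hf : Continuous f) {m : E3 → ℝ} (hm : AEStronglyMeasurable m (μ.restrict K)) {C : ℝ}
    (hC : ∀ x ∈ K, |m x| ≤ C) : Continuous (fun t => ∫ x in K, f (t, x) * m x ∂μ) := by
  rw [continuous_iff_continuousAt]
  intro t₀
  have hc : IsCompact (Icc (t₀ - 1) (t₀ + 1) ×ˢ closure K) := isCompact_Icc.prod hb.isCompact_closure
  obtain ⟨D, hD⟩ := hc.exists_bound_of_continuousOn hf.continuousOn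
  have hnhds : ∀ᶠ t in 𝓝 t₀, t ∈ Icc (t₀ - 1) (t₀ + 1) :=
    Icc_mem_nhds (by linarith) (by linarith)
  refine continuousAt_of_dominated (bound := fun _ => D * C) ?_ ?_ (integrable_const _) ?_
  · exact Eventually.of_forall fun t =>
      ((hf.comp (Continuous.prodMk_right t)).aestronglyMeasurable).mul hm
  · filter_upwards [hnhds] with t ht
    refine (ae_restrict_mem hK).mono fun x hx => ?_
    rw [norm_mul]
    have h1 := hD (t, x) ⟨ht, subset_closure hx⟩
    exact mul_le_mul h1 (hC x hx) (norm_nonneg _) ((norm_nonneg _).trans h1)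
  · exact ae_of_all _ fun x =>
      ((hf.comp (Continuous.prodMk_left x)).mul continuous_const).continuousAt

theorem continuous_setIntegral {μ : Measure E3} {K : Set E3} (hK : MeasurableSet K)
    (hb : Bornology.IsBounded K) [IsFiniteMeasure (μ.restrict K)] {f : ℝ × E3 → ℝ}
    (hf : Continuous f) : Continuous (fun t => ∫ x in K, f (t, x) ∂μ) := by
  simpa using continuous_integral_mul (μ := μ) hK hb hf (m := fun _ => 1)
    aestronglyMeasurable_const (C := 1) (by simp)

/-- A function on the boundary vanishes at `x` if it is small on average near `x`. -/
theorem eq_zero_of_boundary_test {Ω : Set E3} (hΩo : IsOpen Ω) (hΩb : Bornology.IsBounded Ω)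
    (hΩs : HasSmoothBoundary Ω) {x : E3} (hx : x ∈ frontier Ω) {h : E3 → ℝ}
    (hh : ContinuousOn h (frontier Ω)) {M : ℝ}
    (H : ∀ η : ℝ, 0 < η → η ≤ 1 → ∃ U ∈ 𝓝 x, ∀ ψ : E3 → ℝ,
      ContDiff ℝ ((⊤ : ℕ∞) : WithTop ℕ∞) ψ → HasCompactSupport ψ → tsupport ψ ⊆ U →
      (∀ y, 0 ≤ ψ y) →
      |∫ y, h y * ψ y ∂(surfaceArea Ω)| ≤ η * M * ∫ y, ψ y ∂(surfaceArea Ω)) : h x = 0 := by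
  have hfin := isFiniteMeasure_surfaceArea hΩo hΩb hΩs
  by_contra hne
  set c := |h x| / 2 with hc
  have c0 : 0 < c := by have := abs_pos.2 hne; positivity
  have hM0 : 0 < |M| + 1 := by positivity
  -- Gives `η M ≤ c/2`. With `|h x| = 2c` and oscillation of `h` below `c` on the support, testing
  -- with a bump of positive integral `I` would give `2c I ≤ c I + (c/2) I`.
  set η := min 1 (c / (2 * (|M| + 1))) with hη
  have η0 : 0 < η := lt_min one_pos (by positivity)
  obtain ⟨U, hU, hUψ⟩ := H η η0 (min_le_left _ _)
  have hW : ∀ᶠ y in 𝓝 x, y ∈ frontier Ω → |h y - h x| < c := by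
    have := (hh x hx).eventually (Metric.ball_mem_nhds (h x) c0)
    rw [eventually_nhdsWithin_iff] at this
    simpa [Real.dist_eq] using this
  obtain ⟨r, r0, hr⟩ := Metric.nhds_basis_closedBall.mem_iff.1 (inter_mem hU hW)
  let b : ContDiffBump x := ⟨r / 2, r, by positivity, by linarith⟩
  have hbs : tsupport b = Metric.closedBall x r := b.tsupport_eq
  have hψ := hUψ b b.contDiff b.hasCompactSupport
    (by rw [hbs]; exact hr.trans inter_subset_left) (fun y => b.nonneg)
  have hbi : Integrable (fun y => b y) (surfaceArea Ω) :=
    Integrable.of_bound b.continuous.aestronglyMeasurable 1 (ae_of_all _ fun y => by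
      rw [Real.norm_eq_abs, abs_of_nonneg b.nonneg]; exact b.le_one)
  have hpos : 0 < ∫ y, b y ∂(surfaceArea Ω) := by
    rw [integral_pos_iff_support_of_nonneg (fun y => b.nonneg) hbi, b.support_eq]
    exact surfaceArea_pos hΩo hΩs hx (Metric.ball_mem_nhds x r0)
  set I := ∫ y, b y ∂(surfaceArea Ω) with hI
  have hae : ∀ᵐ y ∂(surfaceArea Ω), |h y * b y - h x * b y| ≤ c * b y := by
    rw [surfaceArea]
    refine (ae_restrict_mem (frontier_measurableSet Ω)).mono fun y hy => ?_
    rw [← sub_mul, abs_mul, abs_of_nonneg b.nonneg]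
    by_cases hyb : y ∈ Metric.closedBall x r
    · exact mul_le_mul_of_nonneg_right ((hr hyb).2 hy).le b.nonneg
    · have : b y = 0 := image_eq_zero_of_notMem_tsupport (by rwa [hbs])
      simp [this]
  have hhm : AEStronglyMeasurable h (surfaceArea Ω) :=
    hh.aestronglyMeasurable (frontier_measurableSet Ω)
  have hdi : Integrable (fun y => h y * b y - h x * b y) (surfaceArea Ω) := by
    refine Integrable.mono' (hbi.const_mul c) ?_ hae
    exact (hhm.mul b.continuous.aestronglyMeasurable).sub
      (continuous_const.mul b.continuous).aestronglyMeasurable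
  have hhi : Integrable (fun y => h y * b y) (surfaceArea Ω) := by
    exact (hdi.add (hbi.const_mul (h x))).congr (ae_of_all _ fun y => by simp)
  have h1 : |(∫ y, h y * b y ∂(surfaceArea Ω)) - h x * I| ≤ c * I := by
    rw [hI, ← integral_const_mul, ← integral_sub hhi (hbi.const_mul _), ← integral_const_mul]
    exact (abs_integral_le_integral_abs).trans
      (integral_mono_ae hdi.abs (hbi.const_mul c) hae)
  have h2 : |h x| * I ≤ c * I + η * M * I := by
    rw [← abs_of_pos hpos, ← abs_mul, abs_of_pos hpos]
    have := abs_sub_abs_le_abs_sub (h x * I) (∫ y, h y * b y ∂(surfaceArea Ω))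
    rw [abs_sub_comm] at this
    linarith
  have h3 : η * M ≤ c / 2 := by
    calc η * M ≤ η * (|M| + 1) := by gcongr; linarith [le_abs_self M]
      _ ≤ c / (2 * (|M| + 1)) * (|M| + 1) := by gcongr; exact min_le_right _ _
      _ = c / 2 := by field_simp
  have h4 : |h x| = 2 * c := by rw [hc]; ring
  rw [h4] at h2
  nlinarith

/-! ### Incompressibility and the normal boundary condition -/

section Conclusions

variable {ν τ : ℝ} {Ω : Set E3} (hΩo : IsOpen Ω) (hΩb : Bornology.IsBounded Ω)
  (hΩs : HasSmoothBoundary Ω) {us ws : ℝ → E3 → E3} (hus : SpaceC1 us) (hws : SpaceC1 ws)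
  {x₀ : E3} {s : Fields} (hs : s.Regular)

theorem isFiniteMeasure_restrict {Ω : Set E3} (hΩb : Bornology.IsBounded Ω) :
    IsFiniteMeasure ((volume : Measure E3).restrict Ω) :=
  ⟨by rw [Measure.restrict_apply_univ]; exact hΩb.measure_lt_top⟩

theorem integrableOn_of_continuous {Ω : Set E3} (hΩb : Bornology.IsBounded Ω) {f : E3 → ℝ}
    (hf : Continuous f) : IntegrableOn f Ω :=
  (hf.continuousOn.integrableOn_compact hΩb.isCompact_closure).mono_set subset_closure

include hΩo hΩb hΩs in
theorem continuous_surface_integral {f : Fin 3 → ℝ × E3 → ℝ} (hf : ∀ j, Continuous (f j)) :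
    Continuous (fun t => ∫ x, (∑ j, f j (t, x) * outwardNormal Ω x j) ∂(surfaceArea Ω)) := by
  have hfin := isFiniteMeasure_surfaceArea hΩo hΩb hΩs
  have hfin2 := hfin
  rw [surfaceArea] at hfin2
  have hb := isBounded_frontier hΩb
  have hn := continuousOn_outwardNormal_apply hΩo hΩs
  choose C hC using fun j => (isCompact_frontier hΩb).exists_bound_of_continuousOn (hn j)
  have hm : ∀ j, AEStronglyMeasurable (fun x => outwardNormal Ω x j) (surfaceArea Ω) := fun j =>
    (hn j).aestronglyMeasurable (frontier_measurableSet Ω)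
  have hi : ∀ t j, Integrable (fun x => f j (t, x) * outwardNormal Ω x j) (surfaceArea Ω) := by
    intro t j
    have hc : ContinuousOn (fun x => f j (t, x) * outwardNormal Ω x j) (frontier Ω) :=
      ((hf j).comp (Continuous.prodMk_right t)).continuousOn.mul (hn j)
    obtain ⟨D, hD⟩ := (isCompact_frontier hΩb).exists_bound_of_continuousOn hc
    refine Integrable.of_bound (hc.aestronglyMeasurable (frontier_measurableSet Ω)) D ?_
    exact (ae_restrict_mem (frontier_measurableSet Ω)).mono fun x hx => hD x hx
  have : (fun t => ∫ x, (∑ j, f j (t, x) * outwardNormal Ω x j) ∂(surfaceArea Ω)) =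
      fun t => ∑ j, ∫ x, f j (t, x) * outwardNormal Ω x j ∂(surfaceArea Ω) :=
    funext fun t => integral_finsetSum _ fun j _ => hi t j
  rw [this]
  exact continuous_finsetSum _ fun j _ =>
    continuous_integral_mul (frontier_measurableSet Ω) hb (hf j) (hm j) (hC j)

include hΩo hΩb hΩs hus hws hs in
-- Both sides are continuous in `t` and `θ` is arbitrary, so the time-integrated identity holds at
-- each time.
theorem IsStationary.pressure_weak (hstat : IsStationary ν τ Ω us ws x₀ s) (hτ : 0 < τ)
    {ψ : E3 → ℝ} (hψ : ContDiff ℝ 1 ψ) : ∀ t ∈ Icc 0 τ,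
    (∫ x in Ω, ∑ i, s.u t x i * pd ψ i x) =
      ∫ x, (∑ j, us t x j * outwardNormal Ω x j) * ψ x ∂(surfaceArea Ω) := by
  have hfin' := isFiniteMeasure_restrict hΩb
  have h1 := hs.1.continuous_apply
  have h2 := hus.continuous_apply
  have c1 : Continuous (fun t => ∫ x in Ω, ∑ i, s.u t x i * pd ψ i x) :=
    continuous_setIntegral hΩo.measurableSet hΩb (f := fun z => ∑ i, s.u z.1 z.2 i * pd ψ i z.2)
      (continuous_finsetSum _ fun i _ => (h1 i).mul ((continuous_pd hψ i).comp continuous_snd))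
  have e2 : ∀ t, ∫ x, (∑ j, us t x j * outwardNormal Ω x j) * ψ x ∂(surfaceArea Ω) =
      ∫ x, (∑ j, (us t x j * ψ x) * outwardNormal Ω x j) ∂(surfaceArea Ω) := by
    intro t
    congr 1
    ext x
    rw [Finset.sum_mul]
    exact Finset.sum_congr rfl fun j _ => by ring
  have c2 : Continuous (fun t => ∫ x, (∑ j, us t x j * outwardNormal Ω x j) * ψ x
      ∂(surfaceArea Ω)) := by
    simp only [e2]
    exact continuous_surface_integral hΩo hΩb hΩs (f := fun j z => us z.1 z.2 j * ψ z.2)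
      fun j => (h2 j).mul (hψ.continuous.comp continuous_snd)
  have key := eq_zero_on_Icc_of_integral_eq_zero hτ (c1.sub c2) fun θ hθ _ _ => ?_
  · exact fun t ht => sub_eq_zero.1 (key t ht)
  · have hid := hstat.pressure_identity hΩo hΩb hΩs hus hws hs hτ hθ.continuous hψ
    simp only [integral_const_mul, neg_mul, integral_neg] at hid
    refine Eq.trans ?_ ((intervalIntegral.integral_add
      ((hθ.continuous.mul c1).intervalIntegrable _ _)
      ((hθ.continuous.mul c2.neg).intervalIntegrable _ _)).trans hid)
    congr 1
    ext t
    simp only [Pi.sub_apply, Pi.mul_apply, Pi.neg_apply]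
    ring

include hΩo hΩb hΩs hus hws hs in
-- For `ψ` supported in `Ω` the surface term disappears and integration by parts leaves `∫ ψ div u =
-- 0`.
theorem IsStationary.div_u (hstat : IsStationary ν τ Ω us ws x₀ s) (hτ : 0 < τ) :
    ∀ t ∈ Icc 0 τ, ∀ x ∈ closure Ω, ∑ i, dx s.u i i t x = 0 := by
  intro t ht
  have hc : Continuous (fun x => ∑ i, dx s.u i i t x) :=
    continuous_finsetSum _ fun i _ => (hs.1.contDiff_dx i i t).continuous
  refine eq_zero_on_closure_of_integral_eq_zero (μ := volume) hΩo hc fun ψ hψ hψc hψs => ?_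
  have hψ1 : ContDiff ℝ 1 ψ := hψ.of_le (by norm_cast)
  have h1 := hstat.pressure_weak hΩo hΩb hΩs hus hws hs hτ hψ1 t ht
  have h2 : ∫ x, (∑ j, us t x j * outwardNormal Ω x j) * ψ x ∂(surfaceArea Ω) = 0 := by
    refine integral_eq_zero_of_ae ?_
    rw [surfaceArea]
    refine (ae_restrict_mem (frontier_measurableSet Ω)).mono fun x hx => ?_
    have : ψ x = 0 := image_eq_zero_of_notMem_tsupport fun hx' => by
      rw [hΩo.frontier_eq] at hx
      exact hx.2 (hψs hx')
    simp [this]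
  have hU : ∀ i, ContDiff ℝ 1 (fun x => s.u t x i) := fun i =>
    (hs.1.contDiff_apply t i).of_le (by norm_num)
  have h3 : ∀ i, ∫ x in Ω, pd (fun y => s.u t y i * ψ y) i x = 0 := fun i =>
    integral_pd_eq_zero_of_tsupport_subset ((hU i).mul hψ1) hψc.mul_left
      ((tsupport_mul_subset_right).trans hψs) i
  have h4 : ∀ i, IntegrableOn (pd (fun y => s.u t y i * ψ y) i) Ω := fun i =>
    integrableOn_of_continuous hΩb (continuous_pd ((hU i).mul hψ1) i)
  have h5 : ∫ x in Ω, ∑ i, pd (fun y => s.u t y i * ψ y) i x = 0 := by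
    rw [integral_finsetSum _ fun i _ => h4 i]
    exact Finset.sum_eq_zero fun i _ => h3 i
  have h6 : ∀ x, ∑ i, pd (fun y => s.u t y i * ψ y) i x =
      ∑ i, s.u t x i * pd ψ i x + ψ x * ∑ i, dx s.u i i t x := by
    intro x
    rw [Finset.mul_sum, ← Finset.sum_add_distrib]
    refine Finset.sum_congr rfl fun i _ => ?_
    rw [pd_mul (hs.1.differentiable_apply t i x) (hψ1.differentiable (by simp) x), dx]
    ring
  have h7 : ∫ x in Ω, (∑ i, s.u t x i * pd ψ i x + ψ x * ∑ i, dx s.u i i t x) =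
      (∫ x in Ω, ∑ i, s.u t x i * pd ψ i x) + ∫ x in Ω, ψ x * ∑ i, dx s.u i i t x :=
    integral_add (integrableOn_of_continuous hΩb (continuous_finsetSum _ fun i _ =>
      (hU i).continuous.mul (continuous_pd hψ1 i))) (integrableOn_of_continuous hΩb
      (hψ1.continuous.mul hc))
  simp only [h6] at h5
  rwa [h7, h1, h2, zero_add] at h5

include hΩo hΩb hΩs hus hws hs in
theorem IsStationary.normal_u (hstat : IsStationary ν τ Ω us ws x₀ s) (hτ : 0 < τ) :
    ∀ t ∈ Icc 0 τ, ∀ x ∈ frontier Ω, ∑ i, outwardNormal Ω x i * (s.u t x i - us t x i) = 0 := by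
  intro t ht x hx
  have hfin := isFiniteMeasure_surfaceArea hΩo hΩb hΩs
  have hdiv := hstat.div_u hΩo hΩb hΩs hus hws hs hτ t ht
  have hU : ∀ i, ContDiff ℝ 1 (fun x => s.u t x i) := fun i =>
    (hs.1.contDiff_apply t i).of_le (by norm_num)
  have hus' : ∀ i, Continuous (fun x => us t x i) := fun i =>
    (hus.continuous_apply i).comp (Continuous.prodMk_right t)
  have hn := continuousOn_outwardNormal_apply hΩo hΩs
  set n := outwardNormal Ω x with hnx
  -- The normal multiplying `u` is frozen at `x`, as the approximate divergence theorem yields it;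
  -- the one multiplying `u^s` varies. At `y = x` they coincide.
  let h : E3 → ℝ := fun y => (∑ i, n i * s.u t y i) - ∑ j, us t y j * outwardNormal Ω y j
  have hh : ContinuousOn h (frontier Ω) :=
    (continuous_finsetSum _ fun i _ => continuous_const.mul (hU i).continuous).continuousOn.sub
      (continuousOn_finsetSum _ fun j _ => (hus' j).continuousOn.mul (hn j))
  set M := ‖s.u t x‖ + 1 with hM
  have hMu : ∀ᶠ y in 𝓝 x, ‖s.u t y‖ < M :=
    (hs.1.2.1 t).continuous.norm.continuousAt.eventually (gt_mem_nhds (by linarith))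
  have key : h x = 0 := by
    -- Each of the three components `u_i ψ` contributes an error of at most `η M ∫ ψ`.
    refine eq_zero_of_boundary_test hΩo hΩb hΩs hx hh (M := 3 * M) fun η η0 η1 => ?_
    obtain ⟨U, hU', hUF⟩ := exists_nhds_divergence hΩo hΩs hx η0 η1
    refine ⟨U ∩ {y | ‖s.u t y‖ < M}, inter_mem hU' hMu, fun ψ hψ hψc hψs hψ0 => ?_⟩
    have hψ1 : ContDiff ℝ 1 ψ := hψ.of_le (by norm_cast)
    have hweak := hstat.pressure_weak hΩo hΩb hΩs hus hws hs hτ hψ1 t ht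
    have hF := fun i => hUF (fun y => s.u t y i * ψ y) ((hU i).mul hψ1) hψc.mul_left
      ((tsupport_mul_subset_right).trans (hψs.trans inter_subset_left)) i
    have hsurf : ∀ f : E3 → ℝ, ContinuousOn f (frontier Ω) → Integrable f (surfaceArea Ω) := by
      intro f hf
      obtain ⟨D, hD⟩ := (isCompact_frontier hΩb).exists_bound_of_continuousOn hf
      refine Integrable.of_bound (hf.aestronglyMeasurable (frontier_measurableSet Ω)) D ?_
      exact (ae_restrict_mem (frontier_measurableSet Ω)).mono fun x hx => hD x hx
    have hbound : ∀ i, ∫ y, |s.u t y i * ψ y| ∂(surfaceArea Ω) ≤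
        M * ∫ y, ψ y ∂(surfaceArea Ω) := by
      intro i
      rw [← integral_const_mul]
      refine integral_mono (hsurf _ ((hU i).continuous.mul hψ.continuous).abs.continuousOn)
        (hsurf _ (continuous_const.mul hψ.continuous).continuousOn) fun y => ?_
      rw [abs_mul, abs_of_nonneg (hψ0 y)]
      by_cases hy : y ∈ tsupport ψ
      · refine mul_le_mul_of_nonneg_right ?_ (hψ0 y)
        exact (PiLp.norm_apply_le (s.u t y) i).trans (hψs hy).2.le
      · simp [image_eq_zero_of_notMem_tsupport hy]
    have hvol : ∫ y in Ω, ∑ i, s.u t y i * pd ψ i y =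
        ∑ i, ∫ y in Ω, pd (fun y => s.u t y i * ψ y) i y := by
      rw [← integral_finsetSum _ fun i _ => integrableOn_of_continuous hΩb
        (continuous_pd ((hU i).mul hψ1) i)]
      refine setIntegral_congr_fun hΩo.measurableSet fun y hy => ?_
      have h6 : ∑ i, pd (fun y => s.u t y i * ψ y) i y =
          ∑ i, s.u t y i * pd ψ i y + ψ y * ∑ i, dx s.u i i t y := by
        rw [Finset.mul_sum, ← Finset.sum_add_distrib]
        refine Finset.sum_congr rfl fun i _ => ?_
        rw [pd_mul (hs.1.differentiable_apply t i y) (hψ1.differentiable (by simp) y), dx]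
        ring
      beta_reduce
      rw [h6, hdiv y (subset_closure hy), mul_zero, add_zero]
    have hI : ∫ y, h y * ψ y ∂(surfaceArea Ω) =
        ∑ i, (n i * ∫ y, s.u t y i * ψ y ∂(surfaceArea Ω)
          - ∫ y in Ω, pd (fun y => s.u t y i * ψ y) i y) := by
      rw [Finset.sum_sub_distrib, ← hvol, hweak]
      simp only [← integral_const_mul]
      have j1 : ∀ i, Integrable (fun y => n i * (s.u t y i * ψ y)) (surfaceArea Ω) := fun i =>
        hsurf _ (continuous_const.mul ((hU i).continuous.mul hψ.continuous)).continuousOn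
      have j2 : Integrable (fun y => (∑ j, us t y j * outwardNormal Ω y j) * ψ y)
          (surfaceArea Ω) :=
        hsurf _ ((continuousOn_finsetSum _ fun j _ => (hus' j).continuousOn.mul (hn j)).mul
          hψ.continuous.continuousOn)
      rw [← integral_finsetSum _ fun i _ => j1 i, ← integral_sub (integrable_finsetSum _
        fun i _ => j1 i) j2]
      congr 1
      ext y
      simp only [h, sub_mul, Finset.sum_mul, mul_assoc]
    rw [hI]
    calc _ ≤ ∑ i, |n i * ∫ y, s.u t y i * ψ y ∂(surfaceArea Ω)
          - ∫ y in Ω, pd (fun y => s.u t y i * ψ y) i y| := Finset.abs_sum_le_sum_abs _ _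
      _ ≤ ∑ _i : Fin 3, η * (M * ∫ y, ψ y ∂(surfaceArea Ω)) := by
          refine Finset.sum_le_sum fun i _ => ?_
          rw [abs_sub_comm]
          exact (hF i).trans (mul_le_mul_of_nonneg_left (hbound i) η0.le)
      _ = _ := by simp; ring
  simp only [h] at key
  rw [← key, ← Finset.sum_sub_distrib]
  refine Finset.sum_congr rfl fun i _ => by rw [← hnx]; ring

end Conclusions

/-- The residual of the Euler-Lagrange equation belonging to `δu_i`. -/
noncomputable def momentumResidual (ν : ℝ) (s : Fields) (i : Fin 3) (t : ℝ) (x : E3) : ℝ :=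
  -ν * lap s.u i t x + pd (s.p t) i x + dt s.w i t x +
    ∑ j, (s.u t x j + s.w t x j) / 2 * (dx s.w i j t x + dx s.w j i t x)

theorem continuous_momentumResidual (ν : ℝ) {s : Fields} (hs : s.Regular) (i : Fin 3) :
    Continuous (fun z : ℝ × E3 => momentumResidual ν s i z.1 z.2) :=
  (((continuous_const.mul (hs.1.continuous_lap i)).add (hs.2.2.1.continuous_pd i)).add
    (hs.2.1.continuous_dt i)).add (continuous_finsetSum _ fun j _ =>
      (((hs.1.continuous_apply j).add (hs.2.1.continuous_apply j)).div_const 2).mul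
        ((hs.2.1.continuous_dx i j).add (hs.2.1.continuous_dx j i)))

theorem continuous_momentumResidual_apply (ν : ℝ) {s : Fields} (hs : s.Regular) (i : Fin 3)
    (t : ℝ) : Continuous (fun x => momentumResidual ν s i t x) := by
  have h := (continuous_momentumResidual ν hs i).comp (Continuous.prodMk_right t)
  simpa only [Function.comp_def] using h

/-- Test functions that vanish on the boundary and for which the divergence theorem holds. -/
structure IsBoundaryTest (Ω : Set E3) (φ : E3 → ℝ) : Prop where
  contDiff : ContDiff ℝ 2 φ
  eq_zero : ∀ x ∈ frontier Ω, φ x = 0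
  normal : ∀ x ∈ frontier Ω, ∃ c, ∀ j, pd φ j x = c * outwardNormal Ω x j
  integral_pd : ∀ F : E3 → ℝ, ContDiff ℝ 1 F → ∀ j, ∫ x in Ω, pd (fun y => F y * φ y) j x = 0

theorem isBoundaryTest_of_tsupport_subset {Ω : Set E3} (hΩo : IsOpen Ω) {φ : E3 → ℝ}
    (hφ : ContDiff ℝ 2 φ) (hφc : HasCompactSupport φ) (hφs : tsupport φ ⊆ Ω) :
    IsBoundaryTest Ω φ := by
  have hnot : ∀ x ∈ frontier Ω, x ∉ tsupport φ := fun x hx hx' => by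
    rw [hΩo.frontier_eq] at hx
    exact hx.2 (hφs hx')
  refine ⟨hφ, fun x hx => image_eq_zero_of_notMem_tsupport (hnot x hx), fun x hx => ⟨0, fun j => ?_⟩,
    fun F hF j => integral_pd_eq_zero_of_tsupport_subset (hF.mul (hφ.of_le (by norm_num)))
      hφc.mul_left ((tsupport_mul_subset_right).trans hφs) j⟩
  have : fderiv ℝ φ x = 0 :=
    image_eq_zero_of_notMem_tsupport fun h => hnot x hx (tsupport_fderiv_subset ℝ h)
  simp [pd, this]

/-- On `∂Ω`, where `ρ = 0`, the product rule leaves only `ψ ∇ρ`, which is normal. Outside the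
support of `ψ` both sides vanish, so `ρ` need be a defining function only on `U`. -/
theorem pd_defining_mul {Ω : Set E3} (hΩo : IsOpen Ω) {U : Set E3} {ρ : E3 → ℝ}
    (hρ : ContDiff ℝ ((⊤ : ℕ∞) : WithTop ℕ∞) ρ) (hρU : ∀ y ∈ U, IsDefiningFunctionAt Ω y ρ)
    {ψ : E3 → ℝ} (hψ : ContDiff ℝ ((⊤ : ℕ∞) : WithTop ℕ∞) ψ) (hψs : tsupport ψ ⊆ U)
    {x : E3} (hx : x ∈ frontier Ω) (j : Fin 3) :
    pd (fun y => ρ y * ψ y) j x = (ψ x * ‖gradient ρ x‖) * outwardNormal Ω x j := by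
  rw [pd_mul (hρ.differentiable (by simp) x) (hψ.differentiable (by simp) x)]
  by_cases hxs : x ∈ tsupport ψ
  · have h := hρU x (hψs hxs)
    have h1 : pd ρ j x = gradient ρ x j := by
      rw [pd, ← inner_gradient, EuclideanSpace.inner_single_right]
      simp
    rw [h.eq_zero hΩo hx, h1, h.gradient_eq hΩo hx]
    simp only [PiLp.smul_apply, smul_eq_mul, norm_smul, h.norm_outwardNormal hΩo hx]
    simp
    ring
  · have h1 : fderiv ℝ ψ x = 0 :=
      image_eq_zero_of_notMem_tsupport fun h => hxs (tsupport_fderiv_subset ℝ h)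
    rw [image_eq_zero_of_notMem_tsupport hxs]
    simp [pd, h1]

theorem exists_isBoundaryTest {Ω : Set E3} (hΩo : IsOpen Ω) (hΩs : HasSmoothBoundary Ω) {x : E3}
    (hx : x ∈ frontier Ω) {ρ : E3 → ℝ} (h : IsDefiningFunctionAt Ω x ρ) :
    ∃ U ∈ 𝓝 x, (∀ y ∈ U, IsDefiningFunctionAt Ω y ρ) ∧
      ∀ ψ : E3 → ℝ, ContDiff ℝ ((⊤ : ℕ∞) : WithTop ℕ∞) ψ → HasCompactSupport ψ →
        tsupport ψ ⊆ U → IsBoundaryTest Ω (fun y => ρ y * ψ y) := by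
  obtain ⟨V, hV, hVF⟩ := exists_nhds_integral_pd_eq_zero hΩo hΩs hx
  refine ⟨V ∩ {y | IsDefiningFunctionAt Ω y ρ}, inter_mem hV h.eventually, fun y hy => hy.2,
    fun ψ hψ hψc hψs => ?_⟩
  have hc : ContDiff ℝ ((⊤ : ℕ∞) : WithTop ℕ∞) (fun y => ρ y * ψ y) := h.1.mul hψ
  have h0 : ∀ y ∈ frontier Ω, ρ y * ψ y = 0 := by
    intro y hy
    by_cases hys : y ∈ tsupport ψ
    · rw [(hψs hys).2.eq_zero hΩo hy, zero_mul]
    · rw [image_eq_zero_of_notMem_tsupport hys, mul_zero]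
  refine ⟨hc.of_le (by norm_cast), h0, fun y hy => ⟨_, fun j =>
    pd_defining_mul hΩo h.1 (fun y hy => hy.2) hψ hψs hy j⟩, fun F hF j => ?_⟩
  refine hVF _ (hF.mul (hc.of_le (by norm_cast))) (hψc.mul_left.mul_left) ?_ (fun y hy => ?_) j
  · exact (tsupport_mul_subset_right.trans tsupport_mul_subset_right).trans
      (hψs.trans inter_subset_left)
  · rw [h0 y hy, mul_zero]

/-! ### Momentum equations and the viscous boundary condition -/

section Velocity

variable {ν τ : ℝ} {Ω : Set E3} (hΩo : IsOpen Ω) (hΩb : Bornology.IsBounded Ω)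
  (hΩs : HasSmoothBoundary Ω) {us ws : ℝ → E3 → E3} (hus : SpaceC1 us) (hws : SpaceC1 ws)
  {x₀ : E3} {s : Fields} (hs : s.Regular)

include hΩo hΩb hs in
-- The integrand is `∂_t(θ w_i) φ`. Adding half of it to the first variation converts `½ θ ∂_t w_i -
-- ½ θ' w_i` into `θ ∂_t w_i`, which is integration by parts in time.
theorem integral_deriv_mul_eq_zero (hτ : 0 < τ) {θ : ℝ → ℝ} (hθ : ContDiff ℝ 1 θ) (h0 : θ 0 = 0)
    (h1 : θ τ = 0) {φ : E3 → ℝ} (hφ : Continuous φ) (i : Fin 3) :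
    ∫ t in (0 : ℝ)..τ, ∫ x in Ω, (deriv θ t * s.w t x i + θ t * dt s.w i t x) * φ x = 0 := by
  have hfin' := isFiniteMeasure_restrict hΩb
  have hd : Continuous (deriv θ) := hθ.continuous_deriv (by simp)
  have hc : Continuous (fun z : ℝ × E3 =>
      (deriv θ z.1 * s.w z.1 z.2 i + θ z.1 * dt s.w i z.1 z.2) * φ z.2) :=
    (((hd.comp continuous_fst).mul (hs.2.1.continuous_apply i)).add
      ((hθ.continuous.comp continuous_fst).mul (hs.2.1.continuous_dt i))).mul
        (hφ.comp continuous_snd)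
  rw [intervalIntegral.integral_of_le hτ.le, integral_integral_swap
    (f := fun t x => (deriv θ t * s.w t x i + θ t * dt s.w i t x) * φ x)
    (integrable_prod_of_continuous hΩo.measurableSet hΩb hc)]
  refine integral_eq_zero_of_ae (ae_of_all _ fun x => ?_)
  simp only [integral_mul_const, Pi.zero_apply]
  rw [← intervalIntegral.integral_of_le hτ.le]
  have hi : IntervalIntegrable (fun t => deriv θ t * s.w t x i + θ t * dt s.w i t x)
      volume 0 τ := by
    refine Continuous.intervalIntegrable ?_ _ _
    exact (hd.mul ((hs.2.1.continuous_apply i).comp (Continuous.prodMk_left x))).add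
      (hθ.continuous.mul ((hs.2.1.continuous_dt i).comp (Continuous.prodMk_left x)))
  rw [intervalIntegral.integral_eq_sub_of_hasDerivAt (f := fun t => θ t * s.w t x i)
    (fun t _ => (hθ.differentiable (by simp) t).hasDerivAt.mul (hs.2.1.hasDerivAt_apply i t x)) hi,
    h0, h1]
  simp

include hΩo hΩb hs in
theorem integral_lagrangianVelocityVar_add {t : ℝ}
    (hdiv : ∀ x ∈ closure Ω, ∑ j, dx s.w j j t x = 0) {φ : E3 → ℝ} (hφ : IsBoundaryTest Ω φ)
    (θ : ℝ → ℝ) (i : Fin 3) :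
    ∫ x in Ω, (lagrangianVelocityVar ν s θ φ i t x
      + 1 / 2 * ((deriv θ t * s.w t x i + θ t * dt s.w i t x) * φ x)) =
    θ t * ∫ x in Ω, φ x * momentumResidual ν s i t x := by
  have hφ1 : ContDiff ℝ 1 φ := hφ.contDiff.of_le (by norm_num)
  have hU : ∀ k, ContDiff ℝ 1 (fun x => s.u t x k) := fun k =>
    (hs.1.contDiff_apply t k).of_le (by norm_num)
  have hW : ∀ k, ContDiff ℝ 1 (fun x => s.w t x k) := fun k =>
    (hs.2.1.contDiff_apply t k).of_le (by norm_num)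
  -- The coefficient of `∂_j φ` in the first variation. Subtracting the divergence of `c φ`, whose
  -- integral is zero, leaves `φ` times the residual up to a multiple of `div w`.
  let c : Fin 3 → E3 → ℝ := fun j x =>
    ν * dx s.u i j t x - 1 / 2 * ((s.u t x i + s.w t x i) * s.w t x j)
  have hc : ∀ j, ContDiff ℝ 1 (c j) := fun j =>
    (contDiff_const.mul (hs.1.contDiff_dx i j t)).sub
      (contDiff_const.mul (((hU i).add (hW i)).mul (hW j)))
  have hcd : ∀ j x, pd (c j) j x = ν * pd (dx s.u i j t) j x
      - 1 / 2 * ((s.u t x i + s.w t x i) * dx s.w j j t x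
        + (dx s.u i j t x + dx s.w i j t x) * s.w t x j) := by
    intro j x
    have d1 := hs.1.differentiable_dx i j t x
    have d2 := hs.1.differentiable_apply t i x
    have d3 := hs.2.1.differentiable_apply t i x
    have d4 := hs.2.1.differentiable_apply t j x
    have d5 : DifferentiableAt ℝ (fun y => s.u t y i + s.w t y i) x := d2.add d3
    have d6 : DifferentiableAt ℝ (fun y => (s.u t y i + s.w t y i) * s.w t y j) x := d5.mul d4
    simp only [c]
    rw [pd_sub (d1.const_mul _) (d6.const_mul _), pd_const_mul d1, pd_const_mul d6, pd_mul d5 d4,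
      pd_add d2 d3]
    simp only [dx]
  have hint : ∀ j, IntegrableOn (pd (fun y => c j y * φ y) j) Ω := fun j =>
    integrableOn_of_continuous hΩb (continuous_pd ((hc j).mul hφ1) j)
  have hR : Continuous (fun x => φ x * momentumResidual ν s i t x) := hφ1.continuous.mul (continuous_momentumResidual_apply ν hs i t)
  have i1 : IntegrableOn (fun x => θ t * (φ x * momentumResidual ν s i t x)) Ω :=
    (integrableOn_of_continuous hΩb hR).const_mul _
  have i2 : IntegrableOn (fun x => θ t * ∑ j, pd (fun y => c j y * φ y) j x) Ω :=
    (integrable_finsetSum _ fun j _ => hint j).const_mul _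
  have hzero : ∫ x in Ω, ∑ j, pd (fun y => c j y * φ y) j x = 0 := by
    rw [integral_finsetSum _ fun j _ => hint j]
    exact Finset.sum_eq_zero fun j _ => hφ.integral_pd (c j) (hc j) j
  have hsum : ∫ x in Ω, (θ t * (φ x * momentumResidual ν s i t x)
      + θ t * ∑ j, pd (fun y => c j y * φ y) j x) =
      θ t * ∫ x in Ω, φ x * momentumResidual ν s i t x := by
    rw [integral_add i1 i2, integral_const_mul,
      integral_const_mul, hzero, mul_zero, add_zero]
  rw [← hsum]
  refine setIntegral_congr_fun hΩo.measurableSet fun x hx => ?_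
  have hdx := hdiv x (subset_closure hx)
  have hp : ∀ j, pd (fun y => c j y * φ y) j x = c j x * pd φ j x + pd (c j) j x * φ x := fun j =>
    pd_mul ((hc j).differentiable (by simp) x) (hφ1.differentiable (by simp) x) j
  have hlap : lap s.u i t x = ∑ j, pd (dx s.u i j t) j x := rfl
  simp only [hp, hcd, c, lagrangianVelocityVar, momentumResidual, hlap, Fin.sum_univ_three] at hdx ⊢
  linear_combination (θ t * φ x * (s.u t x i + s.w t x i) / 2) * hdx

include hΩo hΩb hΩs hus hws hs in
theorem IsStationary.velocity_weak (hstat : IsStationary ν τ Ω us ws x₀ s) (hτ : 0 < τ)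
    (hx₀ : x₀ ∈ frontier Ω) (hdiv : ∀ t ∈ Icc 0 τ, ∀ x ∈ closure Ω, ∑ j, dx s.w j j t x = 0)
    {φ : E3 → ℝ} (hφ : IsBoundaryTest Ω φ) (i : Fin 3) : ∀ t ∈ Icc 0 τ,
    ∫ x in Ω, φ x * momentumResidual ν s i t x =
      ∫ x, ν * (s.u t x i - us t x i) * (∑ j, pd φ j x * outwardNormal Ω x j)
        ∂(surfaceArea Ω) := by
  have hfin' := isFiniteMeasure_restrict hΩb
  have hφ1 : ContDiff ℝ 1 φ := hφ.contDiff.of_le (by norm_num)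
  have c1 : Continuous (fun t => ∫ x in Ω, φ x * momentumResidual ν s i t x) :=
    continuous_setIntegral hΩo.measurableSet hΩb
      (f := fun z => φ z.2 * momentumResidual ν s i z.1 z.2)
      ((hφ1.continuous.comp continuous_snd).mul (continuous_momentumResidual ν hs i))
  have e2 : ∀ t, ∫ x, ν * (s.u t x i - us t x i) * (∑ j, pd φ j x * outwardNormal Ω x j)
        ∂(surfaceArea Ω) = ∫ x, (∑ j, (ν * (s.u t x i - us t x i) * pd φ j x) * outwardNormal Ω x j)
        ∂(surfaceArea Ω) := by
    intro t
    congr 1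
    ext x
    rw [Finset.mul_sum]
    exact Finset.sum_congr rfl fun j _ => by ring
  have c2 : Continuous (fun t => ∫ x, ν * (s.u t x i - us t x i) *
      (∑ j, pd φ j x * outwardNormal Ω x j) ∂(surfaceArea Ω)) := by
    simp only [e2]
    exact continuous_surface_integral hΩo hΩb hΩs
      (f := fun j z => ν * (s.u z.1 z.2 i - us z.1 z.2 i) * pd φ j z.2) fun j =>
        (continuous_const.mul ((hs.1.continuous_apply i).sub (hus.continuous_apply i))).mul
          ((continuous_pd hφ1 j).comp continuous_snd)
  have key := eq_zero_on_Icc_of_integral_eq_zero hτ (c1.sub c2) fun θ hθ h0 h1 => ?_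
  · exact fun t ht => sub_eq_zero.1 (key t ht)
  have hid := hstat.velocity_identity hΩo hΩb hΩs hus hws hs hτ hx₀ hθ h0 h1 hφ.contDiff
    hφ.eq_zero hφ.normal i
  have hD := integral_deriv_mul_eq_zero hΩo hΩb hs hτ hθ h0 h1 hφ1.continuous i
  have cL := continuous_lagrangianVelocityVar ν hs hθ hφ.contDiff i
  have cD : Continuous (fun z : ℝ × E3 =>
      (deriv θ z.1 * s.w z.1 z.2 i + θ z.1 * dt s.w i z.1 z.2) * φ z.2) :=
    ((((hθ.continuous_deriv (by simp)).comp continuous_fst).mul (hs.2.1.continuous_apply i)).add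
      ((hθ.continuous.comp continuous_fst).mul (hs.2.1.continuous_dt i))).mul
        (hφ1.continuous.comp continuous_snd)
  have hJ : ∫ t in (0 : ℝ)..τ, ∫ x in Ω, lagrangianVelocityVar ν s θ φ i t x =
      ∫ t in (0 : ℝ)..τ, θ t * ∫ x in Ω, φ x * momentumResidual ν s i t x := by
    -- The added half of the time derivative is kept separate here, since it integrates to zero only
    -- over the whole interval.
    have e3 : ∫ t in (0 : ℝ)..τ, θ t * ∫ x in Ω, φ x * momentumResidual ν s i t x =
        ∫ t in (0 : ℝ)..τ, ((∫ x in Ω, lagrangianVelocityVar ν s θ φ i t x) +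
          1 / 2 * ∫ x in Ω, (deriv θ t * s.w t x i + θ t * dt s.w i t x) * φ x) := by
      refine intervalIntegral.integral_congr fun t ht => ?_
      rw [uIcc_of_le hτ.le] at ht
      beta_reduce
      have i1 : IntegrableOn (fun x => lagrangianVelocityVar ν s θ φ i t x) Ω :=
        integrableOn_of_continuous hΩb (cL.comp (Continuous.prodMk_right t))
      have i2 : IntegrableOn (fun x =>
          1 / 2 * ((deriv θ t * s.w t x i + θ t * dt s.w i t x) * φ x)) Ω :=
        (integrableOn_of_continuous hΩb (cD.comp (Continuous.prodMk_right t))).const_mul _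
      rw [← integral_lagrangianVelocityVar_add (ν := ν) hΩo hΩb hs (hdiv t ht) hφ θ i,
        integral_add i1 i2, integral_const_mul]
    rw [e3, intervalIntegral.integral_add
      ((continuous_setIntegral hΩo.measurableSet hΩb cL).intervalIntegrable _ _)
      (((continuous_setIntegral hΩo.measurableSet hΩb cD).const_mul _).intervalIntegrable _ _),
      intervalIntegral.integral_const_mul, hD, mul_zero, add_zero]
  have hS : ∀ t, ∫ x, θ t * (ν * (-(s.u t x i - us t x i) *
        ∑ j, pd φ j x * outwardNormal Ω x j)) ∂(surfaceArea Ω) =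
      θ t * -∫ x, ν * (s.u t x i - us t x i) * (∑ j, pd φ j x * outwardNormal Ω x j)
        ∂(surfaceArea Ω) := by
    intro t
    rw [integral_const_mul, ← integral_neg]
    congr 2
    ext x
    ring
  rw [hJ] at hid
  simp only [hS] at hid
  refine Eq.trans ?_ ((intervalIntegral.integral_add
    ((hθ.continuous.mul c1).intervalIntegrable _ _)
    ((hθ.continuous.mul c2.neg).intervalIntegrable _ _)).trans hid)
  congr 1
  ext t
  simp only [Pi.sub_apply, Pi.mul_apply, Pi.neg_apply]
  ring

include hΩo hΩb hΩs hus hws hs in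
theorem IsStationary.momentumResidual_eq_zero (hstat : IsStationary ν τ Ω us ws x₀ s) (hτ : 0 < τ)
    (hx₀ : x₀ ∈ frontier Ω) (hdiv : ∀ t ∈ Icc 0 τ, ∀ x ∈ closure Ω, ∑ j, dx s.w j j t x = 0)
    (i : Fin 3) : ∀ t ∈ Icc 0 τ, ∀ x ∈ closure Ω, momentumResidual ν s i t x = 0 := by
  intro t ht
  refine eq_zero_on_closure_of_integral_eq_zero (μ := volume) hΩo
    (continuous_momentumResidual_apply ν hs i t) fun φ hφ hφc hφs => ?_
  have htest := isBoundaryTest_of_tsupport_subset hΩo (hφ.of_le (by norm_cast)) hφc hφs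
  refine (hstat.velocity_weak hΩo hΩb hΩs hus hws hs hτ hx₀ hdiv htest i t ht).trans ?_
  refine integral_eq_zero_of_ae ?_
  rw [surfaceArea]
  refine (ae_restrict_mem (frontier_measurableSet Ω)).mono fun x hx => ?_
  have h0 : fderiv ℝ φ x = 0 := image_eq_zero_of_notMem_tsupport fun hx' => by
    rw [hΩo.frontier_eq] at hx
    exact hx.2 (hφs (tsupport_fderiv_subset ℝ hx'))
  simp [pd, h0]

include hΩo hΩb hΩs hus hws hs in
-- The test function `ρ ψ` vanishes on `∂Ω` but has normal derivative `|∇ρ| ψ` there. The residual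
-- being zero, the weak identity reduces to `∫_∂Ω ν (u_i - u_i^s) |∇ρ| ψ = 0`.
theorem IsStationary.u_eq (hstat : IsStationary ν τ Ω us ws x₀ s) (hτ : 0 < τ)
    (hx₀ : x₀ ∈ frontier Ω) (hdiv : ∀ t ∈ Icc 0 τ, ∀ x ∈ closure Ω, ∑ j, dx s.w j j t x = 0)
    (hν : ν ≠ 0) : ∀ t ∈ Icc 0 τ, ∀ x ∈ frontier Ω, s.u t x = us t x := by
  intro t ht x hx
  ext i
  obtain ⟨ρ, h⟩ := hΩs x hx
  obtain ⟨U, hU, hUρ, hUt⟩ := exists_isBoundaryTest hΩo hΩs hx h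
  have hgc : Continuous (gradient ρ) := by
    unfold gradient
    exact (LinearIsometryEquiv.continuous _).comp (h.1.continuous_fderiv (by simp))
  have hf : Continuous (fun y => ν * (s.u t y i - us t y i) * ‖gradient ρ y‖) :=
    (continuous_const.mul (((hs.1.continuous_apply i).sub (hus.continuous_apply i)).comp
      (Continuous.prodMk_right t))).mul hgc.norm
  -- `M = 0` because the surface integral vanishes exactly.
  have key := eq_zero_of_boundary_test hΩo hΩb hΩs hx hf.continuousOn (M := 0) fun η _ _ =>
    ⟨U, hU, fun ψ hψ hψc hψs _ => ?_⟩
  · have hg : ‖gradient ρ x‖ ≠ 0 := norm_ne_zero_iff.2 h.2.1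
    simpa [hν, hg, sub_eq_zero, h.2.1] using key
  · have h1 := hstat.velocity_weak hΩo hΩb hΩs hus hws hs hτ hx₀ hdiv (hUt ψ hψ hψc hψs) i t ht
    have hres := hstat.momentumResidual_eq_zero hΩo hΩb hΩs hus hws hs hτ hx₀ hdiv i t ht
    have h2 : ∫ x in Ω, (ρ x * ψ x) * momentumResidual ν s i t x = 0 := by
      rw [setIntegral_congr_fun (g := fun _ => (0 : ℝ)) hΩo.measurableSet fun x hx => ?_]
      · simp
      · simp [hres x (subset_closure hx)]
    rw [h2] at h1
    have h3 : ∫ y, ν * (s.u t y i - us t y i) * ‖gradient ρ y‖ * ψ y ∂(surfaceArea Ω) = 0 := by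
      rw [h1]
      refine integral_congr_ae ?_
      rw [surfaceArea]
      refine (ae_restrict_mem (frontier_measurableSet Ω)).mono fun y hy => ?_
      have h4 : ∑ j, pd (fun y => ρ y * ψ y) j y * outwardNormal Ω y j =
          ψ y * ‖gradient ρ y‖ := by
        simp only [pd_defining_mul hΩo h.1 hUρ hψ hψs hy]
        obtain ⟨σ, hσ⟩ := hΩs y hy
        have h5 := hσ.norm_outwardNormal hΩo hy
        have h6 : ∑ j, outwardNormal Ω y j * outwardNormal Ω y j = 1 := by
          have := EuclideanSpace.norm_sq_eq (outwardNormal Ω y)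
          rw [h5] at this
          simpa [sq] using this.symm
        simp only [mul_assoc]
        rw [← Finset.mul_sum, ← Finset.mul_sum, h6, mul_one]
      beta_reduce
      rw [h4]
      ring
    rw [h3]
    simp

end Velocity

/-! ### Exchanging `(u, p)` and `(w, r)` -/

/-- The fields with `(u, p)` and `(w, r)` exchanged. -/
def Fields.swap (s : Fields) : Fields := ⟨s.w, s.r, s.u, s.p⟩

theorem Fields.Regular.swap {s : Fields} (hs : s.Regular) : s.swap.Regular :=
  ⟨hs.2.1, hs.1, hs.2.2.2, hs.2.2.1⟩

theorem lagrangian_swap (ν : ℝ) (s : Fields) (t : ℝ) (x : E3) :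
    lagrangian ν s.swap t x = -lagrangian ν s t x := by
  simp only [lagrangian, Fields.swap]
  ring

/-- The norm involves the symmetric combination `u - u^s + w - w^s`; every other factor or bracket
changes sign under the exchange. -/
theorem surfaceDensity_swap (ν : ℝ) (us ws : ℝ → E3 → E3) (s : Fields) (j : Fin 3) (t : ℝ)
    (x : E3) : surfaceDensity ν ws us s.swap j t x = -surfaceDensity ν us ws s j t x := by
  have h : (fun y => ‖s.w t y - ws t y + s.u t y - us t y‖) =
      fun y => ‖s.u t y - us t y + s.w t y - ws t y‖ := by
    ext y
    congr 1
    abel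
  simp only [surfaceDensity, Fields.swap, h, Fin.sum_univ_three]
  ring

theorem functionalI_swap (ν τ : ℝ) (Ω : Set E3) (us ws : ℝ → E3 → E3) (s : Fields) :
    functionalI ν τ Ω ws us s.swap = -functionalI ν τ Ω us ws s := by
  simp only [functionalI, functionalJ, lagrangian_swap, surfaceDensity_swap, neg_mul,
    Finset.sum_neg_distrib, integral_neg, intervalIntegral.integral_neg]
  ring

theorem IsVariation.swap {τ : ℝ} {Ω : Set E3} {x₀ : E3} {d : Fields}
    (hd : IsVariation τ Ω x₀ d) : IsVariation τ Ω x₀ d.swap :=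
  ⟨⟨hd.1.1.swap, fun x hx => (hd.1.2.1 x hx).symm, fun x hx => (hd.1.2.2.1 x hx).symm,
    fun t ht => (hd.1.2.2.2 t ht).symm⟩, fun t ht x hx => (add_comm _ _).trans (hd.2 t ht x hx)⟩

/-- Transfers every result on `(u, p)` to `(w, r)`: the class of variations is invariant under the
exchange, and a sign does not affect stationarity. -/
theorem IsStationary.swap {ν τ : ℝ} {Ω : Set E3} {us ws : ℝ → E3 → E3} {x₀ : E3} {s : Fields}
    (hstat : IsStationary ν τ Ω us ws x₀ s) : IsStationary ν τ Ω ws us x₀ s.swap := by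
  intro d hd
  have h : (fun ε => functionalI ν τ Ω ws us (s.swap.perturb d ε)) =
      fun ε => -functionalI ν τ Ω us ws (s.perturb d.swap ε) :=
    funext fun ε => functionalI_swap ν τ Ω us ws (s.perturb d.swap ε)
  rw [h]
  have hneg := (hstat d.swap hd.swap).fun_neg
  rwa [neg_zero] at hneg

/-! ### Mean and difference fields -/

section Linear

variable {s : Fields} (hs : s.Regular) (i j : Fin 3) (t : ℝ) (x : E3)

include hs in
theorem dx_meanVelocity : dx s.meanVelocity i j t x = (dx s.u i j t x + dx s.w i j t x) / 2 := by
  have d1 := hs.1.differentiable_apply t i x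
  have d2 := hs.2.1.differentiable_apply t i x
  have d3 : DifferentiableAt ℝ (fun y => s.u t y i + s.w t y i) x := d1.add d2
  have h : (fun y => s.meanVelocity t y i) = fun y => 2⁻¹ * (s.u t y i + s.w t y i) := rfl
  rw [dx, h, pd_const_mul d3, pd_add d1 d2]
  simp only [dx]
  ring

include hs in
theorem dx_diffVelocity : dx s.diffVelocity i j t x = (dx s.u i j t x - dx s.w i j t x) / 2 := by
  have d1 := hs.1.differentiable_apply t i x
  have d2 := hs.2.1.differentiable_apply t i x
  have d3 : DifferentiableAt ℝ (fun y => s.u t y i - s.w t y i) x := d1.sub d2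
  have h : (fun y => s.diffVelocity t y i) = fun y => 2⁻¹ * (s.u t y i - s.w t y i) := rfl
  rw [dx, h, pd_const_mul d3, pd_sub d1 d2]
  simp only [dx]
  ring

include hs in
theorem lap_meanVelocity : lap s.meanVelocity i t x = (lap s.u i t x + lap s.w i t x) / 2 := by
  have h : ∀ j, pd (fun y => dx s.meanVelocity i j t y) j x =
      (pd (dx s.u i j t) j x + pd (dx s.w i j t) j x) / 2 := by
    intro j
    have d1 := hs.1.differentiable_dx i j t x
    have d2 := hs.2.1.differentiable_dx i j t x
    have d3 : DifferentiableAt ℝ (fun y => dx s.u i j t y + dx s.w i j t y) x := d1.add d2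
    have e : (fun y => dx s.meanVelocity i j t y) =
        fun y => 2⁻¹ * (dx s.u i j t y + dx s.w i j t y) := by
      ext y
      rw [dx_meanVelocity hs]
      ring
    rw [e, pd_const_mul d3, pd_add d1 d2]
    ring
  simp only [lap, h, Fin.sum_univ_three]
  ring

include hs in
theorem lap_diffVelocity : lap s.diffVelocity i t x = (lap s.u i t x - lap s.w i t x) / 2 := by
  have h : ∀ j, pd (fun y => dx s.diffVelocity i j t y) j x =
      (pd (dx s.u i j t) j x - pd (dx s.w i j t) j x) / 2 := by
    intro j
    have d1 := hs.1.differentiable_dx i j t x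
    have d2 := hs.2.1.differentiable_dx i j t x
    have d3 : DifferentiableAt ℝ (fun y => dx s.u i j t y - dx s.w i j t y) x := d1.sub d2
    have e : (fun y => dx s.diffVelocity i j t y) =
        fun y => 2⁻¹ * (dx s.u i j t y - dx s.w i j t y) := by
      ext y
      rw [dx_diffVelocity hs]
      ring
    rw [e, pd_const_mul d3, pd_sub d1 d2]
    ring
  simp only [lap, h, Fin.sum_univ_three]
  ring

include hs in
theorem dt_meanVelocity : dt s.meanVelocity i t x = (dt s.u i t x + dt s.w i t x) / 2 := by
  refine (((hs.1.hasDerivAt_apply i t x).add (hs.2.1.hasDerivAt_apply i t x)).const_mul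
    (2⁻¹ : ℝ)).deriv.trans ?_
  ring

include hs in
theorem dt_diffVelocity : dt s.diffVelocity i t x = (dt s.u i t x - dt s.w i t x) / 2 := by
  refine (((hs.1.hasDerivAt_apply i t x).sub (hs.2.1.hasDerivAt_apply i t x)).const_mul
    (2⁻¹ : ℝ)).deriv.trans ?_
  ring

include hs in
theorem pd_diffPressure : pd (s.diffPressure t) i x = (pd (s.p t) i x - pd (s.r t) i x) / 2 := by
  have d1 := hs.2.2.1.differentiable t x
  have d2 := hs.2.2.2.differentiable t x
  have d3 : DifferentiableAt ℝ (fun y => s.p t y - s.r t y) x := d1.sub d2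
  have h : s.diffPressure t = fun y => 2⁻¹ * (s.p t y - s.r t y) := by
    ext y
    rw [Fields.diffPressure]
    ring
  rw [h, pd_const_mul d3, pd_sub d1 d2]
  ring

include hs in
-- The term `|v|²/2` contributes `v_j ∂_i v_j`, exactly the transposed part of `v_j (∂_j v_i + ∂_i
-- v_j)` that the Navier–Stokes equations lack.
theorem pd_meanPressure : pd (s.meanPressure t) i x = (pd (s.p t) i x + pd (s.r t) i x) / 2
    + ∑ j, s.meanVelocity t x j * dx s.meanVelocity j i t x := by
  have d1 := hs.2.2.1.differentiable t x
  have d2 := hs.2.2.2.differentiable t x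
  have d3 : DifferentiableAt ℝ (fun y => s.p t y + s.r t y) x := d1.add d2
  have hv : ∀ j, DifferentiableAt ℝ (fun y => s.meanVelocity t y j) x := fun j =>
    ((hs.1.differentiable_apply t j x).add (hs.2.1.differentiable_apply t j x)).const_mul (2⁻¹ : ℝ)
  have hm : ∀ j, DifferentiableAt ℝ (fun y => s.meanVelocity t y j * s.meanVelocity t y j) x :=
    fun j => (hv j).mul (hv j)
  have d4 : DifferentiableAt ℝ (fun y => s.meanVelocity t y 0 * s.meanVelocity t y 0
    + s.meanVelocity t y 1 * s.meanVelocity t y 1) x := (hm 0).add (hm 1)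
  have d5 : DifferentiableAt ℝ (fun y => s.meanVelocity t y 0 * s.meanVelocity t y 0
    + s.meanVelocity t y 1 * s.meanVelocity t y 1
    + s.meanVelocity t y 2 * s.meanVelocity t y 2) x := d4.add (hm 2)
  have h : s.meanPressure t = fun y => 2⁻¹ * (s.p t y + s.r t y) +
      2⁻¹ * (s.meanVelocity t y 0 * s.meanVelocity t y 0
        + s.meanVelocity t y 1 * s.meanVelocity t y 1
        + s.meanVelocity t y 2 * s.meanVelocity t y 2) := by
    ext y
    rw [Fields.meanPressure, EuclideanSpace.real_norm_sq_eq, Fin.sum_univ_three]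
    ring
  rw [h, pd_add (d3.const_mul _) (d5.const_mul _), pd_const_mul d3, pd_const_mul d5,
    pd_add d1 d2, pd_add d4 (hm 2), pd_add (hm 0) (hm 1), pd_mul (hv 0) (hv 0),
    pd_mul (hv 1) (hv 1), pd_mul (hv 2) (hv 2), Fin.sum_univ_three]
  simp only [dx]
  ring

end Linear

theorem EulerLagrange.navierStokes {ν τ : ℝ} {Ω : Set E3} {s : Fields} (hs : s.Regular)
    (h : EulerLagrange ν τ Ω s) : NavierStokes ν τ Ω s.meanVelocity s.meanPressure := by
  intro t ht x hx
  obtain ⟨hu, hw, h1, h2⟩ := h t ht x hx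
  have hv : ∀ j, s.meanVelocity t x j = 2⁻¹ * (s.u t x j + s.w t x j) := fun j => rfl
  refine ⟨?_, fun i => ?_⟩
  · simp only [dx_meanVelocity hs, Fin.sum_univ_three] at hu hw ⊢
    linear_combination hu / 2 + hw / 2
  · have e1 := h1 i
    have e2 := h2 i
    rw [pd_meanPressure hs, dt_meanVelocity hs, lap_meanVelocity hs]
    simp only [dx_meanVelocity hs, hv, Fin.sum_univ_three] at e1 e2 ⊢
    linear_combination -e1 / 2 - e2 / 2

/-- Half the difference of the momentum equations. Each pairs the Laplacian of one field with the
time derivative and gradients of the other, whence the minus signs on the right. -/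
theorem EulerLagrange.adjointSystem {ν τ : ℝ} {Ω : Set E3} {s : Fields} (hs : s.Regular)
    (h : EulerLagrange ν τ Ω s) :
    AdjointSystem ν τ Ω s.meanVelocity s.diffVelocity s.diffPressure := by
  intro t ht x hx
  obtain ⟨hu, hw, h1, h2⟩ := h t ht x hx
  have hv : ∀ j, s.meanVelocity t x j = 2⁻¹ * (s.u t x j + s.w t x j) := fun j => rfl
  refine ⟨?_, fun i => ?_⟩
  · simp only [dx_diffVelocity hs, Fin.sum_univ_three] at hu hw ⊢
    linear_combination hu / 2 - hw / 2
  · have e1 := h1 i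
    have e2 := h2 i
    rw [pd_diffPressure hs, dt_diffVelocity hs, lap_diffVelocity hs]
    simp only [dx_diffVelocity hs, hv, Fin.sum_univ_three] at e1 e2 ⊢
    linear_combination e1 / 2 - e2 / 2

/-! ### Boundary conditions -/

theorem NaturalBoundaryCondition.congr {ν τ : ℝ} {Ω : Set E3} {v vs vs' : ℝ → E3 → E3}
    (h : NaturalBoundaryCondition ν τ Ω v vs)
    (he : ∀ t ∈ Icc 0 τ, ∀ x ∈ frontier Ω, vs t x = vs' t x) :
    NaturalBoundaryCondition ν τ Ω v vs' := by
  intro t ht x hx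
  rw [← he t ht x hx]
  exact h t ht x hx

theorem NaturalBoundaryCondition.meanVelocity {ν τ : ℝ} {Ω : Set E3} {s : Fields}
    {us : ℝ → E3 → E3} (hu : NaturalBoundaryCondition ν τ Ω s.u us)
    (hw : NaturalBoundaryCondition ν τ Ω s.w us) :
    NaturalBoundaryCondition ν τ Ω s.meanVelocity us := by
  intro t ht x hx
  obtain ⟨h1, h2⟩ := hu t ht x hx
  obtain ⟨h3, h4⟩ := hw t ht x hx
  have hv : ∀ j, s.meanVelocity t x j = 2⁻¹ * (s.u t x j + s.w t x j) := fun j => rfl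
  refine ⟨?_, fun hν => ?_⟩
  · simp only [hv, Fin.sum_univ_three] at h1 h3 ⊢
    linear_combination h1 / 2 + h3 / 2
  · rw [Fields.meanVelocity, h2 hν, h4 hν]
    module

theorem NaturalBoundaryCondition.diffVelocity {ν τ : ℝ} {Ω : Set E3} {s : Fields}
    {us : ℝ → E3 → E3} (hu : NaturalBoundaryCondition ν τ Ω s.u us)
    (hw : NaturalBoundaryCondition ν τ Ω s.w us) :
    NaturalBoundaryCondition ν τ Ω s.diffVelocity (fun _ _ => 0) := by
  intro t ht x hx
  obtain ⟨h1, h2⟩ := hu t ht x hx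
  obtain ⟨h3, h4⟩ := hw t ht x hx
  have hv : ∀ j, s.diffVelocity t x j = 2⁻¹ * (s.u t x j - s.w t x j) := fun j => rfl
  refine ⟨?_, fun hν => ?_⟩
  · simp only [hv, Fin.sum_univ_three, PiLp.zero_apply] at h1 h3 ⊢
    linear_combination h1 / 2 - h3 / 2
  · rw [Fields.diffVelocity, h2 hν, h4 hν]
    module

theorem IsStationary.eulerLagrange {ν τ : ℝ} {Ω : Set E3} (hΩo : IsOpen Ω)
    (hΩb : Bornology.IsBounded Ω) (hΩs : HasSmoothBoundary Ω) {us ws : ℝ → E3 → E3}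
    (hus : SpaceC1 us) (hws : SpaceC1 ws) {x₀ : E3} {s : Fields} (hs : s.Regular)
    (hstat : IsStationary ν τ Ω us ws x₀ s) (hτ : 0 < τ) (hx₀ : x₀ ∈ frontier Ω) :
    EulerLagrange ν τ Ω s := by
  have hdu := hstat.div_u hΩo hΩb hΩs hus hws hs hτ
  have hdw := hstat.swap.div_u hΩo hΩb hΩs hws hus hs.swap hτ
  intro t ht x hx
  refine ⟨hdu t ht x hx, hdw t ht x hx, fun i => ?_, fun i => ?_⟩
  · have h := hstat.momentumResidual_eq_zero hΩo hΩb hΩs hus hws hs hτ hx₀ hdw i t ht x hx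
    rw [momentumResidual] at h
    linear_combination -h
  · have h := hstat.swap.momentumResidual_eq_zero hΩo hΩb hΩs hws hus hs.swap hτ hx₀ hdu i t ht x hx
    simp only [momentumResidual, Fields.swap, add_comm (s.w t x _)] at h
    linear_combination -h

theorem IsStationary.naturalBoundaryCondition_u {ν τ : ℝ} {Ω : Set E3} (hΩo : IsOpen Ω)
    (hΩb : Bornology.IsBounded Ω) (hΩs : HasSmoothBoundary Ω) {us ws : ℝ → E3 → E3}
    (hus : SpaceC1 us) (hws : SpaceC1 ws) {x₀ : E3} {s : Fields} (hs : s.Regular)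
    (hstat : IsStationary ν τ Ω us ws x₀ s) (hτ : 0 < τ) (hx₀ : x₀ ∈ frontier Ω) :
    NaturalBoundaryCondition ν τ Ω s.u us := fun t ht x hx =>
  ⟨hstat.normal_u hΩo hΩb hΩs hus hws hs hτ t ht x hx, fun hν =>
    hstat.u_eq hΩo hΩb hΩs hus hws hs hτ hx₀
      (hstat.swap.div_u hΩo hΩb hΩs hws hus hs.swap hτ) hν t ht x hx⟩

end ExtendedNS

theorem mainTheorem3 (ν τ : ℝ) (hν : 0 ≤ ν) (hτ : 0 < τ)
    (Ω : Set ExtendedNS.E3) (hΩo : IsOpen Ω) (hΩb : Bornology.IsBounded Ω)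
    (hΩs : ExtendedNS.HasSmoothBoundary Ω)
    (us ws : ℝ → ExtendedNS.E3 → ExtendedNS.E3)
    (hus : ExtendedNS.SpaceC1 us) (hws : ExtendedNS.SpaceC1 ws)
    (g : ExtendedNS.E3 → ExtendedNS.E3)
    (x₀ : ExtendedNS.E3) (hx₀ : x₀ ∈ frontier Ω)
    (s : ExtendedNS.Fields) (hs : ExtendedNS.Admissible τ Ω g x₀ s)
    (hstat : ExtendedNS.IsStationary ν τ Ω us ws x₀ s) :
    ExtendedNS.EulerLagrange ν τ Ω s ∧
    ExtendedNS.NavierStokes ν τ Ω s.meanVelocity s.meanPressure ∧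
    ExtendedNS.AdjointSystem ν τ Ω s.meanVelocity s.diffVelocity s.diffPressure ∧
    ExtendedNS.NaturalBoundaryCondition ν τ Ω s.u us ∧
    ExtendedNS.NaturalBoundaryCondition ν τ Ω s.w ws ∧
    ((∀ t ∈ Set.Icc 0 τ, ∀ x ∈ frontier Ω, ws t x = 0) →
      ExtendedNS.NaturalBoundaryCondition ν τ Ω s.w (fun _ _ => 0)) ∧
    ((∀ t ∈ Set.Icc 0 τ, ∀ x ∈ frontier Ω, ws t x = us t x) →
      ExtendedNS.NaturalBoundaryCondition ν τ Ω s.meanVelocity us ∧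
      ExtendedNS.NaturalBoundaryCondition ν τ Ω s.diffVelocity (fun _ _ => 0)) := by
  have hEL := hstat.eulerLagrange hΩo hΩb hΩs hus hws hs.1 hτ hx₀
  have hu := hstat.naturalBoundaryCondition_u hΩo hΩb hΩs hus hws hs.1 hτ hx₀
  -- The result for `u`, applied to the exchanged fields with exchanged surface values.
  have hw : ExtendedNS.NaturalBoundaryCondition ν τ Ω s.w ws :=
    hstat.swap.naturalBoundaryCondition_u hΩo hΩb hΩs hws hus hs.1.swap hτ hx₀
  exact ⟨hEL, hEL.navierStokes hs.1, hEL.adjointSystem hs.1, hu, hw, fun h => hw.congr h,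
    fun h => ⟨hu.meanVelocity (hw.congr h), hu.diffVelocity (hw.congr h)⟩⟩
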